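/- Let $n\ge 1$ and let $(\mathcal X,g,N)$ be a null--Kähler manifold of dimension $4n$: $\mathcal X$ is a smooth (Hausdorff, second countable) manifold, $g$ is a smooth pseudo-Riemannian metric of signature $(2n,2n)$, and $N$ is a smooth endomorphism of $T\mathcal X$ with $N^2=0$ whose kernel is an integrable distribution of rank $2n$, such that $g(NX,Y)=-g(X,NY)$ and $\nabla N=0$ for the Levi-Civita connection $\nabla$ of $g$. Put $\Omega(X,Y)=g(NX,Y)$ and let $\Omega^{\wedge n}$ be its $n$-th exterior power, a $2n$-form. Let $\mathbb S=\mathbb S_+\oplus\mathbb S_-$ be the real $2^{2n}$-dimensional spin space of $\mathbb R^{2n,2n}$, with Clifford multiplication $\gamma(v)\gamma(w)+\gamma(w)\gamma(v)=2g(v,w)\mathbf 1$, and let $\mathrm{Spin}(2n,2n)$ be the group generated by the products $\gamma(v)\gamma(w)$ of vectors of squared norm $\pm1$. A semi-spinor $\psi$ (an element of $\mathbb S_+$ or of $\mathbb S_-$) is called pure if $\dim\{v:\gamma(v)\psi=0\}=2n$. Let $\langle\phi,\psi\rangle=\phi^{T}C\psi$, where $C$ is the product $\gamma(e_1)\cdots\gamma(e_{2n})$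 over the standard basis vectors of square $+1$ (in a basis of $\mathbb S$ for which the gamma matrices of these vectors are symmetric and those of the basis vectors of square $-1$ are skew); then $\langle\gamma(v)\phi,\psi\rangle=-\langle\phi,\gamma(v)\psi\rangle$. Say that a spinor $\psi$ corresponds to the $2n$-form $$\xi_\psi(v_1,\dots,v_{2n})=\Big\langle\psi,\ \frac1{(2n)!}\sum_{\sigma\in S_{2n}}\operatorname{sgn}(\sigma)\,\gamma(v_{\sigma(1)})\cdots\gamma(v_{\sigma(2n)})\,\psi\Big\rangle .$$ A spin structure on $(\mathcal X,g)$ is a smooth $\mathrm{Spin}(2n,2n)$-valued cocycle lifting the transition functions of a family of local pseudo-orthonormal frames whose domains cover $\mathcal X$; the spinor bundle and its covariant derivative are the ones induced by the spin structure and by $\nabla$. Then: 1. $\Omega^{\wedge n}$ is parallel. 2. $(\mathcal X,g)$ admits a spin structure together with a smooth section $\psi$ of the bundle of positive semi-spinors which is pure at every point, is parallel, satisfies $X\cdot\psi=0\iff NX=0$ for every tangent vector $X$, and corresponds to $\Omega^{\wedge n}$, that is, $\xi_\psi=\Omega^{\wedge n}$ in every frame of the spin structure. 3. The pair is canonical: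 if each of two spin structures on $(\mathcal X,g)$ is equipped with a smooth section of positive pure semi-spinors corresponding to $\Omega^{\wedge n}$, then there is an isomorphism of spin structures over the identity of $(\mathcal X,g)$ that carries one section to the other. -/

import Mathlib

open Set Bundle
open scoped Manifold ContDiff Topology

universe u

namespace NullKahler

noncomputable section

/-! ### The quadratic space of signature `(2n, 2n)`, its spin module and its spin group -/

/-- Labels of a pseudo-orthonormal basis in signature `(2n, 2n)`:
`Sum.inl i` has square `+1` and `Sum.inr i` has square `-1`. -/
abbrev Idx (n : ℕ) : Type := Fin (2 * n) ⊕ Fin (2 * n)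

/-- The squares of the vectors of a pseudo-orthonormal basis. -/
def eta {n : ℕ} : Idx n → ℝ := Sum.elim (fun _ ↦ 1) (fun _ ↦ -1)

/-- The vector space underlying `ℝ^{2n,2n}`. -/
abbrev Vec (n : ℕ) : Type := Idx n → ℝ

/-- The standard inner product of signature `(2n, 2n)`. -/
def stdInner {n : ℕ} (v w : Vec n) : ℝ := ∑ a, eta a * v a * w a

/-- The spin space `𝕊`, of dimension `2^{2n}`, in its Fock basis indexed by the subsets of
`{0, …, 2n - 1}`. -/
abbrev Spinor (n : ℕ) : Type := Finset (Fin (2 * n)) → ℝ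

/-- The Jordan–Wigner sign: `-1` to the number of elements of `A` that are smaller than `i`. -/
def jwSign {m : ℕ} (i : Fin m) (A : Finset (Fin m)) : ℝ := (-1) ^ (A.filter (· < i)).card

/-- The creation operator `a†_i`. -/
def create {n : ℕ} (i : Fin (2 * n)) : Module.End ℝ (Spinor n) where
  toFun ψ A := if i ∈ A then jwSign i A * ψ (A.erase i) else 0
  map_add' ψ φ := by ext A; by_cases h : i ∈ A <;> simp [h, mul_add]
  map_smul' c ψ := by ext A; by_cases h : i ∈ A <;> simp [h, mul_left_comm]

/-- The annihilation operator `a_i`. -/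
def annih {n : ℕ} (i : Fin (2 * n)) : Module.End ℝ (Spinor n) where
  toFun ψ A := if i ∈ A then 0 else jwSign i A * ψ (insert i A)
  map_add' ψ φ := by ext A; by_cases h : i ∈ A <;> simp [h, mul_add]
  map_smul' c ψ := by ext A; by_cases h : i ∈ A <;> simp [h, mul_left_comm]

/-- Clifford multiplication `γ : ℝ^{2n,2n} → End 𝕊`.  The gamma matrices of the standard basis are
`a†_i + a_i` (square `+1`) and `a†_i - a_i` (square `-1`). -/
def gamma {n : ℕ} : Vec n →ₗ[ℝ] Module.End ℝ (Spinor n) where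
  toFun v := ∑ i, ((v (Sum.inl i) + v (Sum.inr i)) • create i +
    (v (Sum.inl i) - v (Sum.inr i)) • annih i)
  map_add' v w := by
    rw [← Finset.sum_add_distrib]
    refine Finset.sum_congr rfl fun i _ ↦ ?_
    simp only [Pi.add_apply]
    module
  map_smul' c v := by
    rw [Finset.smul_sum]
    refine Finset.sum_congr rfl fun i _ ↦ ?_
    simp only [Pi.smul_apply, smul_eq_mul, RingHom.id_apply]
    module

lemma jwSign_mul_self {m : ℕ} (i : Fin m) (A : Finset (Fin m)) :
    jwSign i A * jwSign i A = 1 := by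
  unfold jwSign
  rw [← mul_pow]
  norm_num

lemma jwSign_insert {m : ℕ} {i j : Fin m} {A : Finset (Fin m)} (hj : j ∉ A) :
    jwSign i (insert j A) = if j < i then -jwSign i A else jwSign i A := by
  unfold jwSign
  rw [Finset.filter_insert]
  split_ifs with h
  · rw [Finset.card_insert_of_notMem (by simp [hj]), pow_succ]
    ring
  · rfl

lemma jwSign_erase {m : ℕ} {i j : Fin m} {A : Finset (Fin m)} (hj : j ∈ A) :
    jwSign i (A.erase j) = if j < i then -jwSign i A else jwSign i A := by
  have h := jwSign_insert (i := i) (Finset.notMem_erase j A)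
  rw [Finset.insert_erase hj] at h
  split_ifs with hji
  · simp [h, hji]
  · simp [h, hji]

lemma create_apply {n : ℕ} (i : Fin (2 * n)) (ψ : Spinor n) (A : Finset (Fin (2 * n))) :
    create i ψ A = if i ∈ A then jwSign i A * ψ (A.erase i) else 0 := rfl

lemma annih_apply {n : ℕ} (i : Fin (2 * n)) (ψ : Spinor n) (A : Finset (Fin (2 * n))) :
    annih i ψ A = if i ∈ A then 0 else jwSign i A * ψ (insert i A) := rfl

lemma create_create {n : ℕ} (i j : Fin (2 * n)) :
    create (n := n) i * create j + create j * create i = 0 := by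
  refine LinearMap.ext fun ψ ↦ funext fun A ↦ ?_
  simp only [LinearMap.add_apply, Module.End.mul_apply, Pi.add_apply, create_apply,
    LinearMap.zero_apply, Pi.zero_apply]
  rcases eq_or_ne i j with rfl | hij
  · simp
  by_cases hi : i ∈ A <;> by_cases hj : j ∈ A <;>
    simp [hi, hj, hij, hij.symm, jwSign_erase]
  rw [Finset.erase_right_comm]
  rcases lt_or_gt_of_ne hij with h | h <;> simp [h, h.not_gt] <;> ring

lemma annih_annih {n : ℕ} (i j : Fin (2 * n)) :
    annih (n := n) i * annih j + annih j * annih i = 0 := by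
  refine LinearMap.ext fun ψ ↦ funext fun A ↦ ?_
  simp only [LinearMap.add_apply, Module.End.mul_apply, Pi.add_apply, annih_apply,
    LinearMap.zero_apply, Pi.zero_apply]
  rcases eq_or_ne i j with rfl | hij
  · simp
  by_cases hi : i ∈ A <;> by_cases hj : j ∈ A <;>
    simp [hi, hj, hij, hij.symm, jwSign_insert]
  rw [Finset.insert_comm]
  rcases lt_or_gt_of_ne hij with h | h <;> simp [h, h.not_gt] <;> ring

lemma create_annih {n : ℕ} (i j : Fin (2 * n)) :
    create (n := n) i * annih j + annih j * create i = if i = j then 1 else 0 := by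
  refine LinearMap.ext fun ψ ↦ funext fun A ↦ ?_
  rcases eq_or_ne i j with rfl | hij
  · simp only [LinearMap.add_apply, Module.End.mul_apply, Pi.add_apply, annih_apply, create_apply,
      if_true, Module.End.one_apply]
    by_cases hi : i ∈ A
    · simp [hi, jwSign_erase, ← mul_assoc, jwSign_mul_self, Finset.insert_erase]
    · simp [hi, jwSign_insert, ← mul_assoc, jwSign_mul_self]
  · simp only [LinearMap.add_apply, Module.End.mul_apply, Pi.add_apply, annih_apply, create_apply,
      hij, if_false, LinearMap.zero_apply, Pi.zero_apply]
    by_cases hi : i ∈ A <;> by_cases hj : j ∈ A <;>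
      simp [hi, hj, hij, hij.symm, jwSign_insert, jwSign_erase]
    rw [Finset.erase_insert_of_ne hij.symm]
    rcases lt_or_gt_of_ne hij with h | h <;> simp [h, h.not_gt] <;> ring

/-- The Clifford relation `γ(v)γ(w) + γ(w)γ(v) = 2 g(v, w) 1`. -/
theorem gamma_clifford {n : ℕ} (v w : Vec n) :
    gamma v * gamma w + gamma w * gamma v =
      (2 * stdInner v w) • (1 : Module.End ℝ (Spinor n)) := by
  have key : ∀ (a b c d : ℝ) (i j : Fin (2 * n)),
      (a • create i + b • annih i) * (c • create (n := n) j + d • annih j) +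
        (c • create j + d • annih j) * (a • create i + b • annih i) =
      if i = j then (a * d + b * c) • (1 : Module.End ℝ (Spinor n)) else 0 := by
    intro a b c d i j
    have h1 := create_create (n := n) i j
    have h2 := annih_annih (n := n) i j
    have h3 := create_annih (n := n) i j
    have h4 := create_annih (n := n) j i
    have : (a • create i + b • annih i) * (c • create (n := n) j + d • annih j) +
        (c • create j + d • annih j) * (a • create i + b • annih i) =
        (a * c) • (create i * create j + create j * create i) +
        (b * d) • (annih i * annih j + annih j * annih i) +
        (a * d) • (create i * annih j + annih j * create i) +
        (b * c) • (create j * annih i + annih i * create j) := by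
      simp only [add_mul, mul_add, smul_mul_assoc, mul_smul_comm, smul_smul, smul_add]
      simp only [mul_comm c a, mul_comm c b, mul_comm d a, mul_comm d b]
      abel
    rw [this, h1, h2, h3, h4]
    by_cases hij : i = j
    · subst hij
      simp only [if_true]
      module
    · simp [hij, Ne.symm hij]
  simp only [gamma, LinearMap.coe_mk, AddHom.coe_mk]
  rw [Finset.sum_mul_sum, Finset.sum_mul_sum, Finset.sum_comm (s := Finset.univ),
    ← Finset.sum_add_distrib]
  rw [Finset.sum_congr rfl fun i _ ↦ (Finset.sum_add_distrib (s := Finset.univ)).symm]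
  rw [Finset.sum_comm]
  simp only [key, Finset.sum_ite_eq, Finset.mem_univ, if_true]
  rw [← Finset.sum_smul]
  congr 1
  simp only [stdInner, Fintype.sum_sum_type, eta, Sum.elim_inl, Sum.elim_inr]
  rw [← Finset.sum_add_distrib, Finset.mul_sum]
  exact Finset.sum_congr rfl fun i _ ↦ by ring

/-- The group `Spin(2n, 2n)`, as a group of invertible operators on the spin space: it is generated
by the products `γ(X)γ(Y)`, where `X` and `Y` are vectors of squared norm `±1`. -/
def spin (n : ℕ) : Subgroup (Module.End ℝ (Spinor n))ˣ :=
  Subgroup.closure {s | ∃ X Y : Vec n, (stdInner X X = 1 ∨ stdInner X X = -1) ∧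
    (stdInner Y Y = 1 ∨ stdInner Y Y = -1) ∧ (s : Module.End ℝ (Spinor n)) = gamma X * gamma Y}

/-- Semi-spinors of positive chirality (elements of `𝕊₊`). -/
def IsPosSemiSpinor {n : ℕ} (ψ : Spinor n) : Prop := ∀ A, Odd A.card → ψ A = 0

/-- Semi-spinors of negative chirality (elements of `𝕊₋`). -/
def IsNegSemiSpinor {n : ℕ} (ψ : Spinor n) : Prop := ∀ A, Even A.card → ψ A = 0

/-- The annihilator `{X | γ(X) ψ = 0}` of a spinor. -/
def annihilator {n : ℕ} (ψ : Spinor n) : Submodule ℝ (Vec n) :=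
  LinearMap.ker (gamma.flip ψ)

/-- A pure spinor: a semi-spinor whose annihilator has dimension `2n`. -/
def IsPure {n : ℕ} (ψ : Spinor n) : Prop :=
  (IsPosSemiSpinor ψ ∨ IsNegSemiSpinor ψ) ∧ Module.finrank ℝ (annihilator ψ) = 2 * n

/-- The product of the gamma matrices of the `2n` basis vectors of square `+1`. -/
def chargeConj (n : ℕ) : Module.End ℝ (Spinor n) :=
  (List.ofFn fun i : Fin (2 * n) ↦ gamma (Pi.single (Sum.inl i) 1)).prod

/-- The invariant bilinear pairing of spinors `⟨φ, ψ⟩ = φᵀ C ψ`.  It satisfies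
`⟨γ(v) φ, ψ⟩ = -⟨φ, γ(v) ψ⟩`, so it is preserved up to sign by the spin group. -/
def spinorPairing {n : ℕ} (φ ψ : Spinor n) : ℝ := ∑ A, φ A * chargeConj n ψ A

/-- The `2n`-form associated with (the square of) a spinor `ψ`:
`(v₁, …, v₂ₙ) ↦ ⟨ψ, γ(v₁ ∧ … ∧ v₂ₙ) ψ⟩`, where `γ(v₁ ∧ … ∧ v₂ₙ)` is the antisymmetrised product of
the `γ(v_k)`.  For a pure spinor it is a non-zero decomposable form whose kernel is the
annihilator of `ψ`. -/
def spinorForm {n : ℕ} (ψ : Spinor n) (v : Fin (2 * n) → Vec n) : ℝ :=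
  ((2 * n).factorial : ℝ)⁻¹ * ∑ σ : Equiv.Perm (Fin (2 * n)),
    ((Equiv.Perm.sign σ : ℤ) : ℝ) *
      spinorPairing ψ ((List.ofFn fun k ↦ gamma (v (σ k))).prod ψ)

/-! ### Pseudo-Riemannian metrics and the Levi-Civita connection

Manifolds of dimension `4n` are modelled on `EuclideanSpace ℝ (Fin (4 * n))`. -/

/-- The model space of a `4n`-dimensional manifold. -/
abbrev Model (n : ℕ) : Type := EuclideanSpace ℝ (Fin (4 * n))

variable {n : ℕ} {M : Type u} [TopologicalSpace M] [ChartedSpace (Model n) M]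

/-- A vector field (not assumed to be smooth). -/
abbrev VField (n : ℕ) (M : Type u) [TopologicalSpace M] [ChartedSpace (Model n) M] : Type u :=
  (x : M) → TangentSpace (𝓡 (4 * n)) x

/-- Smoothness of a vector field on a set. -/
def SmoothOn [IsManifold (𝓡 (4 * n)) ∞ M] (X : VField n M) (U : Set M) : Prop :=
  ContMDiffOn (𝓡 (4 * n)) (𝓡 (4 * n)).tangent ∞
    (fun x ↦ (⟨x, X x⟩ : TangentBundle (𝓡 (4 * n)) M)) U

/-- Smoothness of a vector field near a point. -/
def SmoothNear [IsManifold (𝓡 (4 * n)) ∞ M] (X : VField n M) (x : M) : Prop :=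
  ∃ U ∈ 𝓝 x, SmoothOn X U

/-- The directional derivative `v(f)` of a real function. -/
def dirDeriv (f : M → ℝ) (x : M) (v : TangentSpace (𝓡 (4 * n)) x) : ℝ :=
  mfderiv (𝓡 (4 * n)) 𝓘(ℝ, ℝ) f x v

/-- A smooth pseudo-Riemannian metric of signature `(2n, 2n)` on a `4n`-dimensional manifold. -/
structure SplitMetric (n : ℕ) (M : Type u) [TopologicalSpace M] [ChartedSpace (Model n) M]
    [IsManifold (𝓡 (4 * n)) ∞ M] where
  /-- The inner product on each tangent space. -/
  val : ∀ x : M, TangentSpace (𝓡 (4 * n)) x →L[ℝ] TangentSpace (𝓡 (4 * n)) x →L[ℝ] ℝ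
  symm : ∀ x v w, val x v w = val x w v
  nondegenerate : ∀ x v, (∀ w, val x v w = 0) → v = 0
  signature : ∀ x, ∃ b : Module.Basis (Idx n) ℝ (TangentSpace (𝓡 (4 * n)) x),
    ∀ a c, val x (b a) (b c) = if a = c then eta a else 0
  contMDiff : ContMDiff (𝓡 (4 * n))
    ((𝓡 (4 * n)).prod 𝓘(ℝ, Model n →L[ℝ] Model n →L[ℝ] ℝ)) ∞
    (fun x ↦ TotalSpace.mk' (Model n →L[ℝ] Model n →L[ℝ] ℝ)
      (E := fun x : M ↦ TangentSpace (𝓡 (4 * n)) x →L[ℝ] TangentSpace (𝓡 (4 * n)) x →L[ℝ] ℝ)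
      x (val x))

variable [IsManifold (𝓡 (4 * n)) ∞ M]

instance finiteDimensional_tangentSpace (x : M) :
    FiniteDimensional ℝ (TangentSpace (𝓡 (4 * n)) x) :=
  inferInstanceAs (FiniteDimensional ℝ (Model n))

/-- The metric at a point as a bilinear form. -/
def SplitMetric.bilin (g : SplitMetric n M) (x : M) :
    LinearMap.BilinForm ℝ (TangentSpace (𝓡 (4 * n)) x) :=
  LinearMap.mk₂ ℝ (fun v w ↦ g.val x v w) (by simp) (by simp) (by simp) (by simp)

lemma SplitMetric.bilin_nondegenerate (g : SplitMetric n M) (x : M) :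
    (g.bilin x).Nondegenerate := by
  rw [LinearMap.BilinForm.nondegenerate_iff_ker_eq_bot, LinearMap.ker_eq_bot']
  intro v hv
  exact g.nondegenerate x v fun w ↦ congrArg (fun f ↦ f w) hv

/-- The right-hand side of the Koszul formula, that is, `g(∇_X Y, Z)`. -/
def koszul (g : SplitMetric n M) (X Y Z : VField n M) (x : M) : ℝ :=
  (1 / 2) *
    (dirDeriv (fun y ↦ g.val y (Y y) (Z y)) x (X x)
      + dirDeriv (fun y ↦ g.val y (X y) (Z y)) x (Y x)
      - dirDeriv (fun y ↦ g.val y (X y) (Y y)) x (Z x)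
      + g.val x (VectorField.mlieBracket (𝓡 (4 * n)) X Y x) (Z x)
      - g.val x (VectorField.mlieBracket (𝓡 (4 * n)) X Z x) (Y x)
      - g.val x (VectorField.mlieBracket (𝓡 (4 * n)) Y Z x) (X x))

/-- The basis of the tangent space at `x` given by the preferred chart at `x`. -/
def tangentBasis (x : M) : Module.Basis (Fin (4 * n)) ℝ (TangentSpace (𝓡 (4 * n)) x) :=
  (EuclideanSpace.basisFun (Fin (4 * n)) ℝ).toBasis

/-- The Levi-Civita derivative `∇_v Y` at `x` of a vector field `Y` that is smooth near `x`: the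
vector whose inner product with `w` is given by the Koszul formula. The expression is tensorial in
`v` and `w`, which are extended to vector fields with constant components in the chart at `x`. -/
def leviCivita (g : SplitMetric n M) (Y : VField n M) (x : M) (v : TangentSpace (𝓡 (4 * n)) x) :
    TangentSpace (𝓡 (4 * n)) x :=
  ((g.bilin x).toDual (g.bilin_nondegenerate x)).symm
    ((tangentBasis x).constr ℝ fun k ↦
      koszul g (FiberBundle.extend (Model n) v) Y
        (FiberBundle.extend (Model n) (tangentBasis x k)) x)

/-! ### Null–Kähler structures -/

/-- A field of endomorphisms of the tangent bundle. -/
abbrev EndField (n : ℕ) (M : Type u) [TopologicalSpace M] [ChartedSpace (Model n) M] : Type u :=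
  ∀ x : M, TangentSpace (𝓡 (4 * n)) x →L[ℝ] TangentSpace (𝓡 (4 * n)) x

/-- A null structure: a smooth endomorphism `N` with `N² = 0` whose kernel is an integrable
distribution of rank `2n`. -/
structure IsNullStructure (N : EndField n M) : Prop where
  contMDiff : ContMDiff (𝓡 (4 * n)) ((𝓡 (4 * n)).prod 𝓘(ℝ, Model n →L[ℝ] Model n)) ∞
    (fun x ↦ TotalSpace.mk' (Model n →L[ℝ] Model n)
      (E := fun x : M ↦ TangentSpace (𝓡 (4 * n)) x →L[ℝ] TangentSpace (𝓡 (4 * n)) x) x (N x))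
  sq_zero : ∀ x v, N x (N x v) = 0
  rank_ker : ∀ x, Module.finrank ℝ (LinearMap.ker (N x).toLinearMap) = 2 * n
  integrable : ∀ X Y : VField n M, SmoothOn X univ → SmoothOn Y univ →
    (∀ x, N x (X x) = 0) → (∀ x, N x (Y x) = 0) →
    ∀ x, N x (VectorField.mlieBracket (𝓡 (4 * n)) X Y x) = 0

/-- A null–Kähler structure `(g, N)`: a null structure `N` that is skew with respect to `g` and
parallel for the Levi-Civita connection of `g`. -/
structure IsNullKahler (g : SplitMetric n M) (N : EndField n M) : Prop
    extends IsNullStructure N where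
  skew : ∀ x v w, g.val x (N x v) w = -g.val x v (N x w)
  parallel : ∀ (x : M) (Y : VField n M), SmoothNear Y x → ∀ v,
    leviCivita g (fun y ↦ N y (Y y)) x v = N x (leviCivita g Y x v)

/-- The fundamental two-form `Ω(v, w) = g(N v, w)`. -/
def fundForm (g : SplitMetric n M) (N : EndField n M) (x : M)
    (v w : TangentSpace (𝓡 (4 * n)) x) : ℝ :=
  g.val x (N x v) w

/-- The `n`-fold exterior power `Ω ∧ … ∧ Ω` of a two-form `Ω`, evaluated on `2n` vectors (with the
convention `(α ∧ β)(v, w) = α(v) β(w) - α(w) β(v)` for one-forms). -/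
def wedgePower {V : Type*} (n : ℕ) (Ω : V → V → ℝ) (v : Fin (2 * n) → V) : ℝ :=
  (1 / 2 ^ n) * ∑ σ : Equiv.Perm (Fin (2 * n)), ((Equiv.Perm.sign σ : ℤ) : ℝ) *
    ∏ k : Fin n, Ω (v (σ ⟨2 * k, by omega⟩)) (v (σ ⟨2 * k + 1, by omega⟩))

/-- The `2n`-form `Ω^{∧n}`. -/
def fundPower (g : SplitMetric n M) (N : EndField n M) (x : M)
    (v : Fin (2 * n) → TangentSpace (𝓡 (4 * n)) x) : ℝ :=
  wedgePower n (fundForm g N x) v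

/-- A `k`-form (given by its values on vectors) is parallel: `∇_v α = 0`, that is,
`v(α(Y₁, …, Y_k)) = ∑ α(Y₁, …, ∇_v Y_j, …, Y_k)`. -/
def IsParallelForm (g : SplitMetric n M) {k : ℕ}
    (α : ∀ x : M, (Fin k → TangentSpace (𝓡 (4 * n)) x) → ℝ) : Prop :=
  ∀ (x : M) (Y : Fin k → VField n M), (∀ j, SmoothNear (Y j) x) → ∀ v,
    dirDeriv (fun y ↦ α y fun j ↦ Y j y) x v =
      ∑ j, α x (Function.update (fun l ↦ Y l x) j (leviCivita g (Y j) x v))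

/-! ### Spin structures and spinor fields -/

/-- A spin structure on `(M, g)`, given by a smooth `Spin(2n, 2n)`-valued cocycle that lifts the
transition functions between local pseudo-orthonormal frames. -/
structure SpinStructure (g : SplitMetric n M) where
  /-- Labels of the local frames. -/
  Index : Type u
  /-- The domain of a local frame. -/
  dom : Index → Set M
  isOpen_dom : ∀ i, IsOpen (dom i)
  cover : ∀ x, ∃ i, x ∈ dom i
  /-- The local frames. -/
  frame : Index → Idx n → VField n M
  smooth_frame : ∀ i a, SmoothOn (frame i a) (dom i)
  orthonormal : ∀ i, ∀ x ∈ dom i, ∀ a c,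
    g.val x (frame i a x) (frame i c x) = if a = c then eta a else 0
  /-- The lifts of the transition functions, from the frame `j` to the frame `i`. -/
  trans : Index → Index → M → (Module.End ℝ (Spinor n))ˣ
  trans_mem : ∀ i j, ∀ x ∈ dom i ∩ dom j, trans i j x ∈ spin n
  smooth_trans : ∀ i j (φ : Spinor n), ContMDiffOn (𝓡 (4 * n)) 𝓘(ℝ, Spinor n) ∞
    (fun x ↦ (trans i j x : Module.End ℝ (Spinor n)) φ) (dom i ∩ dom j)
  /-- `trans i j` covers the change of frame: if `v` and `w` are the components of the same tangent
  vector in the frames `j` and `i`, then `s γ(v) s⁻¹ = γ(w)`. -/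
  trans_lift : ∀ i j, ∀ x ∈ dom i ∩ dom j, ∀ v w : Vec n,
    ∑ a, v a • frame j a x = ∑ a, w a • frame i a x →
      (trans i j x : Module.End ℝ (Spinor n)) * gamma v = gamma w * trans i j x
  cocycle : ∀ i j k, ∀ x ∈ dom i ∩ dom j ∩ dom k, trans i j x * trans j k x = trans i k x

namespace SpinStructure

variable {g : SplitMetric n M}

/-- The components of a tangent vector in the frame `i`. -/
def comp (P : SpinStructure g) (i : P.Index) (x : M) (v : TangentSpace (𝓡 (4 * n)) x) : Vec n :=
  fun a ↦ eta a * g.val x v (P.frame i a x)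

end SpinStructure

/-- A smooth spinor field, that is, a smooth section of the bundle associated with a spin structure
and the spin space: it is given by its components in the local frames. -/
structure SpinorField {g : SplitMetric n M} (P : SpinStructure g) where
  /-- The components in the frame `i`. -/
  toFun : P.Index → M → Spinor n
  smooth : ∀ i, ContMDiffOn (𝓡 (4 * n)) 𝓘(ℝ, Spinor n) ∞ (toFun i) (P.dom i)
  compat : ∀ i j, ∀ x ∈ P.dom i ∩ P.dom j,
    toFun i x = (P.trans i j x : Module.End ℝ (Spinor n)) (toFun j x)

namespace SpinorField

variable {g : SplitMetric n M} {P : SpinStructure g}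

/-- The spinorial Levi-Civita derivative `∇_v ψ`, in the frame `e = frame i`:
`v(ψ) + 1/4 ∑ g(e^a, ∇_v e_b) γ_a γ^b ψ`, where indices are raised with `η`. -/
def covDeriv (ψ : SpinorField P) (i : P.Index) (x : M) (v : TangentSpace (𝓡 (4 * n)) x) :
    Spinor n :=
  (show Spinor n from mfderiv (𝓡 (4 * n)) 𝓘(ℝ, Spinor n) (ψ.toFun i) x v) +
    (1 / 4 : ℝ) • ∑ a, ∑ b,
      (eta a * eta b * g.val x (P.frame i a x) (leviCivita g (P.frame i b) x v)) •
        gamma (Pi.single a 1) (gamma (Pi.single b 1) (ψ.toFun i x))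

/-- `ψ` is parallel: `∇ψ = 0`. -/
def IsParallel (ψ : SpinorField P) : Prop :=
  ∀ i, ∀ x ∈ P.dom i, ∀ v, ψ.covDeriv i x v = 0

/-- Clifford multiplication `X · ψ` by a tangent vector at `x`, in the frame `i`. -/
def clifford (ψ : SpinorField P) (i : P.Index) (x : M) (v : TangentSpace (𝓡 (4 * n)) x) :
    Spinor n :=
  gamma (P.comp i x v) (ψ.toFun i x)

/-- `ψ` is a positive semi-spinor that is pure at every point. -/
def IsPosPure (ψ : SpinorField P) : Prop :=
  ∀ i, ∀ x ∈ P.dom i, IsPosSemiSpinor (ψ.toFun i x) ∧ IsPure (ψ.toFun i x)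

/-- `ψ` corresponds to the `2n`-form `α`: `⟨ψ, γ(v₁ ∧ … ∧ v₂ₙ) ψ⟩ = α(v₁, …, v₂ₙ)`. -/
def CorrespondsTo (ψ : SpinorField P)
    (α : ∀ x : M, (Fin (2 * n) → TangentSpace (𝓡 (4 * n)) x) → ℝ) : Prop :=
  ∀ i, ∀ x ∈ P.dom i, ∀ v : Fin (2 * n) → TangentSpace (𝓡 (4 * n)) x,
    spinorForm (ψ.toFun i x) (fun k ↦ P.comp i x (v k)) = α x v

/-- The annihilator of `ψ` is the distribution `Ker N`: `X · ψ = 0` if and only if `N X = 0`. -/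
def AnnihilatorEqKer (ψ : SpinorField P) (N : EndField n M) : Prop :=
  ∀ i, ∀ x ∈ P.dom i, ∀ v, ψ.clifford i x v = 0 ↔ N x v = 0

end SpinorField

/-- An isomorphism of spin structures over the identity of `(M, g)`: smooth `Spin(2n, 2n)`-valued
functions which cover the change from the frames of `P` to those of `P'` and are compatible with
the two cocycles. -/
structure SpinIso {g : SplitMetric n M} (P P' : SpinStructure g) where
  /-- The lift of the change from the frame `i` of `P` to the frame `k` of `P'`. -/
  toFun : P'.Index → P.Index → M → (Module.End ℝ (Spinor n))ˣ
  mem : ∀ k i, ∀ x ∈ P'.dom k ∩ P.dom i, toFun k i x ∈ spin n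
  smooth : ∀ k i (φ : Spinor n), ContMDiffOn (𝓡 (4 * n)) 𝓘(ℝ, Spinor n) ∞
    (fun x ↦ (toFun k i x : Module.End ℝ (Spinor n)) φ) (P'.dom k ∩ P.dom i)
  lift : ∀ k i, ∀ x ∈ P'.dom k ∩ P.dom i, ∀ v w : Vec n,
    ∑ a, v a • P.frame i a x = ∑ a, w a • P'.frame k a x →
      (toFun k i x : Module.End ℝ (Spinor n)) * gamma v = gamma w * toFun k i x
  compat_left : ∀ l k i, ∀ x ∈ P'.dom l ∩ P'.dom k ∩ P.dom i,
    P'.trans l k x * toFun k i x = toFun l i x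
  compat_right : ∀ k i j, ∀ x ∈ P'.dom k ∩ P.dom i ∩ P.dom j,
    toFun k i x * P.trans i j x = toFun k j x

/-- The isomorphism of spin structures `T` carries the spinor field `ψ` to `ψ'`. -/
def SpinIso.Carries {g : SplitMetric n M} {P P' : SpinStructure g} (T : SpinIso P P')
    (ψ : SpinorField P) (ψ' : SpinorField P') : Prop :=
  ∀ k i, ∀ x ∈ P'.dom k ∩ P.dom i,
    (T.toFun k i x : Module.End ℝ (Spinor n)) (ψ.toFun i x) = ψ'.toFun k x

end

end NullKahler

/-! Parallelism of `Ω^{∧n}` is the Leibniz rule: metric compatibility of `∇` and `∇N = 0` give `∇Ω =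
0` (`IsNullKahler.dirDeriv_fundForm`), and the power inherits this.

The spin structure rests on an algebraic fact: the form of a pure spinor determines the spinor up to
sign. The kernel of the form is the annihilator (`gamma_eq_zero_iff_form`), which fixes the spinor
up to a scalar, and comparing the forms themselves leaves only `±1`. Since `-1` belongs to the spin
group, an isometry matching the forms of two positive pure spinors lifts to a spin element carrying
one spinor to the other (`exists_spin_lift`). This lift is unique because the spin representation is
irreducible (`covering_unique`). So local frames, each with a positive pure spinor representing the
same global `2n`-form, carry a canonical cocycle: the cocycle identity is an instance of uniqueness,
and smoothness is automatic (`contMDiffOn_covering`). The same argument, applied between the frames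
of two spin structures, gives the canonical isomorphism (`exists_spinIso_carries`).

The algebra is reduced to the Fock vacuum. Every isometry is covered by a product of gamma matrices
of unit vectors (`exists_gammaProd_covering`), so every pure spinor is a multiple of a transported
vacuum, whose form can be computed by hand.

On the geometric side, `Ω` has kernel `Ker N`, of rank `2n` in dimension `4n`, so `Ω^{∧n}` is
nowhere zero. Locally there are vector fields `c_1, …, c_{2n}` spanning a complement of `Ker N` on
which `Ω^{∧n}` takes a prescribed non-zero constant value. Applying `N` produces a dual basis `w` of
`Ker N`; correcting `c` by elements of `Ker N` gives an isotropic family `u`; and the vectors `u_i ±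
w_i` form a pseudo-orthonormal frame in which the constant vacuum corresponds to `Ω^{∧n}`
(`IsNullKahler.isSpinorFrame_nullFrame`). As `∇` preserves `Ker N`, the connection form multiplies
the vacuum by a multiple of the trace `∑ g(∇w_i, u_i)`, and this trace vanishes because `Ω^{∧n}` is
parallel and constant on `u` (`IsNullKahler.connection_vac`). -/

namespace NullKahler

/-! ### The Koszul formula and the Levi-Civita derivative -/

section Connection

variable {n : ℕ} {M : Type u} [TopologicalSpace M] [ChartedSpace (Model n) M]

lemma dirDeriv_add {f f' : M → ℝ} {x : M} (hf : MDifferentiableAt (𝓡 (4 * n)) 𝓘(ℝ, ℝ) f x)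
    (hf' : MDifferentiableAt (𝓡 (4 * n)) 𝓘(ℝ, ℝ) f' x) (v : TangentSpace (𝓡 (4 * n)) x) :
    dirDeriv (fun y ↦ f y + f' y) x v = dirDeriv f x v + dirDeriv f' x v := by
  have := mvfderiv_fun_add hf hf'
  exact congrArg (fun L ↦ L v) this

lemma dirDeriv_mul {f f' : M → ℝ} {x : M} (hf : MDifferentiableAt (𝓡 (4 * n)) 𝓘(ℝ, ℝ) f x)
    (hf' : MDifferentiableAt (𝓡 (4 * n)) 𝓘(ℝ, ℝ) f' x) (v : TangentSpace (𝓡 (4 * n)) x) :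
    dirDeriv (fun y ↦ f y * f' y) x v = f x * dirDeriv f' x v + f' x * dirDeriv f x v := by
  have := mvfderiv_fun_mul hf hf'
  have := congrArg (fun L ↦ L v) this
  simpa using! this

lemma dirDeriv_congr {f f' : M → ℝ} {x : M} (h : f =ᶠ[𝓝 x] f') (v : TangentSpace (𝓡 (4 * n)) x) :
    dirDeriv f x v = dirDeriv f' x v := by
  unfold dirDeriv
  rw [h.mfderiv_eq]
  rfl

lemma dirDeriv_const (c : ℝ) {x : M} (v : TangentSpace (𝓡 (4 * n)) x) :
    dirDeriv (fun _ : M ↦ c) x v = 0 := by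
  unfold dirDeriv
  rw [mfderiv_const]
  rfl

lemma dirDeriv_map_add (f : M → ℝ) (x : M) (v w : TangentSpace (𝓡 (4 * n)) x) :
    dirDeriv f x (v + w) = dirDeriv f x v + dirDeriv f x w :=
  map_add (mfderiv (𝓡 (4 * n)) 𝓘(ℝ, ℝ) f x) v w

lemma dirDeriv_map_smul (f : M → ℝ) (x : M) (c : ℝ) (v : TangentSpace (𝓡 (4 * n)) x) :
    dirDeriv f x (c • v) = c * dirDeriv f x v :=
  map_smul (mfderiv (𝓡 (4 * n)) 𝓘(ℝ, ℝ) f x) c v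

variable [IsManifold (𝓡 (4 * n)) ∞ M]

/-- Differentiability of a vector field at a point. -/
abbrev DiffAt (X : VField n M) (x : M) : Prop :=
  MDifferentiableAt (𝓡 (4 * n)) (𝓡 (4 * n)).tangent
    (fun y ↦ (⟨y, X y⟩ : TangentBundle (𝓡 (4 * n)) M)) x

lemma isManifold_two : IsManifold (𝓡 (4 * n)) 2 M := .of_le (n := ∞) (by
  change ((2 : ℕ∞) : WithTop ℕ∞) ≤ ((⊤ : ℕ∞) : WithTop ℕ∞)
  exact_mod_cast le_top)

lemma SmoothNear.contMDiffAt {X : VField n M} {x : M} (h : SmoothNear X x) :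
    ContMDiffAt (𝓡 (4 * n)) (𝓡 (4 * n)).tangent ∞
      (fun y ↦ (⟨y, X y⟩ : TangentBundle (𝓡 (4 * n)) M)) x := by
  obtain ⟨U, hU, hX⟩ := h
  exact hX.contMDiffAt hU

lemma SmoothOn.smoothNear {X : VField n M} {U : Set M} (h : SmoothOn X U) (hU : IsOpen U)
    {x : M} (hx : x ∈ U) : SmoothNear X x :=
  ⟨U, hU.mem_nhds hx, h⟩

lemma SmoothNear.mdifferentiableAt {X : VField n M} {x : M} (h : SmoothNear X x) :
    DiffAt X x :=
  h.contMDiffAt.mdifferentiableAt (by simp)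

lemma SplitMetric.contMDiffWithinAt_val (g : SplitMetric n M) {X Y : VField n M} {x : M} {U : Set M}
    (hX : ContMDiffWithinAt (𝓡 (4 * n)) (𝓡 (4 * n)).tangent ∞
      (fun y ↦ (⟨y, X y⟩ : TangentBundle (𝓡 (4 * n)) M)) U x)
    (hY : ContMDiffWithinAt (𝓡 (4 * n)) (𝓡 (4 * n)).tangent ∞
      (fun y ↦ (⟨y, Y y⟩ : TangentBundle (𝓡 (4 * n)) M)) U x) :
    ContMDiffWithinAt (𝓡 (4 * n)) 𝓘(ℝ, ℝ) ∞ (fun y ↦ g.val y (X y) (Y y)) U x := by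
  -- The function is viewed as a section of the trivial line bundle, so that evaluation of bundle
  -- maps applies.
  have : ContMDiffWithinAt (𝓡 (4 * n)) ((𝓡 (4 * n)).prod 𝓘(ℝ, ℝ)) ∞
      (fun y ↦ TotalSpace.mk' ℝ (E := Bundle.Trivial M ℝ) y (g.val y (X y) (Y y))) U x := by
    apply ContMDiffWithinAt.clm_bundle_apply₂ (F₁ := Model n) (F₂ := Model n)
    · exact (g.contMDiff x).contMDiffWithinAt
    · exact hX
    · exact hY
  simp only [contMDiffWithinAt_totalSpace] at this
  exact this.2

lemma SplitMetric.mdifferentiableAt_val (g : SplitMetric n M) {X Y : VField n M} {x : M}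
    (hX : DiffAt X x) (hY : DiffAt Y x) :
    MDifferentiableAt (𝓡 (4 * n)) 𝓘(ℝ, ℝ) (fun y ↦ g.val y (X y) (Y y)) x := by
  have : MDifferentiableAt (𝓡 (4 * n)) ((𝓡 (4 * n)).prod 𝓘(ℝ, ℝ))
      (fun y ↦ TotalSpace.mk' ℝ (E := Bundle.Trivial M ℝ) y (g.val y (X y) (Y y))) x := by
    apply MDifferentiableAt.clm_bundle_apply₂ (F₁ := Model n) (F₂ := Model n)
    · exact (g.contMDiff x).mdifferentiableAt (by simp)
    · exact hX
    · exact hY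
  simp only [mdifferentiableAt_totalSpace] at this
  exact this.2

lemma contMDiffWithinAt_endField {N : EndField n M}
    (hN : ContMDiff (𝓡 (4 * n)) ((𝓡 (4 * n)).prod 𝓘(ℝ, Model n →L[ℝ] Model n)) ∞
      (fun x ↦ TotalSpace.mk' (Model n →L[ℝ] Model n)
        (E := fun x : M ↦ TangentSpace (𝓡 (4 * n)) x →L[ℝ] TangentSpace (𝓡 (4 * n)) x) x (N x)))
    {X : VField n M} {x : M} {U : Set M}
    (hX : ContMDiffWithinAt (𝓡 (4 * n)) (𝓡 (4 * n)).tangent ∞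
      (fun y ↦ (⟨y, X y⟩ : TangentBundle (𝓡 (4 * n)) M)) U x) :
    ContMDiffWithinAt (𝓡 (4 * n)) (𝓡 (4 * n)).tangent ∞
      (fun y ↦ (⟨y, N y (X y)⟩ : TangentBundle (𝓡 (4 * n)) M)) U x :=
  (hN x).contMDiffWithinAt.clm_bundle_apply (F₁ := Model n) (F₂ := Model n) hX

lemma koszul_add_middle (g : SplitMetric n M) {X Y Y' Z : VField n M} {x : M}
    (hX : DiffAt X x) (hY : DiffAt Y x) (hY' : DiffAt Y' x)
    (hZ : DiffAt Z x) :
    koszul g X (Y + Y') Z x = koszul g X Y Z x + koszul g X Y' Z x := by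
  have := isManifold_two (n := n) (M := M)
  unfold koszul
  rw [VectorField.mlieBracket_add_right hY hY', VectorField.mlieBracket_add_left hY hY']
  simp only [Pi.add_apply, map_add, add_apply]
  rw [dirDeriv_add (g.mdifferentiableAt_val hY hZ) (g.mdifferentiableAt_val hY' hZ),
    dirDeriv_add (g.mdifferentiableAt_val hX hY) (g.mdifferentiableAt_val hX hY')]
  simp only [dirDeriv_map_add]
  ring

/-- Replacing `Z` by `f Z` creates terms `X(f) g(Y, Z)` and `Y(f) g(X, Z)` from the derivatives of
the metric; the brackets `[X, fZ]` and `[Y, fZ]` create the same terms with the opposite sign. -/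
lemma koszul_tensorialAt (g : SplitMetric n M) {X Y : VField n M} {x : M}
    (hX : DiffAt X x) (hY : DiffAt Y x) :
    TensorialAt (𝓡 (4 * n)) (Model n) (fun Z : VField n M ↦ koszul g X Y Z x) x where
  add {Z Z'} hZ hZ' := by
    have := isManifold_two (n := n) (M := M)
    simp only [koszul]
    rw [VectorField.mlieBracket_add_right hZ hZ', VectorField.mlieBracket_add_right hZ hZ']
    simp only [Pi.add_apply, map_add, add_apply]
    rw [dirDeriv_add (g.mdifferentiableAt_val hY hZ) (g.mdifferentiableAt_val hY hZ'),
      dirDeriv_add (g.mdifferentiableAt_val hX hZ) (g.mdifferentiableAt_val hX hZ')]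
    simp only [dirDeriv_map_add]
    ring
  smul {f Z} hf hZ := by
    have := isManifold_two (n := n) (M := M)
    simp only [koszul]
    rw [VectorField.mlieBracket_smul_right hf hZ, VectorField.mlieBracket_smul_right hf hZ]
    simp only [Pi.smul_apply', map_add, map_smul, add_apply, smul_apply, smul_eq_mul]
    rw [dirDeriv_mul hf (g.mdifferentiableAt_val hY hZ),
      dirDeriv_mul hf (g.mdifferentiableAt_val hX hZ)]
    rw [g.symm x (Z x) (Y x), g.symm x (Z x) (X x)]
    change _ = f x * _
    have h1 : ∀ V : TangentSpace (𝓡 (4 * n)) x, mvfderiv (𝓡 (4 * n)) f x V = dirDeriv f x V :=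
      fun V ↦ rfl
    simp only [h1]
    simp only [dirDeriv_map_smul]
    ring

/-- By definition the derivative is tested only on extensions of the chart basis; tensoriality
allows any differentiable `Z`. The direction `v` keeps its fixed extension throughout, so
tensoriality in that slot is not called for. -/
lemma val_leviCivita (g : SplitMetric n M) {Y Z : VField n M} {x : M}
    (hY : DiffAt Y x) (hZ : DiffAt Z x) (v : TangentSpace (𝓡 (4 * n)) x) :
    g.val x (leviCivita g Y x v) (Z x) = koszul g (FiberBundle.extend (Model n) v) Y Z x := by
  have hT := koszul_tensorialAt g
    (FiberBundle.mdifferentiableAt_extend (𝓡 (4 * n)) (Model n) v) hY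
  have hL : ((tangentBasis x).constr ℝ fun k ↦ koszul g (FiberBundle.extend (Model n) v) Y
        (FiberBundle.extend (Model n) (tangentBasis x k)) x) =
      (TensorialAt.mkHom _ x hT).toLinearMap :=
    (tangentBasis x).ext fun k ↦ by
      rw [Module.Basis.constr_basis]
      rfl
  have h := LinearMap.BilinForm.apply_toDual_symm_apply (hB := g.bilin_nondegenerate x)
    ((tangentBasis x).constr ℝ fun k ↦ koszul g (FiberBundle.extend (Model n) v) Y
        (FiberBundle.extend (Model n) (tangentBasis x k)) x) (Z x)
  refine (h.trans ?_)
  rw [hL]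
  exact TensorialAt.mkHom_apply hT hZ

lemma val_leviCivita_apply (g : SplitMetric n M) {Y : VField n M} {x : M}
    (hY : DiffAt Y x) (v w : TangentSpace (𝓡 (4 * n)) x) :
    g.val x (leviCivita g Y x v) w =
      koszul g (FiberBundle.extend (Model n) v) Y (FiberBundle.extend (Model n) w) x := by
  rw [← val_leviCivita g hY (FiberBundle.mdifferentiableAt_extend (𝓡 (4 * n)) (Model n) w),
    FiberBundle.extend_apply_self]

lemma SplitMetric.ext_of_val (g : SplitMetric n M) {x : M} {v v' : TangentSpace (𝓡 (4 * n)) x}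
    (h : ∀ w, g.val x v w = g.val x v' w) : v = v' :=
  sub_eq_zero.1 (g.nondegenerate x _ fun w ↦ by rw [map_sub, sub_apply, h, sub_self])

/-- The Levi-Civita derivative is compatible with the metric. -/
theorem leviCivita_metric (g : SplitMetric n M) {Y Z : VField n M} {x : M}
    (hY : DiffAt Y x) (hZ : DiffAt Z x) (v : TangentSpace (𝓡 (4 * n)) x) :
    dirDeriv (fun y ↦ g.val y (Y y) (Z y)) x v =
      g.val x (leviCivita g Y x v) (Z x) + g.val x (Y x) (leviCivita g Z x v) := by
  -- In the sum of the Koszul expressions for `(Y, Z)` and `(Z, Y)` everything antisymmetric in `Y`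
  -- and `Z` cancels, which leaves the derivative of `g(Y, Z)`.
  rw [g.symm x (Y x), val_leviCivita g hY hZ, val_leviCivita g hZ hY]
  unfold koszul
  rw [VectorField.mlieBracket_swap_apply (V := Z) (W := Y), FiberBundle.extend_apply_self]
  simp only [g.symm _ (Z _) (Y _), map_neg, neg_apply]
  ring

lemma leviCivita_add (g : SplitMetric n M) {Y Z : VField n M} {x : M}
    (hY : DiffAt Y x) (hZ : DiffAt Z x) (v : TangentSpace (𝓡 (4 * n)) x) :
    leviCivita g (Y + Z) x v = leviCivita g Y x v + leviCivita g Z x v := by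
  refine g.ext_of_val fun w ↦ ?_
  rw [map_add, add_apply, val_leviCivita_apply g (mdifferentiableAt_add_section hY hZ),
    val_leviCivita_apply g hY, val_leviCivita_apply g hZ,
    koszul_add_middle g (FiberBundle.mdifferentiableAt_extend ..) hY hZ
      (FiberBundle.mdifferentiableAt_extend ..)]

lemma leviCivita_zero (g : SplitMetric n M) {x : M} (v : TangentSpace (𝓡 (4 * n)) x) :
    leviCivita g (fun _ ↦ 0 : VField n M) x v = 0 := by
  have h0 : DiffAt (fun _ ↦ 0 : VField n M) x := mdifferentiable_zeroSection ℝ _ x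
  have := leviCivita_add g h0 h0 v
  have h2 : (fun _ ↦ 0 : VField n M) + (fun _ ↦ 0 : VField n M) = fun _ ↦ 0 := by
    funext y; simp
  rw [h2] at this
  simpa using this

end Connection

end NullKahler

namespace NullKahler

/-! ### Exterior powers of a skew bilinear form -/

section WedgePower

/-- The labelling of `{0, …, 2n - 1}` by consecutive pairs. -/
def pairEquiv (n : ℕ) : Fin n × Fin 2 ≃ Fin (2 * n) where
  toFun p := ⟨2 * p.1 + p.2, by omega⟩
  invFun j := (⟨j / 2, by omega⟩, ⟨j % 2, by omega⟩)
  left_inv p := by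
    ext
    · simp only; omega
    · simp only; omega
  right_inv j := by
    ext
    simp only
    omega

variable {n : ℕ} {V : Type*} [AddCommGroup V] [Module ℝ V] (B : LinearMap.BilinForm ℝ V)

lemma prod_pair_update_zero (v : Fin (2 * n) → V) (k : Fin n) (x : V) :
    ∏ l, B (Function.update v (pairEquiv n (k, 0)) x (pairEquiv n (l, 0)))
      (Function.update v (pairEquiv n (k, 0)) x (pairEquiv n (l, 1))) =
    (∏ l ∈ Finset.univ.erase k, B (v (pairEquiv n (l, 0))) (v (pairEquiv n (l, 1)))) *
      B x (v (pairEquiv n (k, 1))) := by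
  rw [← Finset.prod_erase_mul _ _ (Finset.mem_univ k)]
  congr 1
  · refine Finset.prod_congr rfl fun l hl ↦ ?_
    rw [Function.update_of_ne, Function.update_of_ne]
    · simp
    · simpa using Finset.ne_of_mem_erase hl
  · rw [Function.update_self, Function.update_of_ne]
    simp

lemma prod_pair_update_one (v : Fin (2 * n) → V) (k : Fin n) (x : V) :
    ∏ l, B (Function.update v (pairEquiv n (k, 1)) x (pairEquiv n (l, 0)))
      (Function.update v (pairEquiv n (k, 1)) x (pairEquiv n (l, 1))) =
    (∏ l ∈ Finset.univ.erase k, B (v (pairEquiv n (l, 0))) (v (pairEquiv n (l, 1)))) *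
      B (v (pairEquiv n (k, 0))) x := by
  rw [← Finset.prod_erase_mul _ _ (Finset.mem_univ k)]
  congr 1
  · refine Finset.prod_congr rfl fun l hl ↦ ?_
    rw [Function.update_of_ne, Function.update_of_ne]
    · simpa using Finset.ne_of_mem_erase hl
    · simp
  · rw [Function.update_self, Function.update_of_ne]
    simp

lemma forall_pairEquiv {p : Fin (2 * n) → Prop} (h0 : ∀ k, p (pairEquiv n (k, 0)))
    (h1 : ∀ k, p (pairEquiv n (k, 1))) (i : Fin (2 * n)) : p i := by
  obtain ⟨⟨k, j⟩, rfl⟩ := (pairEquiv n).surjective i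
  fin_cases j
  · exact h0 k
  · exact h1 k

/-- The multilinear map `v ↦ ∏ B(v₂ₖ, v₂ₖ₊₁)`. -/
noncomputable def pairProd (n : ℕ) : MultilinearMap ℝ (fun _ : Fin (2 * n) ↦ V) ℝ where
  toFun v := ∏ k : Fin n, B (v (pairEquiv n (k, 0))) (v (pairEquiv n (k, 1)))
  map_update_add' {inst} v i x y := by
    -- The field quantifies over all decidability instances; the update lemmas above use the
    -- standard one.
    rw [Subsingleton.elim inst (instDecidableEqFin _)]
    revert i
    apply forall_pairEquiv
    · intro k
      simp only [prod_pair_update_zero, map_add, LinearMap.add_apply, mul_add]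
    · intro k
      simp only [prod_pair_update_one, map_add, mul_add]
  map_update_smul' {inst} v i c x := by
    rw [Subsingleton.elim inst (instDecidableEqFin _)]
    revert i
    apply forall_pairEquiv
    · intro k
      simp only [prod_pair_update_zero, map_smul, LinearMap.smul_apply, smul_eq_mul]
      ring
    · intro k
      simp only [prod_pair_update_one, map_smul, smul_eq_mul]
      ring

lemma pairProd_apply (v : Fin (2 * n) → V) :
    pairProd B n v = ∏ k : Fin n, B (v (pairEquiv n (k, 0))) (v (pairEquiv n (k, 1))) := rfl

/-- The `n`-th exterior power of a two-form as an alternating map. -/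
noncomputable def wedgeAlt (n : ℕ) : V [⋀^Fin (2 * n)]→ₗ[ℝ] ℝ :=
  (1 / 2 ^ n : ℝ) • MultilinearMap.alternatization (pairProd B n)

lemma wedgeAlt_apply (v : Fin (2 * n) → V) :
    wedgeAlt B n v = (1 / 2 ^ n) * ∑ σ : Equiv.Perm (Fin (2 * n)),
      ((Equiv.Perm.sign σ : ℤ) : ℝ) * pairProd B n (v ∘ σ) := by
  simp only [wedgeAlt, AlternatingMap.smul_apply, MultilinearMap.alternatization_apply,
    smul_eq_mul]
  congr 1
  refine Finset.sum_congr rfl fun σ _ ↦ ?_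
  rw [Units.smul_def, zsmul_eq_mul]
  rfl

lemma wedgePower_eq (v : Fin (2 * n) → V) :
    wedgePower n (fun x y ↦ B x y) v = wedgeAlt B n v := by
  rw [wedgeAlt_apply]
  rfl

lemma pairProd_eq_zero {v : Fin (2 * n) → V} (i : Fin (2 * n)) (h : ∀ j, B (v i) (v j) = 0)
    (h' : ∀ j, B (v j) (v i) = 0) : pairProd B n v = 0 := by
  revert i
  refine forall_pairEquiv ?_ ?_
  · intro k h _
    exact Finset.prod_eq_zero (Finset.mem_univ k) (h _)
  · intro k _ h'
    exact Finset.prod_eq_zero (Finset.mem_univ k) (h' _)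

lemma wedgeAlt_eq_zero {v : Fin (2 * n) → V} (i : Fin (2 * n)) (h : ∀ j, B (v i) (v j) = 0)
    (h' : ∀ j, B (v j) (v i) = 0) : wedgeAlt B n v = 0 := by
  rw [wedgeAlt_apply, Finset.sum_eq_zero, mul_zero]
  intro σ _
  rw [pairProd_eq_zero B (σ.symm i), mul_zero] <;> simp [h, h']

/-- The left side comes from differentiating each argument in turn, the right side from the Leibniz
rule for a product of `n` factors. Each factor contains exactly the two arguments of its pair. -/
lemma sum_pairProd_update (v D : Fin (2 * n) → V) :
    ∑ i, pairProd B n (Function.update v i (D i)) =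
      ∑ k : Fin n, (∏ l ∈ Finset.univ.erase k,
        B (v (pairEquiv n (l, 0))) (v (pairEquiv n (l, 1)))) *
        (B (D (pairEquiv n (k, 0))) (v (pairEquiv n (k, 1))) +
          B (v (pairEquiv n (k, 0))) (D (pairEquiv n (k, 1)))) := by
  rw [← (pairEquiv n).sum_comp, Fintype.sum_prod_type]
  refine Finset.sum_congr rfl fun k _ ↦ ?_
  rw [Fin.sum_univ_two, pairProd_apply, pairProd_apply, prod_pair_update_zero,
    prod_pair_update_one, mul_add]

lemma sum_wedgeAlt_update (v D : Fin (2 * n) → V) :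
    ∑ i, wedgeAlt B n (Function.update v i (D i)) =
      (1 / 2 ^ n) * ∑ σ : Equiv.Perm (Fin (2 * n)), ((Equiv.Perm.sign σ : ℤ) : ℝ) *
        ∑ i, pairProd B n (Function.update (v ∘ σ) i (D (σ i))) := by
  simp only [wedgeAlt_apply]
  rw [← Finset.mul_sum, Finset.sum_comm]
  congr 1
  refine Finset.sum_congr rfl fun σ _ ↦ ?_
  rw [← Finset.mul_sum, ← Equiv.sum_comp σ]
  congr 1
  refine Finset.sum_congr rfl fun i _ ↦ ?_
  rw [Function.update_comp_eq_of_injective _ σ.injective]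

variable {B}

/-- If the `n`-th power of a skew form does not vanish on a family, then the Gram matrix of the
family is invertible. -/
lemma det_gram_ne_zero (hB : ∀ x y, B x y = -B y x) {c : Fin (2 * n) → V}
    (hc : wedgeAlt B n c ≠ 0) : (Matrix.of fun i j ↦ B (c i) (c j)).det ≠ 0 := by
  intro hdet
  -- A null vector `a` of the Gram matrix gives `u = ∑ a_l c_l` with `B(u, c_j) = 0` for all `j`.
  -- Putting `u` in a place `i` with `a_i ≠ 0` kills the power, whereas multilinearity gives `a_i`
  -- times its value on `c`.
  obtain ⟨a, ha, h0⟩ := Matrix.exists_vecMul_eq_zero_iff.2 hdet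
  obtain ⟨i, hi⟩ := Function.ne_iff.1 ha
  have h1 : ∀ j, B (∑ l, a l • c l) (c j) = 0 := fun j ↦ by
    have := congrFun h0 j
    simpa [Matrix.vecMul, dotProduct] using this
  have h2 : B (∑ l, a l • c l) (∑ l, a l • c l) = 0 := by
    have := hB (∑ l, a l • c l) (∑ l, a l • c l)
    linarith
  have h3 : wedgeAlt B n (Function.update c i (∑ l, a l • c l)) = 0 := by
    have : ∀ j, B (∑ l, a l • c l) (Function.update c i (∑ l, a l • c l) j) = 0 := fun j ↦ by
      by_cases hj : j = i
      · subst hj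
        rw [Function.update_self, h2]
      · rw [Function.update_of_ne hj, h1]
    refine wedgeAlt_eq_zero B i ?_ ?_
    · intro j
      rw [Function.update_self, this]
    · intro j
      rw [hB, Function.update_self, this, neg_zero]
  rw [AlternatingMap.map_update_sum] at h3
  simp only [AlternatingMap.map_update_smul] at h3
  rw [Finset.sum_eq_single i] at h3
  · rw [Function.update_eq_self] at h3
    exact (mul_ne_zero hi hc) h3
  · intro l _ hl
    rw [AlternatingMap.map_update_self _ _ hl.symm, smul_zero]
  · simp

/-- The standard symplectic matrix on two indices. -/
noncomputable def sympTwo (i j : Fin 2) : ℝ := if i < j then 1 else if j < i then -1 else 0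

lemma sympTwo_perm (t : Equiv.Perm (Fin 2)) :
    sympTwo (t 0) (t 1) = ((Equiv.Perm.sign t : ℤ) : ℝ) := by
  have h : ∀ t : Equiv.Perm (Fin 2), (Equiv.Perm.sign t = 1 ∧ t 0 < t 1) ∨
      (Equiv.Perm.sign t = -1 ∧ t 1 < t 0) := by decide
  rcases h t with ⟨h1, h2⟩ | ⟨h1, h2⟩
  · simp [sympTwo, h1, h2]
  · simp [sympTwo, h1, h2, h2.le]

/-- The product vanishes unless `τ` maps pairs to pairs. In that case `τ` is a permutation of the
blocks composed with permutations inside the blocks. The block part is even, since it acts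
identically on both members of the pairs, and the symplectic entries multiply to the sign of the
inner part. -/
lemma sign_mul_prod_symp_nonneg (τ : Equiv.Perm (Fin n × Fin 2)) :
    0 ≤ ((Equiv.Perm.sign τ : ℤ) : ℝ) * ∏ k : Fin n,
      (if (τ (k, 0)).1 = (τ (k, 1)).1 then sympTwo (τ (k, 0)).2 (τ (k, 1)).2 else 0) := by
  by_cases h : ∀ k, (τ (k, 0)).1 = (τ (k, 1)).1
  swap
  · push Not at h
    obtain ⟨k, hk⟩ := h
    rw [Finset.prod_eq_zero (Finset.mem_univ k) (if_neg hk), mul_zero]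
  have hf : ∀ k i, (τ (k, i)).1 = (τ (k, 0)).1 := fun k i ↦ by
    fin_cases i
    · rfl
    · exact (h k).symm
  have hbp : Function.Bijective fun k ↦ (τ (k, 0)).1 := by
    refine Function.Surjective.bijective_of_finite fun m ↦ ⟨(τ.symm (m, 0)).1, ?_⟩
    have := hf (τ.symm (m, 0)).1 (τ.symm (m, 0)).2
    simpa using this.symm
  have ht : ∀ k, Function.Bijective fun i ↦ (τ (k, i)).2 := fun k ↦ by
    refine Function.Injective.bijective_of_finite fun i j hij ↦ ?_
    have : τ (k, i) = τ (k, j) := Prod.ext ((hf k i).trans (hf k j).symm) hij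
    simpa using this
  let bp : Equiv.Perm (Fin n) := Equiv.ofBijective _ hbp
  let t : Fin n → Equiv.Perm (Fin 2) := fun k ↦ Equiv.ofBijective _ (ht k)
  have hτ : τ = Equiv.prodCongrLeft (fun _ : Fin 2 ↦ bp) * Equiv.prodCongrRight t := by
    ext1 ⟨k, i⟩
    exact Prod.ext (hf k i) rfl
  have hs : Equiv.Perm.sign τ = ∏ k, Equiv.Perm.sign (t k) := by
    rw [hτ, map_mul, Equiv.Perm.sign_prodCongrLeft, Equiv.Perm.sign_prodCongrRight,
      Fin.prod_univ_two, Int.units_mul_self, one_mul]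
  have hp : (∏ k : Fin n, (if (τ (k, 0)).1 = (τ (k, 1)).1 then
      sympTwo (τ (k, 0)).2 (τ (k, 1)).2 else 0)) = ((Equiv.Perm.sign τ : ℤ) : ℝ) := by
    rw [hs, Units.coe_prod, Int.cast_prod]
    refine Finset.prod_congr rfl fun k _ ↦ ?_
    rw [if_pos (h k)]
    exact sympTwo_perm (t k)
  rw [hp]
  exact mul_self_nonneg _

/-- No cancellation is possible: every permutation contributes a non-negative term, and the identity
contributes `1`. -/
lemma wedgeAlt_darboux_pos {c : Fin (2 * n) → V}
    (hc : ∀ p q : Fin n × Fin 2, B (c (pairEquiv n p)) (c (pairEquiv n q)) =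
      if p.1 = q.1 then sympTwo p.2 q.2 else 0) : 0 < wedgeAlt B n c := by
  rw [wedgeAlt_apply]
  refine mul_pos (by positivity) ?_
  rw [← (pairEquiv n).permCongr.sum_comp]
  have hterm : ∀ τ : Equiv.Perm (Fin n × Fin 2),
      ((Equiv.Perm.sign ((pairEquiv n).permCongr τ) : ℤ) : ℝ) *
        pairProd B n (c ∘ (pairEquiv n).permCongr τ) =
      ((Equiv.Perm.sign τ : ℤ) : ℝ) * ∏ k : Fin n,
      (if (τ (k, 0)).1 = (τ (k, 1)).1 then sympTwo (τ (k, 0)).2 (τ (k, 1)).2 else 0) := by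
    intro τ
    rw [Equiv.Perm.sign_permCongr, pairProd_apply]
    congr 1
    refine Finset.prod_congr rfl fun k _ ↦ ?_
    simp only [Function.comp_apply, Equiv.permCongr_apply, Equiv.symm_apply_apply]
    exact hc _ _
  simp only [hterm]
  refine Finset.sum_pos' (fun τ _ ↦ sign_mul_prod_symp_nonneg τ) ⟨1, Finset.mem_univ _, ?_⟩
  simp [sympTwo]

/-- Symplectic Gram–Schmidt: the map `P` projects onto the `B`-orthogonal of the pairs already
found. If its image were contained in the radical, the space would be the sum of the radical and a
span of at most `2k` vectors, against the bound on the rank since `k < n`. -/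
lemma exists_hyperbolic_pairs [FiniteDimensional ℝ V] (hB : ∀ x y, B x y = -B y x)
    (hr : 2 * n + Module.finrank ℝ (LinearMap.ker B) ≤ Module.finrank ℝ V) (k : ℕ) (hk : k ≤ n) :
    ∃ e f : Fin k → V, (∀ i j, B (e i) (f j) = if i = j then 1 else 0) ∧
      (∀ i j, B (e i) (e j) = 0) ∧ ∀ i j, B (f i) (f j) = 0 := by
  induction k with
  | zero => exact ⟨Fin.elim0, Fin.elim0, fun i ↦ i.elim0, fun i ↦ i.elim0, fun i ↦ i.elim0⟩
  | succ k ih =>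
    obtain ⟨e, f, hef, hee, hff⟩ := ih (by omega)
    have hfe : ∀ i j, B (f i) (e j) = if i = j then -1 else 0 := fun i j ↦ by
      rw [hB, hef]
      by_cases h : i = j
      · simp [h]
      · simp [h, Ne.symm h]
    let P : V → V := fun v ↦ v - ∑ i, B v (f i) • e i + ∑ i, B v (e i) • f i
    have hPe : ∀ v j, B (P v) (e j) = 0 := fun v j ↦ by simp [P, hee, hfe]
    have hPf : ∀ v j, B (P v) (f j) = 0 := fun v j ↦ by simp [P, hff, hef]
    have hPP : ∀ v w, B (P v) (P w) = B (P v) w := fun v w ↦ by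
      conv_lhs => rw [show P w = w - ∑ i, B w (f i) • e i + ∑ i, B w (e i) • f i from rfl]
      simp [hPe, hPf]
    have hv : ∃ v, P v ∉ LinearMap.ker B := by
      by_contra! hall
      have htop : LinearMap.ker B ⊔ (Submodule.span ℝ (Set.range e) ⊔
          Submodule.span ℝ (Set.range f)) = ⊤ := by
        refine eq_top_iff.2 fun v _ ↦ ?_
        have hsum : v = P v + (∑ i, B v (f i) • e i + ∑ i, (-B v (e i)) • f i) := by
          simp only [P, neg_smul, Finset.sum_neg_distrib]
          abel
        rw [hsum]
        refine Submodule.add_mem_sup (hall v) (Submodule.add_mem_sup ?_ ?_)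
        · exact Submodule.sum_mem _ fun i _ ↦
            Submodule.smul_mem _ _ (Submodule.subset_span ⟨i, rfl⟩)
        · exact Submodule.sum_mem _ fun i _ ↦
            Submodule.smul_mem _ _ (Submodule.subset_span ⟨i, rfl⟩)
      have h1 := Submodule.finrank_add_le_finrank_add_finrank (LinearMap.ker B)
        (Submodule.span ℝ (Set.range e) ⊔ Submodule.span ℝ (Set.range f))
      have h2 := Submodule.finrank_add_le_finrank_add_finrank (Submodule.span ℝ (Set.range e))
        (Submodule.span ℝ (Set.range f))
      have h3 := finrank_range_le_card (R := ℝ) e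
      have h4 := finrank_range_le_card (R := ℝ) f
      rw [htop, finrank_top] at h1
      simp only [Set.finrank, Fintype.card_fin] at h3 h4
      omega
    obtain ⟨v, hv⟩ := hv
    have hw : ∃ w, B (P v) w ≠ 0 := by
      by_contra! h
      exact hv (LinearMap.mem_ker.2 (LinearMap.ext h))
    obtain ⟨w, hw⟩ := hw
    -- The partner of `P v` is projected too, so that it stays orthogonal to the old pairs; `hPP`
    -- shows that its pairing with `P v` is unchanged.
    set w' := (B (P v) w)⁻¹ • P w with hw'
    have hself : ∀ x, B x x = 0 := fun x ↦ by linarith [hB x x]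
    have hvw : B (P v) w' = 1 := by
      rw [hw', map_smul, hPP, smul_eq_mul, inv_mul_cancel₀ hw]
    have hw'e : ∀ j, B w' (e j) = 0 := fun j ↦ by simp [hw', hPe]
    have hw'f : ∀ j, B w' (f j) = 0 := fun j ↦ by simp [hw', hPf]
    refine ⟨Fin.snoc e (P v), Fin.snoc f w', ?_, ?_, ?_⟩
    · intro i j
      refine Fin.lastCases ?_ (fun i ↦ ?_) i <;> refine Fin.lastCases ?_ (fun j ↦ ?_) j
      · simp [hvw]
      · simp [hPf, (Fin.castSucc_lt_last j).ne']
      · simp [hB (e i), hw'e, (Fin.castSucc_lt_last i).ne]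
      · simp [hef]
    · intro i j
      refine Fin.lastCases ?_ (fun i ↦ ?_) i <;> refine Fin.lastCases ?_ (fun j ↦ ?_) j
      · simp [hself]
      · simp [hPe]
      · simp [hB (e i), hPe]
      · simp [hee]
    · intro i j
      refine Fin.lastCases ?_ (fun i ↦ ?_) i <;> refine Fin.lastCases ?_ (fun j ↦ ?_) j
      · simp [hself]
      · simp [hw'f]
      · simp [hB (f i), hw'f]
      · simp [hff]

/-- The `n`-th power of a skew form of rank at least `2n` does not vanish. -/
theorem exists_wedgeAlt_ne_zero [FiniteDimensional ℝ V] (hB : ∀ x y, B x y = -B y x)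
    (hr : 2 * n + Module.finrank ℝ (LinearMap.ker B) ≤ Module.finrank ℝ V) :
    ∃ c : Fin (2 * n) → V, wedgeAlt B n c ≠ 0 := by
  obtain ⟨e, f, hef, hee, hff⟩ := exists_hyperbolic_pairs hB hr n le_rfl
  refine ⟨fun i ↦ ![e ((pairEquiv n).symm i).1, f ((pairEquiv n).symm i).1]
    ((pairEquiv n).symm i).2, (wedgeAlt_darboux_pos ?_).ne'⟩
  rintro ⟨k, i⟩ ⟨l, j⟩
  simp only [Equiv.symm_apply_apply]
  fin_cases i <;> fin_cases j
  · simp [hee, sympTwo]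
  · simp [hef, sympTwo]
  · simp only [Fin.mk_one, Fin.isValue, Matrix.cons_val_one, Matrix.cons_val_fin_one,
      Fin.zero_eta, Matrix.cons_val_zero]
    rw [hB, hef]
    by_cases h : k = l
    · simp [h, sympTwo]
    · simp [h, Ne.symm h]
  · simp [hff, sympTwo]

end WedgePower

end NullKahler

namespace NullKahler

/-! ### Parallelism of the power of the fundamental form -/

section ParallelPower

variable {n : ℕ} {M : Type u} [TopologicalSpace M] [ChartedSpace (Model n) M]

lemma dirDeriv_const_mul (c : ℝ) {f : M → ℝ} {x : M}
    (hf : MDifferentiableAt (𝓡 (4 * n)) 𝓘(ℝ, ℝ) f x) (v : TangentSpace (𝓡 (4 * n)) x) :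
    dirDeriv (fun y ↦ c * f y) x v = c * dirDeriv f x v := by
  rw [dirDeriv_mul mdifferentiableAt_const hf, dirDeriv_const, mul_zero, add_zero]

lemma mdifferentiableAt_finset_sum {ι : Type*} {f : ι → M → ℝ} {x : M}
    (hf : ∀ i, MDifferentiableAt (𝓡 (4 * n)) 𝓘(ℝ, ℝ) (f i) x) (s : Finset ι) :
    MDifferentiableAt (𝓡 (4 * n)) 𝓘(ℝ, ℝ) (fun y ↦ ∑ i ∈ s, f i y) x := by
  classical
  induction s using Finset.induction_on with
  | empty => simpa using mdifferentiableAt_const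
  | insert a s ha ih =>
    simp only [Finset.sum_insert ha]
    exact (hf a).add ih

lemma dirDeriv_finset_sum {ι : Type*} {f : ι → M → ℝ} {x : M}
    (hf : ∀ i, MDifferentiableAt (𝓡 (4 * n)) 𝓘(ℝ, ℝ) (f i) x) (s : Finset ι)
    (v : TangentSpace (𝓡 (4 * n)) x) :
    dirDeriv (fun y ↦ ∑ i ∈ s, f i y) x v = ∑ i ∈ s, dirDeriv (f i) x v := by
  classical
  induction s using Finset.induction_on with
  | empty => simpa using dirDeriv_const 0 v
  | insert a s ha ih =>
    simp only [Finset.sum_insert ha]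
    rw [dirDeriv_add (hf a) (mdifferentiableAt_finset_sum hf s), ih]

lemma mdifferentiableAt_finset_prod {ι : Type*} {f : ι → M → ℝ} {x : M}
    (hf : ∀ i, MDifferentiableAt (𝓡 (4 * n)) 𝓘(ℝ, ℝ) (f i) x) (s : Finset ι) :
    MDifferentiableAt (𝓡 (4 * n)) 𝓘(ℝ, ℝ) (fun y ↦ ∏ i ∈ s, f i y) x := by
  classical
  induction s using Finset.induction_on with
  | empty => simpa using mdifferentiableAt_const
  | insert a s ha ih =>
    simp only [Finset.prod_insert ha]
    exact (hf a).mul ih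

lemma dirDeriv_finset_prod {ι : Type*} [DecidableEq ι] {f : ι → M → ℝ} {x : M}
    (hf : ∀ i, MDifferentiableAt (𝓡 (4 * n)) 𝓘(ℝ, ℝ) (f i) x) (s : Finset ι)
    (v : TangentSpace (𝓡 (4 * n)) x) :
    dirDeriv (fun y ↦ ∏ i ∈ s, f i y) x v =
      ∑ i ∈ s, (∏ j ∈ s.erase i, f j x) * dirDeriv (f i) x v := by
  induction s using Finset.induction_on with
  | empty => simpa using dirDeriv_const 1 v
  | insert a s ha ih =>
    simp only [Finset.prod_insert ha]
    rw [dirDeriv_mul (hf a) (mdifferentiableAt_finset_prod hf s), ih, Finset.sum_insert ha,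
      Finset.erase_insert ha, Finset.mul_sum, add_comm]
    congr 1
    refine Finset.sum_congr rfl fun i hi ↦ ?_
    have hai : a ≠ i := fun h ↦ ha (h ▸ hi)
    rw [Finset.erase_insert_of_ne hai, Finset.prod_insert (by simp [ha]), mul_assoc]

variable [IsManifold (𝓡 (4 * n)) ∞ M] {g : SplitMetric n M} {N : EndField n M}

variable (g N) in
/-- The fundamental two-form at a point as a bilinear form. -/
noncomputable def fundBilin (x : M) : LinearMap.BilinForm ℝ (TangentSpace (𝓡 (4 * n)) x) :=
  LinearMap.mk₂ ℝ (fundForm g N x) (by simp [fundForm]) (by simp [fundForm]) (by simp [fundForm])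
    (by simp [fundForm])

lemma fundBilin_apply (x : M) (v w : TangentSpace (𝓡 (4 * n)) x) :
    fundBilin g N x v w = g.val x (N x v) w := rfl

lemma fundPower_eq (x : M) (v : Fin (2 * n) → TangentSpace (𝓡 (4 * n)) x) :
    fundPower g N x v = wedgeAlt (fundBilin g N x) n v :=
  wedgePower_eq (fundBilin g N x) v

lemma IsNullKahler.fundBilin_skew (h : IsNullKahler g N) (x : M)
    (v w : TangentSpace (𝓡 (4 * n)) x) : fundBilin g N x v w = -fundBilin g N x w v := by
  rw [fundBilin_apply, fundBilin_apply, h.skew, g.symm]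

lemma IsNullKahler.smoothNear_apply (h : IsNullKahler g N) {Y : VField n M} {x : M}
    (hY : SmoothNear Y x) : SmoothNear (fun y ↦ N y (Y y)) x := by
  obtain ⟨U, hU, hYU⟩ := hY
  exact ⟨U, hU, fun y hy ↦ contMDiffWithinAt_endField h.contMDiff (hYU y hy)⟩

/-- This is `∇Ω = 0`: metric compatibility differentiates both slots, and `∇N = 0` moves the
derivative through `N`. -/
lemma IsNullKahler.dirDeriv_fundForm (h : IsNullKahler g N) {Y Z : VField n M} {x : M}
    (hY : SmoothNear Y x) (hZ : SmoothNear Z x) (v : TangentSpace (𝓡 (4 * n)) x) :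
    dirDeriv (fun y ↦ g.val y (N y (Y y)) (Z y)) x v =
      fundBilin g N x (leviCivita g Y x v) (Z x) + fundBilin g N x (Y x) (leviCivita g Z x v) := by
  rw [leviCivita_metric g (h.smoothNear_apply hY).mdifferentiableAt hZ.mdifferentiableAt,
    h.parallel x Y hY]
  rfl

/-- The form `Ω^{∧n}` of a null–Kähler structure is parallel. -/
theorem IsNullKahler.isParallelForm_fundPower (h : IsNullKahler g N) :
    IsParallelForm g (fundPower g N) := by
  intro x Y hY v
  have hF : ∀ i j, MDifferentiableAt (𝓡 (4 * n)) 𝓘(ℝ, ℝ)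
      (fun y ↦ g.val y (N y (Y i y)) (Y j y)) x := fun i j ↦
    g.mdifferentiableAt_val (h.smoothNear_apply (hY i)).mdifferentiableAt (hY j).mdifferentiableAt
  simp only [fundPower_eq]
  rw [sum_wedgeAlt_update]
  simp only [wedgeAlt_apply, pairProd_apply, fundBilin_apply, Function.comp_apply]
  have hP : ∀ σ : Equiv.Perm (Fin (2 * n)), MDifferentiableAt (𝓡 (4 * n)) 𝓘(ℝ, ℝ)
      (fun y ↦ ∏ k : Fin n, g.val y (N y (Y (σ (pairEquiv n (k, 0))) y))
        (Y (σ (pairEquiv n (k, 1))) y)) x := fun σ ↦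
    mdifferentiableAt_finset_prod (fun k ↦ hF _ _) _
  have hS : ∀ σ : Equiv.Perm (Fin (2 * n)), MDifferentiableAt (𝓡 (4 * n)) 𝓘(ℝ, ℝ)
      (fun y ↦ ((Equiv.Perm.sign σ : ℤ) : ℝ) *
        ∏ k : Fin n, g.val y (N y (Y (σ (pairEquiv n (k, 0))) y))
        (Y (σ (pairEquiv n (k, 1))) y)) x := fun σ ↦
    mdifferentiableAt_const.mul (hP σ)
  rw [dirDeriv_const_mul _ (mdifferentiableAt_finset_sum hS _), dirDeriv_finset_sum hS]
  congr 1
  refine Finset.sum_congr rfl fun σ _ ↦ ?_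
  rw [dirDeriv_const_mul _ (hP σ), dirDeriv_finset_prod (fun k ↦ hF _ _)]
  congr 1
  -- For a fixed permutation both sides are Leibniz sums over the `n` factors, which are compared
  -- one at a time.
  refine Eq.trans ?_ (sum_pairProd_update (fundBilin g N x) ((fun l ↦ Y l x) ∘ σ)
    (fun i ↦ leviCivita g (Y (σ i)) x v)).symm
  refine Finset.sum_congr rfl fun k _ ↦ ?_
  rw [h.dirDeriv_fundForm (hY _) (hY _)]
  rfl

end ParallelPower

end NullKahler

namespace NullKahler

/-! ### Reflections and the covering of isometries by products of gamma matrices -/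

section Clifford

variable {n : ℕ}

/-- The standard inner product as a bilinear form. -/
noncomputable def stdBilin (n : ℕ) : LinearMap.BilinForm ℝ (Vec n) :=
  LinearMap.mk₂ ℝ stdInner
    (fun v v' w ↦ by
      simp only [stdInner, Pi.add_apply, ← Finset.sum_add_distrib]
      exact Finset.sum_congr rfl fun a _ ↦ by ring)
    (fun c v w ↦ by
      simp only [stdInner, Pi.smul_apply, smul_eq_mul, Finset.mul_sum]
      exact Finset.sum_congr rfl fun a _ ↦ by ring)
    (fun v w w' ↦ by
      simp only [stdInner, Pi.add_apply, ← Finset.sum_add_distrib]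
      exact Finset.sum_congr rfl fun a _ ↦ by ring)
    (fun c v w ↦ by
      simp only [stdInner, Pi.smul_apply, smul_eq_mul, Finset.mul_sum]
      exact Finset.sum_congr rfl fun a _ ↦ by ring)

lemma stdBilin_apply (v w : Vec n) : stdBilin n v w = stdInner v w := rfl

lemma stdBilin_symm (v w : Vec n) : stdBilin n v w = stdBilin n w v := by
  simp only [stdBilin_apply, stdInner]
  exact Finset.sum_congr rfl fun a _ ↦ by ring

lemma eta_mul_self (a : Idx n) : eta a * eta a = 1 := by
  rcases a with i | i <;> simp [eta]

lemma stdBilin_single_right (v : Vec n) (a : Idx n) :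
    stdBilin n v (Pi.single a 1) = eta a * v a := by
  simp [stdBilin_apply, stdInner, Pi.single_apply]

lemma stdBilin_single (a c : Idx n) :
    stdBilin n (Pi.single a 1) (Pi.single c 1) = if a = c then eta a else 0 := by
  rw [stdBilin_single_right, Pi.single_apply]
  by_cases h : a = c
  · simp [h]
  · simp [h, Ne.symm h]

lemma stdBilin_nondegenerate {v : Vec n} (h : ∀ w, stdBilin n v w = 0) : v = 0 := by
  funext a
  have := h (Pi.single a 1)
  rw [stdBilin_single_right] at this
  rcases a with i | i <;> simpa [eta] using this

lemma gamma_apply (v : Vec n) : gamma v = ∑ i, ((v (Sum.inl i) + v (Sum.inr i)) • create i +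
    (v (Sum.inl i) - v (Sum.inr i)) • annih i) := rfl

lemma gamma_mul_self (v : Vec n) : gamma v * gamma v = stdInner v v • 1 := by
  have h := gamma_clifford v v
  rw [← two_smul ℝ (gamma v * gamma v), mul_smul] at h
  exact smul_right_injective _ (two_ne_zero' ℝ) h

lemma gamma_anticomm {v w : Vec n} (h : stdBilin n v w = 0) :
    gamma v * gamma w = (-1 : ℝ) • (gamma w * gamma v) := by
  have := gamma_clifford v w
  rw [show stdInner v w = 0 from h, mul_zero, zero_smul] at this
  exact (eq_neg_of_add_eq_zero_left this).trans (neg_one_smul ℝ _).symm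

/-- The null vector with gamma matrix `a†_i`. -/
noncomputable def creVec (i : Fin (2 * n)) : Vec n :=
  Pi.single (Sum.inl i) (1 / 2) + Pi.single (Sum.inr i) (1 / 2)

/-- The null vector with gamma matrix `a_i`. -/
noncomputable def annVec (i : Fin (2 * n)) : Vec n :=
  Pi.single (Sum.inl i) (1 / 2) - Pi.single (Sum.inr i) (1 / 2)

lemma gamma_single_inl (i : Fin (2 * n)) (c : ℝ) :
    gamma (Pi.single (Sum.inl i) c : Vec n) = c • (create i + annih i) := by
  rw [gamma_apply, Finset.sum_eq_single i]
  · simp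
  · intro j _ hj
    simp [hj]
  · simp

lemma gamma_single_inr (i : Fin (2 * n)) (c : ℝ) :
    gamma (Pi.single (Sum.inr i) c : Vec n) = c • (create i - annih i) := by
  rw [gamma_apply, Finset.sum_eq_single i]
  · simp only [Pi.single_eq_same, ne_eq, reduceCtorEq, not_false_eq_true, Pi.single_eq_of_ne]
    module
  · intro j _ hj
    simp [hj]
  · simp

lemma gamma_creVec (i : Fin (2 * n)) : gamma (creVec i : Vec n) = create i := by
  rw [creVec, map_add, gamma_single_inl, gamma_single_inr]
  module

lemma gamma_annVec (i : Fin (2 * n)) : gamma (annVec i : Vec n) = annih i := by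
  rw [annVec, map_sub, gamma_single_inl, gamma_single_inr]
  module

/-- The product of the gamma matrices of a list of vectors. -/
noncomputable def gammaProd (L : List (Vec n)) : Module.End ℝ (Spinor n) := (L.map gamma).prod

lemma gammaProd_nil : gammaProd ([] : List (Vec n)) = 1 := rfl

lemma gammaProd_cons (X : Vec n) (L : List (Vec n)) :
    gammaProd (X :: L) = gamma X * gammaProd L := by
  simp [gammaProd]

lemma gammaProd_append (L L' : List (Vec n)) :
    gammaProd (L ++ L') = gammaProd L * gammaProd L' := by
  simp [gammaProd]

/-- Vectors of squared norm `±1`. -/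
def IsUnitVec (X : Vec n) : Prop := stdInner X X = 1 ∨ stdInner X X = -1

lemma IsUnitVec.sq {X : Vec n} (h : IsUnitVec X) : stdInner X X * stdInner X X = 1 := by
  rcases h with h | h <;> simp [h]

lemma IsUnitVec.isUnit_gamma {X : Vec n} (h : IsUnitVec X) : IsUnit (gamma X) := by
  have h1 : gamma X * (stdInner X X • gamma X) = 1 := by
    rw [mul_smul_comm, gamma_mul_self, smul_smul, h.sq, one_smul]
  have h2 : (stdInner X X • gamma X) * gamma X = 1 := by
    rw [smul_mul_assoc, gamma_mul_self, smul_smul, h.sq, one_smul]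
  exact ⟨⟨_, _, h1, h2⟩, rfl⟩

lemma isUnit_gammaProd {L : List (Vec n)} (hL : ∀ X ∈ L, IsUnitVec X) : IsUnit (gammaProd L) := by
  induction L with
  | nil => exact isUnit_one
  | cons X L ih =>
    rw [gammaProd_cons]
    exact (hL X (by simp)).isUnit_gamma.mul (ih fun Y hY ↦ hL Y (by simp [hY]))

/-- Linear isometries of `ℝ^{2n,2n}`. -/
def IsIsometry (A : Vec n →ₗ[ℝ] Vec n) : Prop :=
  ∀ v w, stdBilin n (A v) (A w) = stdBilin n v w

lemma IsIsometry.injective {A : Vec n →ₗ[ℝ] Vec n} (hA : IsIsometry A) : Function.Injective A := by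
  rw [injective_iff_map_eq_zero]
  intro v hv
  refine stdBilin_nondegenerate fun w ↦ ?_
  rw [← hA, hv, map_zero, LinearMap.zero_apply]

lemma IsIsometry.surjective {A : Vec n →ₗ[ℝ] Vec n} (hA : IsIsometry A) : Function.Surjective A :=
  LinearMap.injective_iff_surjective.1 hA.injective

/-- The reflection in the hyperplane orthogonal to a unit vector. -/
noncomputable def reflVec (X : Vec n) : Vec n →ₗ[ℝ] Vec n :=
  -- The square of `X` will be `±1`, so it serves as its own inverse in the usual reflection
  -- formula.
  LinearMap.id - (2 * stdInner X X) • (stdBilin n X).smulRight X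

lemma reflVec_apply (X v : Vec n) :
    reflVec X v = v - (2 * stdInner X X * stdBilin n X v) • X := by
  simp [reflVec, smul_smul]

lemma IsUnitVec.isIsometry_reflVec {X : Vec n} (h : IsUnitVec X) : IsIsometry (reflVec X) := by
  intro v w
  have hs := h.sq
  rw [← stdBilin_apply] at hs
  simp only [reflVec_apply, map_sub, map_smul, LinearMap.sub_apply, LinearMap.smul_apply,
    smul_eq_mul, ← stdBilin_apply]
  rw [stdBilin_symm v X]
  linear_combination (4 * stdBilin n X X * stdBilin n X v * stdBilin n X w) * (hs - hs) +
    4 * stdBilin n X v * stdBilin n X w * stdBilin n X X * hs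

/-- Conjugation by `γ(X)` is minus the reflection along `X`. This minus sign accumulates to `(-1) ^
L.length` in the covering relations for products. -/
lemma IsUnitVec.gamma_mul_reflVec {X : Vec n} (h : IsUnitVec X) (v : Vec n) :
    gamma X * gamma (reflVec X v) = (-1 : ℝ) • (gamma v * gamma X) := by
  have hs := h.sq
  rw [reflVec_apply, map_sub, map_smul, mul_sub, mul_smul_comm, gamma_mul_self,
    eq_sub_of_add_eq (gamma_clifford X v), smul_smul]
  have : 2 * stdInner X X * (stdBilin n X v) * stdInner X X = 2 * stdInner X v := by
    rw [stdBilin_apply]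
    linear_combination 2 * stdInner X v * hs
  rw [this]
  module

/-- A vector of non-zero square can be normalised. -/
lemma exists_smul_isUnitVec {Y : Vec n} (hY : stdInner Y Y ≠ 0) :
    ∃ c : ℝ, c ≠ 0 ∧ IsUnitVec (c • Y) ∧ stdInner (c • Y) (c • Y) * c ^ 2 = (stdInner Y Y)⁻¹ := by
  have hq : 0 < |stdInner Y Y| := abs_pos.2 hY
  have hc : ((√|stdInner Y Y|)⁻¹) ^ 2 = |stdInner Y Y|⁻¹ := by
    rw [inv_pow, Real.sq_sqrt hq.le]
  have hn : stdInner ((√|stdInner Y Y|)⁻¹ • Y) ((√|stdInner Y Y|)⁻¹ • Y) =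
      |stdInner Y Y|⁻¹ * stdInner Y Y := by
    rw [← hc]
    simp only [← stdBilin_apply, map_smul, LinearMap.smul_apply, smul_eq_mul]
    ring
  refine ⟨(√|stdInner Y Y|)⁻¹, by positivity, ?_, ?_⟩
  · unfold IsUnitVec
    rw [hn]
    rcases lt_or_gt_of_ne hY with h | h
    · right
      rw [abs_of_neg h]
      field_simp
    · left
      rw [abs_of_pos h]
      field_simp
  · rw [hn, hc]
    have : |stdInner Y Y|⁻¹ * |stdInner Y Y|⁻¹ = (stdInner Y Y)⁻¹ * (stdInner Y Y)⁻¹ := by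
      rw [← mul_inv, ← mul_inv, abs_mul_abs_self]
    calc _ = stdInner Y Y * (|stdInner Y Y|⁻¹ * |stdInner Y Y|⁻¹) := by ring
      _ = _ := by rw [this]; field_simp

/-- Two vectors of the same square `±1` are related by at most two reflections, in directions that
are orthogonal to every vector orthogonal to both of them. -/
lemma exists_reflections {e f : Vec n} (he : IsUnitVec e) (hf : stdInner f f = stdInner e e) :
    ∃ L : List (Vec n), (∀ X ∈ L, IsUnitVec X) ∧ (L.map reflVec).prod f = e ∧
      ∀ v, stdBilin n v e = 0 → stdBilin n v f = 0 → (L.map reflVec).prod v = v := by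
  have key : ∀ Y : Vec n, stdInner Y Y ≠ 0 → ∃ X : Vec n, IsUnitVec X ∧
      (∀ v, reflVec X v = v - (2 * (stdInner Y Y)⁻¹ * stdBilin n Y v) • Y) := by
    intro Y hY
    obtain ⟨c, -, hc, hc'⟩ := exists_smul_isUnitVec hY
    refine ⟨c • Y, hc, fun v ↦ ?_⟩
    rw [reflVec_apply, map_smul, LinearMap.smul_apply, smul_smul, ← hc']
    congr 2
    simp only [smul_eq_mul]
    ring
  -- If `f - e` is not null, the reflection along it takes `f` to `e`. If it is null, the
  -- parallelogram law gives `f + e` the square `4 q(e) ≠ 0`; the reflection along `f + e` takes `f`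
  -- to `-e`, and the one along `e` restores the sign.
  by_cases h : stdInner (f - e) (f - e) = 0
  · have hsum : stdInner (f + e) (f + e) = 4 * stdInner e e := by
      simp only [← stdBilin_apply, map_sub, map_add, LinearMap.sub_apply, LinearMap.add_apply]
        at h hf ⊢
      linear_combination -h + 2 * hf
    have he0 : stdInner e e ≠ 0 := by rcases he with h | h <;> simp [h]
    obtain ⟨X, hX, hXv⟩ := key (f + e) (by rw [hsum]; simpa using he0)
    refine ⟨[e, X], ?_, ?_, ?_⟩
    · simp [he, hX]
    · have hXf : reflVec X f = -e := by
        rw [hXv, hsum]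
        have : 2 * (4 * stdInner e e)⁻¹ * stdBilin n (f + e) f = 1 := by
          have h1 : stdBilin n (f + e) f = 2 * stdInner e e := by
            simp only [← stdBilin_apply, map_sub, map_add, LinearMap.sub_apply,
              LinearMap.add_apply] at h hf ⊢
            rw [stdBilin_symm e f] at h ⊢
            linear_combination -h / 2 + 3 / 2 * hf
          rw [h1]
          field_simp
          norm_num
        rw [this, one_smul]
        abel
      simp only [List.map_cons, List.map_nil, List.prod_cons, List.prod_nil, mul_one,
        Module.End.mul_apply, hXf]
      rw [map_neg, reflVec_apply, ← stdBilin_apply]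
      have : 2 * stdBilin n e e * stdBilin n e e = 2 := by
        have := he.sq
        rw [← stdBilin_apply] at this
        linarith
      rw [this]
      module
    · intro v hve hvf
      have h1 : reflVec X v = v := by
        rw [hXv, map_add, LinearMap.add_apply, stdBilin_symm f, stdBilin_symm e, hve, hvf]
        simp
      simp only [List.map_cons, List.map_nil, List.prod_cons, List.prod_nil, mul_one,
        Module.End.mul_apply, h1]
      rw [reflVec_apply, stdBilin_symm e, hve]
      simp
  · obtain ⟨X, hX, hXv⟩ := key (f - e) h
    refine ⟨[X], by simp [hX], ?_, ?_⟩
    · simp only [List.map_cons, List.map_nil, List.prod_cons, List.prod_nil, mul_one]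
      rw [hXv]
      have : 2 * (stdInner (f - e) (f - e))⁻¹ * stdBilin n (f - e) f = 1 := by
        have h1 : 2 * stdBilin n (f - e) f = stdInner (f - e) (f - e) := by
          simp only [← stdBilin_apply, map_sub, LinearMap.sub_apply] at hf ⊢
          rw [stdBilin_symm e f]
          linear_combination hf
        rw [mul_right_comm, h1, mul_inv_cancel₀ h]
      rw [this, one_smul]
      abel
    · intro v hve hvf
      simp only [List.map_cons, List.map_nil, List.prod_cons, List.prod_nil, mul_one]
      rw [hXv, map_sub, LinearMap.sub_apply, stdBilin_symm f, stdBilin_symm e, hve, hvf]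
      simp

lemma isIsometry_prod_reflVec {L : List (Vec n)} (hL : ∀ X ∈ L, IsUnitVec X) :
    IsIsometry (L.map reflVec).prod := by
  induction L with
  | nil => exact fun v w ↦ rfl
  | cons X L ih =>
    intro v w
    simp only [List.map_cons, List.prod_cons, Module.End.mul_apply]
    rw [(hL X (by simp)).isIsometry_reflVec, ih fun Y hY ↦ hL Y (by simp [hY])]

/-- The list is reversed so that the last gamma matrix of the product meets the outermost
reflection. -/
lemma gammaProd_mul_reflVec {L : List (Vec n)} (hL : ∀ X ∈ L, IsUnitVec X) (v : Vec n) :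
    gammaProd L.reverse * gamma ((L.map reflVec).prod v) =
      (-1 : ℝ) ^ L.length • (gamma v * gammaProd L.reverse) := by
  induction L with
  | nil => simp [gammaProd_nil]
  | cons X L ih =>
    have hX := hL X (by simp)
    specialize ih fun Y hY ↦ hL Y (by simp [hY])
    simp only [List.map_cons, List.prod_cons, Module.End.mul_apply, List.reverse_cons,
      gammaProd_append, gammaProd_cons, gammaProd_nil, mul_one, List.length_cons]
    rw [mul_assoc, hX.gamma_mul_reflVec, mul_smul_comm, ← mul_assoc, ih, pow_succ', smul_mul_assoc,
      mul_assoc, smul_smul]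

/-- Every isometry of `ℝ^{2n,2n}` is covered by a product of gamma matrices of unit vectors. -/
theorem exists_gammaProd_covering {A : Vec n →ₗ[ℝ] Vec n} (hA : IsIsometry A) :
    ∃ L : List (Vec n), (∀ X ∈ L, IsUnitVec X) ∧
      ∀ v, gammaProd L * gamma v = (-1 : ℝ) ^ L.length • (gamma (A v) * gammaProd L) := by
  -- Cartan–Dieudonné by induction on the set `S` of basis vectors already fixed: `A'` is what
  -- remains of `A` after the reflections peeled off so far, and `L` records them. Once `S` is
  -- everything, `A'` is the identity.
  have key : ∀ S : Finset (Idx n), ∃ L : List (Vec n), ∃ A' : Vec n →ₗ[ℝ] Vec n,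
      (∀ X ∈ L, IsUnitVec X) ∧ IsIsometry A' ∧ (∀ a ∈ S, A' (Pi.single a 1) = Pi.single a 1) ∧
      ∀ v, gammaProd L * gamma (A' v) = (-1 : ℝ) ^ L.length • (gamma (A v) * gammaProd L) := by
    intro S
    induction S using Finset.induction_on with
    | empty => exact ⟨[], A, by simp, hA, by simp, by simp [gammaProd_nil]⟩
    | insert b S hb ih =>
      obtain ⟨L, A', hL, hA', hfix, hcov⟩ := ih
      have heb : IsUnitVec (Pi.single b 1 : Vec n) := by
        unfold IsUnitVec
        rw [← stdBilin_apply, stdBilin_single, if_pos rfl]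
        rcases b with i | i <;> simp [eta]
      obtain ⟨L', hL', hLf, hLv⟩ := exists_reflections heb (hA' (Pi.single b 1) (Pi.single b 1))
      refine ⟨L ++ L'.reverse, (L'.map reflVec).prod * A', ?_, ?_, ?_, ?_⟩
      · intro X hX
        rcases List.mem_append.1 hX with h | h
        · exact hL X h
        · exact hL' X (by simpa using h)
      · intro v w
        rw [Module.End.mul_apply, Module.End.mul_apply, isIsometry_prod_reflVec hL', hA']
      · intro a ha
        rw [Module.End.mul_apply]
        rcases Finset.mem_insert.1 ha with rfl | ha
        · exact hLf
        · have hab : a ≠ b := fun h ↦ hb (h ▸ ha)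
          rw [hfix a ha]
          -- The new reflections do not disturb the old vectors: a fixed `e_a` is orthogonal to
          -- `e_b` and, as `A'` is an isometry fixing `e_a`, also to `A' e_b`.
          refine hLv _ (by rw [stdBilin_single, if_neg hab]) ?_
          rw [← hfix a ha, hA', stdBilin_single, if_neg hab]
      · intro v
        rw [gammaProd_append, mul_assoc, Module.End.mul_apply, gammaProd_mul_reflVec hL',
          mul_smul_comm, ← mul_assoc, hcov, List.length_append, List.length_reverse, pow_add,
          smul_mul_assoc, smul_smul, mul_assoc, mul_comm ((-1 : ℝ) ^ L'.length)]
  obtain ⟨L, A', hL, -, hfix, hcov⟩ := key Finset.univ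
  refine ⟨L, hL, fun v ↦ ?_⟩
  have : A' = LinearMap.id := by
    refine LinearMap.pi_ext' fun a ↦ LinearMap.ext_ring ?_
    simpa using hfix a (Finset.mem_univ a)
  rw [← hcov, this]
  rfl

end Clifford

end NullKahler

namespace NullKahler

/-! ### The invariant pairing, the Fock vacuum and irreducibility -/

section Pairing

variable {n : ℕ}

lemma jwSign_ne_zero {m : ℕ} (i : Fin m) (A : Finset (Fin m)) : jwSign i A ≠ 0 := fun h ↦ by
  simpa [h] using jwSign_mul_self i A

/-! ### The charge conjugation and the pairing -/

lemma chargeConj_eq : chargeConj n =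
    ((List.finRange (2 * n)).map fun i ↦ gamma (Pi.single (Sum.inl i) 1 : Vec n)).prod := by
  rw [chargeConj, List.ofFn_eq_map]

lemma gamma_inl_mul_prod (j : Fin (2 * n)) (l : List (Fin (2 * n))) :
    gamma (Pi.single (Sum.inl j) 1 : Vec n) *
      (l.map fun i ↦ gamma (Pi.single (Sum.inl i) 1 : Vec n)).prod =
    (-1 : ℝ) ^ (l.length + l.count j) •
      ((l.map fun i ↦ gamma (Pi.single (Sum.inl i) 1 : Vec n)).prod *
        gamma (Pi.single (Sum.inl j) 1)) := by
  induction l with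
  | nil => simp
  | cons i l ih =>
    rw [List.map_cons, List.prod_cons, List.length_cons]
    by_cases hij : i = j
    · subst hij
      rw [List.count_cons_self, mul_assoc, ← mul_smul_comm]
      congr 1
      rw [ih]
      congr 1
      ring
    · rw [List.count_cons_of_ne hij, ← mul_assoc, gamma_anticomm, smul_mul_assoc, mul_assoc, ih,
        mul_smul_comm, smul_smul, mul_assoc]
      · congr 1
        ring
      · rw [stdBilin_single, if_neg]
        simpa using Ne.symm hij

lemma gamma_inr_mul_prod (j : Fin (2 * n)) (l : List (Fin (2 * n))) :
    gamma (Pi.single (Sum.inr j) 1 : Vec n) *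
      (l.map fun i ↦ gamma (Pi.single (Sum.inl i) 1 : Vec n)).prod =
    (-1 : ℝ) ^ l.length •
      ((l.map fun i ↦ gamma (Pi.single (Sum.inl i) 1 : Vec n)).prod *
        gamma (Pi.single (Sum.inr j) 1)) := by
  induction l with
  | nil => simp
  | cons i l ih =>
    rw [List.map_cons, List.prod_cons, List.length_cons, ← mul_assoc, gamma_anticomm,
      smul_mul_assoc, mul_assoc, ih, mul_smul_comm, smul_smul, mul_assoc]
    · congr 1
      ring
    · rw [stdBilin_single, if_neg (by simp)]

/-- Of the `2n` factors of `C`, one is the given gamma matrix itself and `2n - 1` anticommute with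
it. For a basis vector of square `-1` all `2n` factors anticommute, hence the other sign in
`gamma_inr_mul_chargeConj`. -/
lemma gamma_inl_mul_chargeConj (j : Fin (2 * n)) :
    gamma (Pi.single (Sum.inl j) 1 : Vec n) * chargeConj n =
      (-1 : ℝ) • (chargeConj n * gamma (Pi.single (Sum.inl j) 1)) := by
  rw [chargeConj_eq, gamma_inl_mul_prod, List.length_finRange,
    List.count_eq_one_of_mem (List.nodup_finRange _) (List.mem_finRange j), pow_succ, pow_mul]
  simp

lemma gamma_inr_mul_chargeConj (j : Fin (2 * n)) :
    gamma (Pi.single (Sum.inr j) 1 : Vec n) * chargeConj n =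
      chargeConj n * gamma (Pi.single (Sum.inr j) 1) := by
  rw [chargeConj_eq, gamma_inr_mul_prod, List.length_finRange, pow_mul]
  simp

/-- Creation and annihilation operators are mutually transposed, through the bijection `A ↦ A.erase
i`. Hence the gamma matrices of square `+1` are symmetric and those of square `-1` are skew. -/
lemma sum_create_mul (i : Fin (2 * n)) (φ χ : Spinor n) :
    ∑ A, create i φ A * χ A = ∑ A, φ A * annih i χ A := by
  have h1 : ∑ A, create i φ A * χ A =
      ∑ A ∈ Finset.univ.filter (fun A ↦ i ∈ A), jwSign i A * φ (A.erase i) * χ A := by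
    rw [Finset.sum_filter]
    refine Finset.sum_congr rfl fun A _ ↦ ?_
    rw [create_apply]
    split_ifs <;> simp
  have h2 : ∑ A, φ A * annih i χ A =
      ∑ A ∈ Finset.univ.filter (fun A ↦ i ∉ A), φ A * (jwSign i A * χ (insert i A)) := by
    rw [Finset.sum_filter]
    refine Finset.sum_congr rfl fun A _ ↦ ?_
    rw [annih_apply]
    split_ifs <;> simp_all
  rw [h1, h2]
  refine Finset.sum_bij' (fun A _ ↦ A.erase i) (fun A _ ↦ insert i A) ?_ ?_ ?_ ?_ ?_
  · simp
  · simp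
  · intro A hA
    simp only [Finset.mem_filter, Finset.mem_univ, true_and] at hA
    exact Finset.insert_erase hA
  · intro A hA
    simp only [Finset.mem_filter, Finset.mem_univ, true_and] at hA
    exact Finset.erase_insert hA
  · intro A hA
    simp only [Finset.mem_filter, Finset.mem_univ, true_and] at hA
    rw [jwSign_erase hA, Finset.insert_erase hA, if_neg (lt_irrefl i)]
    ring

lemma sum_annih_mul (i : Fin (2 * n)) (φ χ : Spinor n) :
    ∑ A, annih i φ A * χ A = ∑ A, φ A * create i χ A := by
  have := sum_create_mul i χ φ
  simp only [mul_comm (χ _)] at this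
  rw [← this]
  exact Finset.sum_congr rfl fun A _ ↦ mul_comm _ _

/-- The pairing as a bilinear form. -/
noncomputable def pairingBilin (n : ℕ) : LinearMap.BilinForm ℝ (Spinor n) :=
  LinearMap.mk₂ ℝ spinorPairing
    (fun φ φ' ψ ↦ by simp [spinorPairing, add_mul, Finset.sum_add_distrib])
    (fun c φ ψ ↦ by simp [spinorPairing, mul_assoc, Finset.mul_sum])
    (fun φ ψ ψ' ↦ by simp [spinorPairing, mul_add, Finset.sum_add_distrib])
    (fun c φ ψ ↦ by simp [spinorPairing, mul_left_comm, Finset.mul_sum])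

lemma pairingBilin_apply (φ ψ : Spinor n) : pairingBilin n φ ψ = spinorPairing φ ψ := rfl

/-- A symmetric gamma matrix anticommutes with `C` and a skew one commutes with it; the two signs
combine to the same minus in both cases. -/
lemma pairingBilin_gamma (v : Vec n) (φ ψ : Spinor n) :
    pairingBilin n (gamma v φ) ψ = -pairingBilin n φ (gamma v ψ) := by
  have hl : ∀ i, pairingBilin n (gamma (Pi.single (Sum.inl i) 1) φ) ψ =
      -pairingBilin n φ (gamma (Pi.single (Sum.inl i) 1) ψ) := by
    intro i
    have h := congrArg (fun T ↦ T ψ) (gamma_inl_mul_chargeConj (n := n) i)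
    simp only [Module.End.mul_apply, LinearMap.smul_apply, neg_one_smul] at h
    rw [← neg_eq_iff_eq_neg] at h
    simp only [pairingBilin_apply, spinorPairing, ← h]
    rw [gamma_single_inl]
    simp only [one_smul, LinearMap.add_apply, Pi.add_apply, add_mul, Pi.neg_apply, mul_neg,
      Finset.sum_neg_distrib, neg_neg, mul_add, Finset.sum_add_distrib, sum_create_mul,
      sum_annih_mul]
    ring
  have hr : ∀ i, pairingBilin n (gamma (Pi.single (Sum.inr i) 1) φ) ψ =
      -pairingBilin n φ (gamma (Pi.single (Sum.inr i) 1) ψ) := by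
    intro i
    have h := congrArg (fun T ↦ T ψ) (gamma_inr_mul_chargeConj (n := n) i)
    simp only [Module.End.mul_apply] at h
    simp only [pairingBilin_apply, spinorPairing, ← h]
    rw [gamma_single_inr]
    simp only [one_smul, LinearMap.sub_apply, Pi.sub_apply, sub_mul, mul_sub,
      Finset.sum_sub_distrib, sum_create_mul, sum_annih_mul]
    ring
  have hv : v = ∑ a, v a • (Pi.single a 1 : Vec n) := by
    simpa using (pi_eq_sum_univ' v)
  rw [hv]
  simp only [map_sum, map_smul, LinearMap.sum_apply, LinearMap.smul_apply,
    ← Finset.sum_neg_distrib]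
  refine Finset.sum_congr rfl fun a _ ↦ ?_
  rcases a with i | i
  · rw [hl, smul_neg]
  · rw [hr, smul_neg]

/-- Each unit vector `X` contributes the factor `-q(X) = ±1`. -/
lemma pairingBilin_gammaProd {L : List (Vec n)} (hL : ∀ X ∈ L, IsUnitVec X) :
    ∃ δ : ℝ, (δ = 1 ∨ δ = -1) ∧ ∀ φ ψ,
      pairingBilin n (gammaProd L φ) (gammaProd L ψ) = δ * pairingBilin n φ ψ := by
  induction L with
  | nil => exact ⟨1, Or.inl rfl, fun φ ψ ↦ by simp [gammaProd_nil]⟩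
  | cons X L ih =>
    obtain ⟨δ, hδ, h⟩ := ih fun Y hY ↦ hL Y (by simp [hY])
    refine ⟨-stdInner X X * δ, ?_, fun φ ψ ↦ ?_⟩
    · rcases hδ with rfl | rfl <;> rcases hL X (by simp) with h | h <;> simp [h]
    · rw [gammaProd_cons, Module.End.mul_apply, Module.End.mul_apply, pairingBilin_gamma,
        ← Module.End.mul_apply (gamma X), gamma_mul_self, LinearMap.smul_apply, map_smul,
        Module.End.one_apply, h, smul_eq_mul]
      ring

lemma gamma_inl_apply (i : Fin (2 * n)) (φ : Spinor n) {A : Finset (Fin (2 * n))} (hi : i ∉ A) :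
    gamma (Pi.single (Sum.inl i) 1) φ A = jwSign i A * φ (insert i A) := by
  rw [gamma_single_inl, one_smul, LinearMap.add_apply, Pi.add_apply, create_apply, annih_apply,
    if_neg hi, if_neg hi, zero_add]

lemma exists_prod_gamma_inl_apply {l : List (Fin (2 * n))} (hl : l.Nodup)
    (A : Finset (Fin (2 * n))) (hA : ∀ i ∈ l, i ∉ A) :
    ∃ c : ℝ, c ≠ 0 ∧ ∀ φ : Spinor n,
      (l.map fun i ↦ gamma (Pi.single (Sum.inl i) 1 : Vec n)).prod φ A =
        c * φ (A ∪ l.toFinset) := by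
  induction l generalizing A with
  | nil => exact ⟨1, one_ne_zero, fun φ ↦ by simp⟩
  | cons i l ih =>
    rw [List.nodup_cons] at hl
    obtain ⟨c, hc, h⟩ := ih hl.2 (insert i A) fun j hj ↦ by
      rw [Finset.mem_insert, not_or]
      exact ⟨fun hji ↦ hl.1 (hji ▸ hj), hA j (by simp [hj])⟩
    refine ⟨jwSign i A * c, mul_ne_zero (jwSign_ne_zero i A) hc, fun φ ↦ ?_⟩
    rw [List.map_cons, List.prod_cons, Module.End.mul_apply,
      gamma_inl_apply _ _ (hA i (by simp)), h, mul_assoc]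
    congr 3
    ext j
    simp only [Finset.mem_union, Finset.mem_insert, List.mem_toFinset, List.mem_cons]
    tauto

/-- The Fock vacuum. -/
noncomputable def vac (n : ℕ) : Spinor n := Pi.single ∅ 1

/-- The product `C` of all matrices `a†_i + a_i` turns the component at the full set into the
component at `∅`. Only the non-vanishing of the constant matters later. -/
lemma exists_pairing_vac (n : ℕ) :
    ∃ c : ℝ, c ≠ 0 ∧ ∀ φ, pairingBilin n (vac n) φ = c * φ Finset.univ := by
  obtain ⟨c, hc, h⟩ := exists_prod_gamma_inl_apply (List.nodup_finRange (2 * n)) ∅ (by simp)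
  refine ⟨c, hc, fun φ ↦ ?_⟩
  rw [pairingBilin_apply, spinorPairing, Finset.sum_eq_single ∅]
  · rw [chargeConj_eq, h]
    simp only [vac, Pi.single_eq_same, one_mul, Finset.empty_union]
    congr 2
    ext i
    simp
  · intro A _ hA
    simp [vac, hA]
  · simp

/-! ### The Fock representation -/

lemma annih_vac (i : Fin (2 * n)) : annih i (vac n) = 0 := by
  ext A
  rw [annih_apply]
  split_ifs
  · rfl
  · rw [vac, Pi.single_eq_of_ne (Finset.insert_ne_empty _ _), mul_zero]
    rfl

lemma gamma_vac (v : Vec n) :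
    gamma v (vac n) = ∑ i, (v (Sum.inl i) + v (Sum.inr i)) • create i (vac n) := by
  simp [gamma_apply, LinearMap.sum_apply, annih_vac]

lemma create_single {i : Fin (2 * n)} {B : Finset (Fin (2 * n))} (hi : i ∉ B) :
    create i (Pi.single B 1 : Spinor n) = jwSign i B • (Pi.single (insert i B) 1 : Spinor n) := by
  ext A
  rw [create_apply, Pi.smul_apply, smul_eq_mul]
  by_cases hA : A = insert i B
  · subst hA
    rw [if_pos (Finset.mem_insert_self i B), Finset.erase_insert hi, jwSign_insert hi,
      if_neg (lt_irrefl i)]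
    simp
  · rw [Pi.single_eq_of_ne hA, mul_zero]
    split_ifs with hiA
    · rw [Pi.single_eq_of_ne, mul_zero]
      rintro rfl
      exact hA (Finset.insert_erase hiA).symm
    · rfl

lemma gamma_vac_singleton (v : Vec n) (i : Fin (2 * n)) :
    gamma v (vac n) {i} = v (Sum.inl i) + v (Sum.inr i) := by
  rw [gamma_vac, Finset.sum_apply, Finset.sum_eq_single i]
  · rw [Pi.smul_apply, create_apply, if_pos (Finset.mem_singleton_self i)]
    simp [vac, jwSign, Finset.filter_singleton]
  · intro j _ hj
    rw [Pi.smul_apply, create_apply, if_neg (by simpa using hj), smul_zero]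
  · simp

lemma gamma_vac_eq_zero_iff (v : Vec n) :
    gamma v (vac n) = 0 ↔ ∀ i, v (Sum.inl i) + v (Sum.inr i) = 0 := by
  constructor
  · intro h i
    rw [← gamma_vac_singleton, h]
    rfl
  · intro h
    rw [gamma_vac]
    simp [h]

lemma exists_prod_create_vac {l : List (Fin (2 * n))} (hl : l.Nodup) :
    ∃ c : ℝ, c ≠ 0 ∧ (l.map create).prod (vac n) = c • (Pi.single l.toFinset 1 : Spinor n) := by
  induction l with
  | nil => exact ⟨1, one_ne_zero, by simp [vac]⟩
  | cons i l ih =>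
    rw [List.nodup_cons] at hl
    obtain ⟨c, hc, h⟩ := ih hl.2
    refine ⟨c * jwSign i l.toFinset, mul_ne_zero hc (jwSign_ne_zero _ _), ?_⟩
    rw [List.map_cons, List.prod_cons, Module.End.mul_apply, h, map_smul,
      create_single (by simpa using hl.1), smul_smul, List.toFinset_cons]

/-- A spinor annihilated by all the annihilation operators is a multiple of the vacuum. -/
lemma eq_smul_vac {φ : Spinor n} (h : ∀ i, annih i φ = 0) : φ = φ ∅ • vac n := by
  ext A
  by_cases hA : A = ∅
  · subst hA
    simp [vac]
  · obtain ⟨i, hi⟩ := Finset.nonempty_iff_ne_empty.2 hA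
    have := congrFun (h i) (A.erase i)
    rw [annih_apply, if_neg (Finset.notMem_erase i A), Finset.insert_erase hi] at this
    simpa [vac, hA, jwSign_ne_zero] using this

/-- The spin representation is irreducible. -/
theorem eq_top_of_gamma_invariant {W : Submodule ℝ (Spinor n)}
    (hW : ∀ v, ∀ φ ∈ W, gamma v φ ∈ W) {ψ : Spinor n} (hψ : ψ ∈ W) (h0 : ψ ≠ 0) : W = ⊤ := by
  -- Descent on a bound `d` for the degree of `ψ`: annihilating an `i` that occurs in a component of
  -- top degree lowers the bound and keeps the spinor non-zero, until a multiple of the vacuum is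
  -- left.
  have hvac : ∀ d : ℕ, ∀ ψ ∈ W, ψ ≠ 0 → (∀ A, d < A.card → ψ A = 0) → vac n ∈ W := by
    intro d
    induction d with
    | zero =>
      intro ψ hψ h0 hd
      have : ψ = ψ ∅ • vac n := by
        ext A
        by_cases hA : A = ∅
        · subst hA
          simp [vac]
        · rw [hd A (Finset.card_pos.2 (Finset.nonempty_iff_ne_empty.2 hA))]
          simp [vac, hA]
      have hne : ψ ∅ ≠ 0 := fun h ↦ h0 (by rw [this, h, zero_smul])
      have h2 : vac n = (ψ ∅)⁻¹ • ψ := by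
        conv_rhs => rw [this]
        simp [vac, hne]
      rw [h2]
      exact W.smul_mem _ hψ
    | succ d ih =>
      intro ψ hψ h0 hd
      by_cases hall : ∀ A, d < A.card → ψ A = 0
      · exact ih ψ hψ h0 hall
      push Not at hall
      obtain ⟨A, hA, hne⟩ := hall
      obtain ⟨i, hi⟩ := Finset.card_pos.1 (by omega : 0 < A.card)
      refine ih (annih i ψ) ?_ ?_ ?_
      · rw [← gamma_annVec]
        exact hW _ _ hψ
      · intro h
        have := congrFun h (A.erase i)
        rw [annih_apply, if_neg (Finset.notMem_erase i A), Finset.insert_erase hi] at this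
        exact mul_ne_zero (jwSign_ne_zero _ _) hne this
      · intro B hB
        rw [annih_apply]
        split_ifs with hiB
        · rfl
        · rw [hd, mul_zero]
          rw [Finset.card_insert_of_notMem hiB]
          omega
  have hv := hvac (2 * n) ψ hψ h0 fun A hA ↦ by
    have := Finset.card_le_univ A
    rw [Fintype.card_fin] at this
    omega
  -- Creation operators rebuild the whole Fock basis from the vacuum.
  have hsingle : ∀ A : Finset (Fin (2 * n)), (Pi.single A 1 : Spinor n) ∈ W := by
    intro A
    induction A using Finset.induction_on with
    | empty => exact hv
    | insert i A hi ih =>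
      have h1 : create i (Pi.single A 1 : Spinor n) ∈ W := by
        rw [← gamma_creVec]
        exact hW _ _ ih
      rw [create_single hi] at h1
      exact (W.smul_mem_iff (jwSign_ne_zero i A)).1 h1
  refine eq_top_iff.2 fun φ _ ↦ ?_
  rw [show φ = ∑ A, φ A • (Pi.single A 1 : Spinor n) by simpa using pi_eq_sum_univ' φ]
  exact W.sum_mem fun A _ ↦ W.smul_mem _ (hsingle A)

end Pairing

end NullKahler

namespace NullKahler

/-! ### Forms of pure spinors and lifts to the spin group -/

section SpinorForm

variable {n : ℕ}

/-- The functional `T ↦ ⟨ψ, T ψ⟩`. -/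
noncomputable def pairingEval (ψ : Spinor n) : Module.End ℝ (Spinor n) →ₗ[ℝ] ℝ :=
  pairingBilin n ψ ∘ₗ LinearMap.applyₗ ψ

/-- The `2n`-form of a spinor as an alternating map. -/
noncomputable def spinorAlt (ψ : Spinor n) : Vec n [⋀^Fin (2 * n)]→ₗ[ℝ] ℝ :=
  ((2 * n).factorial : ℝ)⁻¹ • MultilinearMap.alternatization ((pairingEval ψ).compMultilinearMap
    ((MultilinearMap.mkPiAlgebraFin ℝ (2 * n) (Module.End ℝ (Spinor n))).compLinearMap
      fun _ ↦ gamma))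

lemma gammaProd_ofFn {m : ℕ} (z : Fin m → Vec n) :
    gammaProd (List.ofFn z) = (List.ofFn fun k ↦ gamma (z k)).prod := by
  rw [gammaProd, List.map_ofFn]
  rfl

lemma spinorAlt_apply (ψ : Spinor n) (z : Fin (2 * n) → Vec n) :
    spinorAlt ψ z = ((2 * n).factorial : ℝ)⁻¹ * ∑ σ : Equiv.Perm (Fin (2 * n)),
      ((Equiv.Perm.sign σ : ℤ) : ℝ) *
        pairingBilin n ψ (gammaProd (List.ofFn (z ∘ σ)) ψ) := by
  simp only [spinorAlt, AlternatingMap.smul_apply, MultilinearMap.alternatization_apply,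
    smul_eq_mul]
  congr 1
  refine Finset.sum_congr rfl fun σ _ ↦ ?_
  rw [Units.smul_def, zsmul_eq_mul, gammaProd_ofFn]
  rfl

lemma spinorForm_eq (ψ : Spinor n) (z : Fin (2 * n) → Vec n) : spinorForm ψ z = spinorAlt ψ z := by
  rw [spinorAlt_apply]
  simp only [gammaProd_ofFn]
  rfl

lemma spinorAlt_smul (c : ℝ) (ψ : Spinor n) (z : Fin (2 * n) → Vec n) :
    spinorAlt (c • ψ) z = c ^ 2 * spinorAlt ψ z := by
  simp only [spinorAlt_apply, map_smul, LinearMap.smul_apply, smul_eq_mul, Finset.mul_sum]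
  exact Finset.sum_congr rfl fun σ _ ↦ by ring

lemma mul_gammaProd {S : Module.End ℝ (Spinor n)} {A : Vec n →ₗ[ℝ] Vec n} {ε : ℝ}
    (h : ∀ v, S * gamma v = ε • (gamma (A v) * S)) (l : List (Vec n)) :
    S * gammaProd l = ε ^ l.length • (gammaProd (l.map A) * S) := by
  induction l with
  | nil => simp [gammaProd_nil]
  | cons X l ih =>
    rw [List.map_cons, gammaProd_cons, gammaProd_cons, ← mul_assoc, h, smul_mul_assoc, mul_assoc,
      ih, mul_smul_comm, smul_smul, mul_assoc, List.length_cons, pow_succ']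

/-- The form has even degree `2n`, so the sign `ε` drops out and operators of either parity are
admitted; only the factor `δ` of the pairing remains. -/
lemma spinorAlt_covering {S : Module.End ℝ (Spinor n)} {A : Vec n →ₗ[ℝ] Vec n} {ε δ : ℝ}
    (h : ∀ v, S * gamma v = ε • (gamma (A v) * S)) (hε : ε ^ 2 = 1)
    (hδ : ∀ φ ψ, pairingBilin n (S φ) (S ψ) = δ * pairingBilin n φ ψ) (ψ : Spinor n)
    (z : Fin (2 * n) → Vec n) : spinorAlt (S ψ) (A ∘ z) = δ * spinorAlt ψ z := by
  simp only [spinorAlt_apply, Finset.mul_sum]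
  refine Finset.sum_congr rfl fun σ _ ↦ ?_
  have hm := mul_gammaProd h (List.ofFn (z ∘ σ))
  rw [List.length_ofFn, pow_mul, hε, one_pow, one_smul, List.map_ofFn] at hm
  rw [Function.comp_assoc, ← Module.End.mul_apply, ← hm, Module.End.mul_apply, hδ]
  ring

/-! ### The form of the vacuum -/

lemma gamma_degree {d : ℕ} {φ : Spinor n} (hφ : ∀ A, d < A.card → φ A = 0) (v : Vec n)
    (A : Finset (Fin (2 * n))) (hA : d + 1 < A.card) : gamma v φ A = 0 := by
  rw [gamma_apply, LinearMap.sum_apply, Finset.sum_apply]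
  refine Finset.sum_eq_zero fun i _ ↦ ?_
  simp only [LinearMap.add_apply, LinearMap.smul_apply, Pi.add_apply, Pi.smul_apply, create_apply,
    annih_apply]
  split_ifs with hi
  · rw [hφ]
    · simp
    · rw [Finset.card_erase_of_mem hi]
      omega
  · rw [hφ]
    · simp
    · rw [Finset.card_insert_of_notMem hi]
      omega

lemma gamma_degree_of_vac {d : ℕ} {φ : Spinor n} (hφ : ∀ A, d < A.card → φ A = 0) {v : Vec n}
    (hv : gamma v (vac n) = 0) (A : Finset (Fin (2 * n))) (hA : d < A.card) :
    gamma v φ A = 0 := by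
  rw [gamma_vac_eq_zero_iff] at hv
  rw [gamma_apply, LinearMap.sum_apply, Finset.sum_apply]
  refine Finset.sum_eq_zero fun i _ ↦ ?_
  simp only [LinearMap.smul_apply, Pi.smul_apply, hv, zero_smul, zero_add, annih_apply]
  split_ifs with hi
  · simp
  · rw [hφ]
    · simp
    · rw [Finset.card_insert_of_notMem hi]
      omega

lemma gammaProd_vac_degree (l : List (Vec n)) (A : Finset (Fin (2 * n))) (hA : l.length < A.card) :
    gammaProd l (vac n) A = 0 := by
  induction l generalizing A with
  | nil =>
    rw [gammaProd_nil, Module.End.one_apply, vac, Pi.single_eq_of_ne]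
    rintro rfl
    simp at hA
  | cons X l ih =>
    rw [gammaProd_cons, Module.End.mul_apply]
    exact gamma_degree ih X A (by simpa using hA)

/-- Each factor raises the degree by at most one, and a vector killing the vacuum is a combination
of annihilation operators, which do not raise it. Such a factor keeps the product from reaching the
degree `l.length`. -/
lemma gammaProd_vac_eq_zero {l : List (Vec n)} {v : Vec n} (hl : v ∈ l)
    (hv : gamma v (vac n) = 0) (A : Finset (Fin (2 * n))) (hA : l.length ≤ A.card) :
    gammaProd l (vac n) A = 0 := by
  induction l generalizing A with
  | nil => simp at hl
  | cons X l ih =>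
    rw [gammaProd_cons, Module.End.mul_apply]
    rcases List.mem_cons.1 hl with rfl | hl
    · exact gamma_degree_of_vac (gammaProd_vac_degree l) hv A (by simpa using hA)
    · rcases l with _ | ⟨Y, l⟩
      · simp at hl
      · refine gamma_degree (d := l.length) (fun B hB ↦ ih hl B (by simpa using hB)) X A ?_
        simp only [List.length_cons] at hA
        omega

lemma spinorAlt_vac_eq_zero {z : Fin (2 * n) → Vec n} (i : Fin (2 * n))
    (hi : gamma (z i) (vac n) = 0) : spinorAlt (vac n) z = 0 := by
  obtain ⟨c, -, hc⟩ := exists_pairing_vac n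
  rw [spinorAlt_apply, Finset.sum_eq_zero, mul_zero]
  intro σ _
  rw [hc, gammaProd_vac_eq_zero (v := z i) _ hi, mul_zero, mul_zero]
  · simp
  · rw [List.mem_ofFn]
    exact ⟨σ.symm i, by simp⟩

lemma stdBilin_creVec (i j : Fin (2 * n)) : stdBilin n (creVec i) (creVec j) = 0 := by
  have h : ∀ a, (Pi.single a (1 / 2) : Vec n) = (1 / 2 : ℝ) • (Pi.single a 1 : Vec n) := by
    intro a
    rw [← Pi.single_smul, smul_eq_mul, mul_one]
  simp only [creVec, h, map_add, map_smul, LinearMap.add_apply, LinearMap.smul_apply,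
    stdBilin_single]
  by_cases hij : i = j <;> simp [hij, eta]

/-- The vectors `creVec i` span an isotropic subspace, on which `γ` squares to zero. So `γ` factors
there through the exterior algebra, where permuting a wedge product gives the sign. -/
lemma gammaProd_creVec_perm (σ : Equiv.Perm (Fin (2 * n))) :
    gammaProd (List.ofFn (creVec ∘ σ)) =
      ((Equiv.Perm.sign σ : ℤ) : ℝ) • gammaProd (List.ofFn (creVec (n := n))) := by
  let f : (Fin (2 * n) → ℝ) →ₗ[ℝ] Module.End ℝ (Spinor n) :=
    gamma ∘ₗ Fintype.linearCombination ℝ creVec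
  have hf : ∀ x, f x * f x = 0 := fun x ↦ by
    have : f x * f x = stdInner (Fintype.linearCombination ℝ creVec x)
        (Fintype.linearCombination ℝ (creVec (n := n)) x) • 1 := gamma_mul_self _
    rw [this, ← stdBilin_apply, Fintype.linearCombination_apply]
    simp [map_sum, LinearMap.sum_apply, stdBilin_creVec]
  have hl : ∀ z : Fin (2 * n) → Fin (2 * n), gammaProd (List.ofFn (creVec ∘ z)) =
      ExteriorAlgebra.lift ℝ ⟨f, hf⟩
        (ExteriorAlgebra.ιMulti ℝ (2 * n) fun k ↦ Pi.single (z k) (1 : ℝ)) := by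
    intro z
    rw [ExteriorAlgebra.ιMulti_apply, map_list_prod, List.map_ofFn, gammaProd_ofFn]
    congr 2
    funext k
    simp [f, Fintype.linearCombination_apply_single]
  have h1 := hl id
  rw [Function.comp_id] at h1
  rw [hl, h1]
  have := (ExteriorAlgebra.ιMulti ℝ (2 * n)).map_perm
    (fun k : Fin (2 * n) ↦ (Pi.single k (1 : ℝ) : Fin (2 * n) → ℝ)) σ
  change ExteriorAlgebra.ιMulti ℝ (2 * n) 
    (fun k ↦ (Pi.single (σ k) (1 : ℝ) : Fin (2 * n) → ℝ)) = _ at this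
  rw [this, Units.smul_def, map_zsmul, ← Int.cast_smul_eq_zsmul ℝ]
  rfl

/-- All `(2n)!` terms of the antisymmetrisation agree, since the sign of each permutation occurs
twice. This value is the normalisation later imposed on `Ω^{∧n}`. -/
lemma spinorAlt_vac_creVec_ne_zero (n : ℕ) : spinorAlt (vac n) creVec ≠ 0 := by
  obtain ⟨c, hc, hpair⟩ := exists_pairing_vac n
  obtain ⟨c', hc', hprod⟩ := exists_prod_create_vac (List.nodup_finRange (2 * n))
  have h1 : gammaProd (List.ofFn (creVec (n := n))) (vac n) Finset.univ = c' := by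
    have : gammaProd (List.ofFn (creVec (n := n))) = ((List.finRange (2 * n)).map create).prod := by
      rw [gammaProd_ofFn, List.ofFn_eq_map]
      simp only [gamma_creVec]
    rw [this, hprod, show (List.finRange (2 * n)).toFinset = Finset.univ by ext i; simp]
    simp
  rw [spinorAlt_apply]
  have h2 : ∀ σ : Equiv.Perm (Fin (2 * n)), ((Equiv.Perm.sign σ : ℤ) : ℝ) *
      pairingBilin n (vac n) (gammaProd (List.ofFn (creVec ∘ σ)) (vac n)) = c * c' := by
    intro σ
    rw [gammaProd_creVec_perm, LinearMap.smul_apply, map_smul, hpair, h1, smul_eq_mul, ← mul_assoc,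
      ← Int.cast_mul, ← Units.val_mul, Int.units_mul_self]
    simp
  simp only [h2, Finset.sum_const, Finset.card_univ, Fintype.card_perm, Fintype.card_fin,
    nsmul_eq_mul]
  have : ((2 * n).factorial : ℝ) ≠ 0 := by positivity
  field_simp
  exact mul_ne_zero hc hc'

lemma exists_sum_creVec (v : Vec n) : ∃ w : Vec n, gamma w (vac n) = 0 ∧
    v = w + ∑ i, (v (Sum.inl i) + v (Sum.inr i)) • creVec i := by
  refine ⟨v - ∑ i, (v (Sum.inl i) + v (Sum.inr i)) • creVec i, ?_, by abel⟩
  rw [map_sub, LinearMap.sub_apply, gamma_vac, map_sum, LinearMap.sum_apply]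
  simp [gamma_creVec]

/-- The kernel of the form of the vacuum is the annihilator of the vacuum. -/
lemma gamma_vac_eq_zero_iff_form (v : Vec n) : gamma v (vac n) = 0 ↔
    ∀ (z : Fin (2 * n) → Vec n) (i : Fin (2 * n)), z i = v → spinorAlt (vac n) z = 0 := by
  constructor
  · rintro hv z i rfl
    exact spinorAlt_vac_eq_zero i hv
  · intro h
    rw [gamma_vac_eq_zero_iff]
    intro j
    obtain ⟨w, hw, hvw⟩ := exists_sum_creVec v
    -- With `v` in place `j` of the family `creVec`, only the component of `v` along `creVec j`
    -- survives.
    have h1 := h (Function.update creVec j v) j (by simp)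
    rw [hvw, AlternatingMap.map_update_add, spinorAlt_vac_eq_zero j (by simpa using hw), zero_add,
      AlternatingMap.map_update_sum, Finset.sum_eq_single j] at h1
    · rw [AlternatingMap.map_update_smul, Function.update_eq_self, smul_eq_mul] at h1
      exact (mul_eq_zero.1 h1).resolve_right (spinorAlt_vac_creVec_ne_zero n)
    · intro l _ hl
      rw [AlternatingMap.map_update_smul, AlternatingMap.map_update_self _ _ hl.symm, smul_zero]
    · simp

/-! ### Hyperbolic frames -/

section Hyperbolic

variable {V : Type*} [AddCommGroup V] [Module ℝ V] (b : LinearMap.BilinForm ℝ V)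
  (w c : Fin (2 * n) → V)

/-- The correction of `c` to an isotropic family. -/
noncomputable def hypVec (j : Fin (2 * n)) : V := c j - ∑ k, b (c j) (c k) • w k

/-- The pseudo-orthonormal frame built from a basis `w` of an isotropic subspace and a dual
family `c`. -/
noncomputable def hypFrame : Idx n → V :=
  Sum.elim (fun i ↦ hypVec b w c i + w i) fun i ↦ hypVec b w c i - w i

variable {b w c}

lemma bilin_hypVec_right (hw : ∀ i j, b (w i) (w j) = 0)
    (hwc : ∀ i j, b (w i) (c j) = if i = j then 1 / 2 else 0) (i j : Fin (2 * n)) :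
    b (w i) (hypVec b w c j) = if i = j then 1 / 2 else 0 := by
  simp [hypVec, hw, hwc]

/-- The two cross terms each contribute `-b(c_i, c_j) / 2`, because `w` and `c` are dual up to the
factor `1 / 2`. That factor also makes the squares of `hypVec ± w` equal to `±1`. -/
lemma bilin_hypVec_hypVec (hb : ∀ x y, b x y = b y x) (hw : ∀ i j, b (w i) (w j) = 0)
    (hwc : ∀ i j, b (w i) (c j) = if i = j then 1 / 2 else 0) (i j : Fin (2 * n)) :
    b (hypVec b w c i) (hypVec b w c j) = 0 := by
  have hcw : ∀ i j, b (c i) (w j) = if i = j then 1 / 2 else 0 := fun i j ↦ by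
    rw [hb, hwc]
    simp [eq_comm]
  simp only [hypVec, map_sub, map_sum, map_smul, LinearMap.sub_apply, LinearMap.sum_apply,
    LinearMap.smul_apply, hw, hwc, hcw, smul_eq_mul, mul_zero, Finset.sum_const_zero, sub_zero]
  simp only [mul_ite, mul_zero, Finset.sum_ite_eq, Finset.sum_ite_eq', Finset.mem_univ, if_true]
  rw [hb (c j) (c i)]
  ring

lemma bilin_hypFrame (hb : ∀ x y, b x y = b y x) (hw : ∀ i j, b (w i) (w j) = 0)
    (hwc : ∀ i j, b (w i) (c j) = if i = j then 1 / 2 else 0) (a d : Idx n) :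
    b (hypFrame b w c a) (hypFrame b w c d) = if a = d then eta a else 0 := by
  have h1 := bilin_hypVec_right hw hwc
  have h2 := bilin_hypVec_hypVec hb hw hwc
  have h3 : ∀ i j, b (hypVec b w c i) (w j) = if i = j then 1 / 2 else 0 := fun i j ↦ by
    rw [hb, h1]
    simp [eq_comm]
  rcases a with i | i <;> rcases d with j | j <;>
    simp only [hypFrame, Sum.elim_inl, Sum.elim_inr, map_add, map_sub, LinearMap.add_apply,
      LinearMap.sub_apply, h1, h2, h3, hw, Sum.inl.injEq, Sum.inr.injEq, eta, reduceCtorEq,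
      if_false] <;> by_cases hij : i = j <;> simp [hij]
  all_goals norm_num

end Hyperbolic

/-! ### Pure spinors -/

lemma mem_annihilator {ψ : Spinor n} {v : Vec n} : v ∈ annihilator ψ ↔ gamma v ψ = 0 := Iff.rfl

/-- Every pure spinor is obtained from the vacuum by a product of gamma matrices of unit vectors. -/
theorem exists_eq_gammaProd_vac (hn : 0 < n) {ψ : Spinor n}
    (hψ : Module.finrank ℝ (annihilator ψ) = 2 * n) :
    ∃ (A : Vec n →ₗ[ℝ] Vec n) (L : List (Vec n)) (c : ℝ), IsIsometry A ∧ (∀ X ∈ L, IsUnitVec X) ∧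
      (∀ v, gammaProd L * gamma v = (-1 : ℝ) ^ L.length • (gamma (A v) * gammaProd L)) ∧ c ≠ 0 ∧
      ψ = c • gammaProd L (vac n) := by
  have h0 : ψ ≠ 0 := by
    rintro rfl
    have : annihilator (0 : Spinor n) = ⊤ := eq_top_iff.2 fun v _ ↦ by
      rw [mem_annihilator, map_zero]
    rw [this, finrank_top, Module.finrank_fintype_fun_eq_card] at hψ
    simp at hψ
    omega
  -- The Clifford relation applied to `ψ ≠ 0` shows that the annihilator is isotropic.
  have hiso : ∀ v w, v ∈ annihilator ψ → w ∈ annihilator ψ → stdBilin n v w = 0 := by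
    intro v w hv hw
    rw [mem_annihilator] at hv hw
    have := congrArg (fun T ↦ T ψ) (gamma_clifford v w)
    simp only [LinearMap.add_apply, Module.End.mul_apply, hv, hw, map_zero, add_zero,
      LinearMap.smul_apply, Module.End.one_apply] at this
    have := (smul_eq_zero.1 this.symm).resolve_right h0
    rw [stdBilin_apply]
    linarith
  let w := Module.finBasisOfFinrankEq ℝ (annihilator ψ) hψ
  -- A dual family: the coordinate functional is extended to the whole space and represented through
  -- the inner product.
  have hc : ∀ j, ∃ c : Vec n, ∀ i, stdBilin n (w i) c = if i = j then 1 / 2 else 0 := by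
    intro j
    obtain ⟨f, hf⟩ := LinearMap.exists_extend (w.coord j)
    refine ⟨fun a ↦ eta a * (1 / 2 * f (Pi.single a 1)), fun i ↦ ?_⟩
    have h1 : f (w i) = if i = j then 1 else 0 := by
      have := congrArg (fun T ↦ T (w i)) hf
      simp only [LinearMap.comp_apply, Submodule.subtype_apply, Module.Basis.coord_apply,
        Module.Basis.repr_self, Finsupp.single_apply] at this
      exact this
    have h2 : f (w i) = ∑ a, (w i : Vec n) a * f (Pi.single a 1) := by
      conv_lhs => rw [show (w i : Vec n) = ∑ a, (w i : Vec n) a • (Pi.single a 1 : Vec n) by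
        simpa using pi_eq_sum_univ' (w i : Vec n)]
      simp
    rw [stdBilin_apply, stdInner]
    have h3 : ∑ a, eta a * (w i : Vec n) a * (eta a * (1 / 2 * f (Pi.single a 1))) =
        1 / 2 * f (w i) := by
      rw [h2, Finset.mul_sum]
      refine Finset.sum_congr rfl fun a _ ↦ ?_
      linear_combination (w i : Vec n) a * (1 / 2 * f (Pi.single a 1)) * eta_mul_self a
    rw [h3, h1]
    split_ifs <;> norm_num
  choose c hc using hc
  have hframe := bilin_hypFrame (b := stdBilin n) (w := fun i ↦ (w i : Vec n)) (c := c)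
    stdBilin_symm (fun i j ↦ hiso _ _ (w i).2 (w j).2) fun i j ↦ hc j i
  set e := hypFrame (stdBilin n) (fun i ↦ (w i : Vec n)) c with he
  let A : Vec n →ₗ[ℝ] Vec n := Fintype.linearCombination ℝ e
  have hA : IsIsometry A := by
    intro x y
    simp only [A, Fintype.linearCombination_apply, map_sum, map_smul, LinearMap.sum_apply,
      LinearMap.smul_apply, hframe, smul_eq_mul, stdBilin_apply, stdInner]
    refine Finset.sum_congr rfl fun a _ ↦ ?_
    simp only [mul_ite, mul_zero, Finset.sum_ite_eq', Finset.mem_univ, if_true]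
    ring
  obtain ⟨L, hL, hcov⟩ := exists_gammaProd_covering hA
  obtain ⟨S, hS⟩ := isUnit_gammaProd hL
  have hAw : ∀ i, A (annVec i) = (w i : Vec n) := by
    intro i
    have hs : ∀ a t, A (Pi.single a t) = t • e a := fun a t ↦ by
      simp only [A]
      rw [Fintype.linearCombination_apply_single]
    rw [annVec, map_sub, hs, hs, he]
    simp only [hypFrame, Sum.elim_inl, Sum.elim_inr]
    module
  -- The isometry takes `annVec i` to `w i`, so pulling `ψ` back by the covering operator gives a
  -- spinor killed by every annihilation operator, that is, a multiple of the vacuum.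
  have hann : ∀ i, annih i ((S⁻¹ : (Module.End ℝ (Spinor n))ˣ).val ψ) = 0 := by
    intro i
    have h1 := hcov (annVec i)
    rw [hAw, ← hS, gamma_annVec] at h1
    have hinj : Function.Injective (S : Module.End ℝ (Spinor n)) := fun x y hxy ↦ by
      have := congrArg (S⁻¹ : (Module.End ℝ (Spinor n))ˣ).val hxy
      simpa [← Module.End.mul_apply] using this
    apply hinj
    rw [map_zero, ← Module.End.mul_apply, h1, LinearMap.smul_apply, Module.End.mul_apply,
      ← Module.End.mul_apply S.val, S.mul_inv, Module.End.one_apply,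
      mem_annihilator.1 (w i).2, smul_zero]
  have hφ := eq_smul_vac hann
  have hψ' : ψ = ((S⁻¹ : (Module.End ℝ (Spinor n))ˣ).val ψ ∅) • gammaProd L (vac n) := by
    have := congrArg S.val hφ
    rw [← Module.End.mul_apply, S.mul_inv, Module.End.one_apply, map_smul] at this
    rw [← hS]
    exact this
  refine ⟨A, L, _, hA, hL, hcov, ?_, hψ'⟩
  intro hzero
  rw [hzero, zero_smul] at hψ'
  exact h0 hψ'

lemma covering_gamma_eq_zero_iff {A : Vec n →ₗ[ℝ] Vec n} {L : List (Vec n)}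
    (hL : ∀ X ∈ L, IsUnitVec X)
    (hcov : ∀ v, gammaProd L * gamma v = (-1 : ℝ) ^ L.length • (gamma (A v) * gammaProd L))
    (v : Vec n) (φ : Spinor n) : gamma (A v) (gammaProd L φ) = 0 ↔ gamma v φ = 0 := by
  have h := congrArg (fun T ↦ T φ) (hcov v)
  simp only [Module.End.mul_apply, LinearMap.smul_apply] at h
  obtain ⟨S, hS⟩ := isUnit_gammaProd hL
  constructor
  · intro h1
    rw [h1, smul_zero, ← hS] at h
    have := congrArg (S⁻¹ : (Module.End ℝ (Spinor n))ˣ).val h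
    simpa [← Module.End.mul_apply] using this
  · intro h1
    rw [h1, map_zero] at h
    exact (smul_eq_zero.1 h.symm).resolve_left (by simp)

lemma neg_one_pow_sq (k : ℕ) : ((-1 : ℝ) ^ k) ^ 2 = 1 := by
  rw [← pow_mul, mul_comm, pow_mul]
  simp

/-- The kernel of the form of a pure spinor is its annihilator. -/
theorem gamma_eq_zero_iff_form (hn : 0 < n) {ψ : Spinor n}
    (hψ : Module.finrank ℝ (annihilator ψ) = 2 * n) (v : Vec n) : gamma v ψ = 0 ↔
      ∀ (z : Fin (2 * n) → Vec n) (i : Fin (2 * n)), z i = v → spinorAlt ψ z = 0 := by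
  obtain ⟨A, L, c, hA, hL, hcov, hc, hψc⟩ := exists_eq_gammaProd_vac hn hψ
  obtain ⟨δ, hδ, hpair⟩ := pairingBilin_gammaProd hL
  have hform : ∀ z, spinorAlt ψ (A ∘ z) = c ^ 2 * δ * spinorAlt (vac n) z := fun z ↦ by
    rw [hψc, spinorAlt_smul, spinorAlt_covering hcov (neg_one_pow_sq _) hpair, mul_assoc]
  have hne : c ^ 2 * δ ≠ 0 := mul_ne_zero (pow_ne_zero _ hc) (by rcases hδ with rfl | rfl <;> simp)
  obtain ⟨v, rfl⟩ := hA.surjective v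
  have h1 : gamma (A v) ψ = 0 ↔ gamma v (vac n) = 0 := by
    rw [hψc, map_smul, smul_eq_zero_iff_right hc, covering_gamma_eq_zero_iff hL hcov]
  rw [h1, gamma_vac_eq_zero_iff_form]
  constructor
  · intro h z i hz
    obtain ⟨z', rfl⟩ := hA.surjective.comp_left z
    rw [hform, h z' i (hA.injective hz), mul_zero]
  · intro h z i hz
    have := h (A ∘ z) i (by simp [hz])
    rw [hform] at this
    exact (mul_eq_zero.1 this).resolve_left hne

/-- The form of a pure spinor does not vanish. -/
lemma exists_spinorAlt_ne_zero (hn : 0 < n) {ψ : Spinor n}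
    (hψ : Module.finrank ℝ (annihilator ψ) = 2 * n) : ∃ z, spinorAlt ψ z ≠ 0 := by
  by_contra! h
  have : annihilator ψ = ⊤ := eq_top_iff.2 fun v _ ↦
    mem_annihilator.2 ((gamma_eq_zero_iff_form hn hψ v).2 fun z _ _ ↦ h z)
  rw [this, finrank_top, Module.finrank_fintype_fun_eq_card] at hψ
  simp at hψ
  omega

/-- A spinor annihilated by the annihilator of a pure spinor is a multiple of it. -/
lemma eq_smul_of_annihilator_le (hn : 0 < n) {ψ φ : Spinor n}
    (hψ : Module.finrank ℝ (annihilator ψ) = 2 * n) (h : ∀ v, gamma v ψ = 0 → gamma v φ = 0) :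
    ∃ t : ℝ, φ = t • ψ := by
  obtain ⟨A, L, c, hA, hL, hcov, hc, hψc⟩ := exists_eq_gammaProd_vac hn hψ
  obtain ⟨S, hS⟩ := isUnit_gammaProd hL
  have hφ : φ = gammaProd L ((S⁻¹ : (Module.End ℝ (Spinor n))ˣ).val φ) := by
    rw [← hS, ← Module.End.mul_apply, S.mul_inv, Module.End.one_apply]
  have hann : ∀ i, annih i ((S⁻¹ : (Module.End ℝ (Spinor n))ˣ).val φ) = 0 := by
    intro i
    rw [← gamma_annVec, ← covering_gamma_eq_zero_iff hL hcov, ← hφ]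
    apply h
    rw [hψc, map_smul, (covering_gamma_eq_zero_iff hL hcov _ _).2, smul_zero]
    rw [gamma_annVec, annih_vac]
  refine ⟨(S⁻¹ : (Module.End ℝ (Spinor n))ˣ).val φ ∅ * c⁻¹, ?_⟩
  rw [hψc, smul_smul, mul_assoc, inv_mul_cancel₀ hc, mul_one, ← map_smul, ← eq_smul_vac hann, ← hφ]

/-! ### Lifts to the spin group -/

lemma gamma_parity {v : Vec n} {φ : Spinor n} {k : ℕ}
    (h : ∀ A : Finset (Fin (2 * n)), Odd (A.card + k) → φ A = 0) (A : Finset (Fin (2 * n)))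
    (hA : Odd (A.card + (k + 1))) : gamma v φ A = 0 := by
  rw [gamma_apply, LinearMap.sum_apply, Finset.sum_apply]
  refine Finset.sum_eq_zero fun i _ ↦ ?_
  simp only [LinearMap.add_apply, LinearMap.smul_apply, Pi.add_apply, Pi.smul_apply, create_apply,
    annih_apply]
  split_ifs with hi
  · rw [h]
    · simp
    · have := Finset.card_pos.2 ⟨i, hi⟩
      rw [Finset.card_erase_of_mem hi]
      rw [Nat.odd_iff] at hA ⊢
      omega
  · rw [h]
    · simp
    · rw [Finset.card_insert_of_notMem hi]
      rw [Nat.odd_iff] at hA ⊢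
      omega

lemma gammaProd_parity {φ : Spinor n} (h : IsPosSemiSpinor φ) (L : List (Vec n))
    (A : Finset (Fin (2 * n))) (hA : Odd (A.card + L.length)) : gammaProd L φ A = 0 := by
  induction L generalizing A with
  | nil => exact h A (by simpa using hA)
  | cons X L ih =>
    rw [gammaProd_cons, Module.End.mul_apply]
    exact gamma_parity ih A (by simpa using hA)

lemma exists_mem_spin {L : List (Vec n)} (hL : ∀ X ∈ L, IsUnitVec X) (he : Even L.length) :
    ∃ s ∈ spin n, (s : Module.End ℝ (Spinor n)) = gammaProd L := by
  obtain ⟨k, hk⟩ := he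
  induction k generalizing L with
  | zero =>
    have : L = [] := List.eq_nil_of_length_eq_zero (by omega)
    subst this
    exact ⟨1, one_mem _, rfl⟩
  | succ k ih =>
    match L, hk, hL with
    | [], hk, _ => simp at hk
    | [_], hk, _ => simp at hk; omega
    | X :: Y :: L, hk, hL =>
      obtain ⟨s, hs, hsL⟩ := ih (L := L) (fun Z hZ ↦ hL Z (by simp [hZ]))
        (by simp only [List.length_cons] at hk; omega)
      obtain ⟨t, ht⟩ := (hL X (by simp)).isUnit_gamma.mul (hL Y (by simp)).isUnit_gamma
      refine ⟨t * s, mul_mem (Subgroup.subset_closure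
        ⟨X, Y, hL X (by simp), hL Y (by simp), ht⟩) hs, ?_⟩
      rw [Units.val_mul, ht, hsL, gammaProd_cons, gammaProd_cons, mul_assoc]

/-- For a basis vector `X` of square `-1`, the generator `γ(X)γ(X)` is `-1`. -/
lemma exists_mem_spin_neg_one (hn : 0 < n) :
    ∃ s ∈ spin n, (s : Module.End ℝ (Spinor n)) = (-1 : ℝ) • 1 := by
  have hsq : stdInner (Pi.single (Sum.inr ⟨0, by omega⟩) 1 : Vec n)
      (Pi.single (Sum.inr ⟨0, by omega⟩) 1) = -1 := by
    rw [← stdBilin_apply, stdBilin_single, if_pos rfl]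
    rfl
  have hX : IsUnitVec (Pi.single (Sum.inr ⟨0, by omega⟩) 1 : Vec n) := Or.inr hsq
  obtain ⟨t, ht⟩ := hX.isUnit_gamma.mul hX.isUnit_gamma
  refine ⟨t, Subgroup.subset_closure ⟨_, _, hX, hX, ht⟩, ?_⟩
  rw [ht, gamma_mul_self, hsq]

/-- A change of frame that matches the forms of two positive pure spinors lifts to an element of
the spin group that carries one spinor to the other. -/
theorem exists_spin_lift (hn : 0 < n) {A : Vec n →ₗ[ℝ] Vec n} (hA : IsIsometry A)
    {ψ ψ' : Spinor n} (hψ : IsPosSemiSpinor ψ) (hψ' : IsPosSemiSpinor ψ')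
    (hr : Module.finrank ℝ (annihilator ψ) = 2 * n)
    (hr' : Module.finrank ℝ (annihilator ψ') = 2 * n)
    (hform : ∀ z, spinorAlt ψ' (A ∘ z) = spinorAlt ψ z) :
    ∃ s ∈ spin n, (s : Module.End ℝ (Spinor n)) ψ = ψ' ∧
      ∀ v, (s : Module.End ℝ (Spinor n)) * gamma v = gamma (A v) * s := by
  obtain ⟨L, hL, hcov⟩ := exists_gammaProd_covering hA
  obtain ⟨δ, hδ, hpair⟩ := pairingBilin_gammaProd hL
  -- Matching forms have matching kernels, which are the annihilators; so `gammaProd L ψ` is a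
  -- multiple `t` of `ψ'`.
  have hann : ∀ v, gamma v ψ' = 0 → gamma v (gammaProd L ψ) = 0 := by
    intro v
    obtain ⟨v, rfl⟩ := hA.surjective v
    rw [covering_gamma_eq_zero_iff hL hcov, gamma_eq_zero_iff_form hn hr,
      gamma_eq_zero_iff_form hn hr']
    intro h z i hz
    rw [← hform]
    exact h _ i (by simp [hz])
  obtain ⟨t, ht⟩ := eq_smul_of_annihilator_le hn hr' hann
  obtain ⟨z, hz⟩ := exists_spinorAlt_ne_zero hn hr
  -- The form is quadratic in the spinor. As `δ = ±1` and `t` is real, this excludes `δ = -1` and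
  -- leaves `t = ±1`.
  have ht2 : t ^ 2 = δ := by
    have h1 := spinorAlt_covering hcov (neg_one_pow_sq _) hpair ψ z
    rw [ht, spinorAlt_smul, hform] at h1
    exact mul_right_cancel₀ hz h1
  have ht1 : t = 1 ∨ t = -1 := by
    rcases hδ with rfl | rfl
    · exact sq_eq_one_iff.1 ht2
    · nlinarith [sq_nonneg t]
  have ht0 : t ≠ 0 := by rcases ht1 with rfl | rfl <;> norm_num
  -- An odd product reverses chirality, so `ψ'` would be both even and odd, hence zero.
  have heven : Even L.length := by
    by_contra hodd
    rw [Nat.not_even_iff_odd] at hodd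
    have hzero : ψ' = 0 := by
      ext B
      by_cases hB : Odd B.card
      · exact hψ' B hB
      · have h1 := gammaProd_parity hψ L B (by
          rw [Nat.not_odd_iff_even] at hB
          exact hB.add_odd hodd)
        rw [ht, Pi.smul_apply, smul_eq_mul] at h1
        exact (mul_eq_zero.1 h1).resolve_left ht0
    obtain ⟨z', hz'⟩ := exists_spinorAlt_ne_zero hn hr'
    apply hz'
    rw [hzero, ← zero_smul ℝ (0 : Spinor n), spinorAlt_smul]
    simp
  obtain ⟨s, hs, hsL⟩ := exists_mem_spin hL heven
  rw [heven.neg_one_pow] at hcov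
  simp only [one_smul] at hcov
  rcases ht1 with rfl | rfl
  · exact ⟨s, hs, by rw [hsL, ht, one_smul], fun v ↦ by rw [hsL, hcov]⟩
  -- The remaining sign is absorbed by `-1` in the spin group, which covers the identity.
  · obtain ⟨m, hm, hm1⟩ := exists_mem_spin_neg_one hn
    have hms : ((m * s : (Module.End ℝ (Spinor n))ˣ) : Module.End ℝ (Spinor n)) =
        (-1 : ℝ) • gammaProd L := by
      rw [Units.val_mul, hm1, hsL, smul_mul_assoc, one_mul]
    refine ⟨m * s, mul_mem hm hs, ?_, fun v ↦ ?_⟩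
    · rw [hms, LinearMap.smul_apply, ht, smul_smul]
      norm_num
    · rw [hms, smul_mul_assoc, hcov, mul_smul_comm]

/-- An operator that covers a change of frame is determined by its value on a non-zero spinor. -/
theorem covering_unique {B : Vec n → Vec n} {S S' : Module.End ℝ (Spinor n)}
    (hS : ∀ v, S * gamma v = gamma (B v) * S) (hS' : ∀ v, S' * gamma v = gamma (B v) * S')
    {ψ : Spinor n} (h0 : ψ ≠ 0) (h : S ψ = S' ψ) : S = S' := by
  -- The difference intertwines the same gamma matrices, so its kernel is an invariant subspace
  -- containing `ψ ≠ 0`; irreducibility makes it everything.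
  have hker : LinearMap.ker (S - S') = ⊤ := by
    refine eq_top_of_gamma_invariant (ψ := ψ) ?_ ?_ h0
    · intro v φ hφ
      rw [LinearMap.mem_ker] at hφ ⊢
      have h1 : (S - S') * gamma v = gamma (B v) * (S - S') := by
        rw [sub_mul, mul_sub, hS, hS']
      rw [← Module.End.mul_apply, h1, Module.End.mul_apply, hφ, map_zero]
    · rw [LinearMap.mem_ker, LinearMap.sub_apply, h, sub_self]
  exact sub_eq_zero.1 (LinearMap.ker_eq_top.1 hker)

lemma isPosSemiSpinor_vac (n : ℕ) : IsPosSemiSpinor (vac n) := fun A hA ↦ by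
  rw [vac, Pi.single_eq_of_ne]
  rintro rfl
  simp at hA

lemma finrank_annihilator_vac (n : ℕ) : Module.finrank ℝ (annihilator (vac n)) = 2 * n := by
  let f : Vec n →ₗ[ℝ] (Fin (2 * n) → ℝ) :=
    LinearMap.pi fun i ↦
      (LinearMap.proj (Sum.inl i) : Vec n →ₗ[ℝ] ℝ) + LinearMap.proj (Sum.inr i)
  have hker : annihilator (vac n) = LinearMap.ker f := by
    ext v
    rw [mem_annihilator, gamma_vac_eq_zero_iff, LinearMap.mem_ker, funext_iff]
    rfl
  have hf : LinearMap.range f = ⊤ := LinearMap.range_eq_top.2 fun x ↦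
    ⟨Sum.elim x 0, by ext i; simp [f]⟩
  have := LinearMap.finrank_range_add_finrank_ker f
  rw [hf, finrank_top, Module.finrank_fintype_fun_eq_card,
    Module.finrank_fintype_fun_eq_card] at this
  simp only [Fintype.card_fin, Fintype.card_sum] at this
  rw [hker]
  omega

end SpinorForm

end NullKahler

namespace NullKahler

/-! ### Smooth dependence of covering operators on the point -/

section Smooth

variable {n : ℕ} {M : Type u} [TopologicalSpace M] [ChartedSpace (Model n) M]

lemma contMDiffWithinAt_det {ι : Type*} [Fintype ι] [DecidableEq ι] {F : M → Matrix ι ι ℝ}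
    {D : Set M} {x : M}
    (hF : ∀ i j, ContMDiffWithinAt (𝓡 (4 * n)) 𝓘(ℝ, ℝ) ∞ (fun y ↦ F y i j) D x) :
    ContMDiffWithinAt (𝓡 (4 * n)) 𝓘(ℝ, ℝ) ∞ (fun y ↦ (F y).det) D x := by
  simp only [Matrix.det_apply']
  refine ContMDiffWithinAt.sum fun σ _ ↦ ?_
  exact contMDiffWithinAt_const.mul (contMDiffWithinAt_finsetProd fun i _ ↦ hF _ _)

lemma contMDiffWithinAt_inv_apply {ι : Type*} [Fintype ι] [DecidableEq ι] {F : M → Matrix ι ι ℝ}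
    {D : Set M} {x : M}
    (hF : ∀ i j, ContMDiffWithinAt (𝓡 (4 * n)) 𝓘(ℝ, ℝ) ∞ (fun y ↦ F y i j) D x)
    (hx : (F x).det ≠ 0) (i j : ι) :
    ContMDiffWithinAt (𝓡 (4 * n)) 𝓘(ℝ, ℝ) ∞ (fun y ↦ (F y)⁻¹ i j) D x := by
  simp only [Matrix.inv_def, Matrix.smul_apply, smul_eq_mul, Ring.inverse_eq_inv',
    Matrix.adjugate_apply]
  refine ContMDiffWithinAt.mul ((contMDiffWithinAt_det hF).inv₀ hx) (contMDiffWithinAt_det ?_)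
  intro k l
  simp only [Matrix.updateRow_apply]
  split_ifs
  · exact contMDiffWithinAt_const
  · exact hF k l

lemma contMDiffWithinAt_end_apply {T : M → Module.End ℝ (Spinor n)} {χ : M → Spinor n}
    {D : Set M} {x : M}
    (hT : ∀ φ, ContMDiffWithinAt (𝓡 (4 * n)) 𝓘(ℝ, Spinor n) ∞ (fun y ↦ T y φ) D x)
    (hχ : ContMDiffWithinAt (𝓡 (4 * n)) 𝓘(ℝ, Spinor n) ∞ χ D x) :
    ContMDiffWithinAt (𝓡 (4 * n)) 𝓘(ℝ, Spinor n) ∞ (fun y ↦ T y (χ y)) D x := by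
  have h : (fun y ↦ T y (χ y)) = fun y ↦ ∑ B, χ y B • T y (Pi.single B 1 : Spinor n) := by
    funext y
    conv_lhs => rw [show χ y = ∑ B, χ y B • (Pi.single B 1 : Spinor n) by
      simpa using pi_eq_sum_univ' (χ y)]
    simp
  rw [h]
  exact ContMDiffWithinAt.sum fun B _ ↦ (contMDiffWithinAt_pi_space.1 hχ B).smul (hT _)

lemma contMDiffWithinAt_gamma {a : M → Vec n} {D : Set M} {x : M}
    (ha : ContMDiffWithinAt (𝓡 (4 * n)) 𝓘(ℝ, Vec n) ∞ a D x) (φ : Spinor n) :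
    ContMDiffWithinAt (𝓡 (4 * n)) 𝓘(ℝ, Spinor n) ∞ (fun y ↦ gamma (a y) φ) D x :=
  (LinearMap.toContinuousLinearMap (gamma.flip φ)).contMDiff.contMDiffAt.comp_contMDiffWithinAt x ha

lemma contMDiffWithinAt_linearMap (T : Module.End ℝ (Spinor n)) {χ : M → Spinor n}
    {D : Set M} {x : M} (hχ : ContMDiffWithinAt (𝓡 (4 * n)) 𝓘(ℝ, Spinor n) ∞ χ D x) :
    ContMDiffWithinAt (𝓡 (4 * n)) 𝓘(ℝ, Spinor n) ∞ (fun y ↦ T (χ y)) D x :=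
  (LinearMap.toContinuousLinearMap T).contMDiff.contMDiffAt.comp_contMDiffWithinAt x hχ

/-- Operators that cover a smooth change of frame and carry a smooth non-vanishing spinor to a
smooth spinor depend smoothly on the point. -/
theorem contMDiffOn_covering {D : Set M} {A : M → Vec n → Vec n} {ψ ψ' : M → Spinor n}
    {S : M → Module.End ℝ (Spinor n)}
    (hA : ∀ v, ContMDiffOn (𝓡 (4 * n)) 𝓘(ℝ, Vec n) ∞ (fun x ↦ A x v) D)
    (hψ : ContMDiffOn (𝓡 (4 * n)) 𝓘(ℝ, Spinor n) ∞ ψ D)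
    (hψ' : ContMDiffOn (𝓡 (4 * n)) 𝓘(ℝ, Spinor n) ∞ ψ' D) (h0 : ∀ x ∈ D, ψ x ≠ 0)
    (hS : ∀ x ∈ D, ∀ v, S x * gamma v = gamma (A x v) * S x) (hSψ : ∀ x ∈ D, S x (ψ x) = ψ' x)
    (φ : Spinor n) : ContMDiffOn (𝓡 (4 * n)) 𝓘(ℝ, Spinor n) ∞ (fun x ↦ S x φ) D := by
  intro x hx
  -- Values at `x` of operators `T` on `ψ` that can be moved through `S`: `S_y T = T'_y S_y` with
  -- `T'` smooth. Moving `γ(v)` through `S` gives `γ(A_y v)`, so `W` is invariant and hence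
  -- everything, with no prior regularity of `S`.
  let W : Submodule ℝ (Spinor n) :=
    { carrier := {χ | ∃ (T : Module.End ℝ (Spinor n)) (T' : M → Module.End ℝ (Spinor n)),
        (∀ φ, ContMDiffWithinAt (𝓡 (4 * n)) 𝓘(ℝ, Spinor n) ∞ (fun y ↦ T' y φ) D x) ∧
        (∀ y ∈ D, S y * T = T' y * S y) ∧ T (ψ x) = χ}
      add_mem' := by
        rintro _ _ ⟨T₁, T₁', h₁, hS₁, rfl⟩ ⟨T₂, T₂', h₂, hS₂, rfl⟩
        refine ⟨T₁ + T₂, fun y ↦ T₁' y + T₂' y, fun φ ↦ (h₁ φ).add (h₂ φ), fun y hy ↦ ?_, rfl⟩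
        rw [mul_add, add_mul, hS₁ y hy, hS₂ y hy]
      zero_mem' := ⟨0, fun _ ↦ 0, fun φ ↦ contMDiffWithinAt_const, fun y _ ↦ by simp, rfl⟩
      smul_mem' := by
        rintro c _ ⟨T₁, T₁', h₁, hS₁, rfl⟩
        refine ⟨c • T₁, fun y ↦ c • T₁' y, fun φ ↦
          contMDiffWithinAt_linearMap (c • LinearMap.id) (h₁ φ),
          fun y hy ↦ ?_, rfl⟩
        rw [mul_smul_comm, smul_mul_assoc, hS₁ y hy] }
  have hW : W = ⊤ := by
    refine eq_top_of_gamma_invariant (ψ := ψ x) ?_ ?_ (h0 x hx)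
    · rintro v _ ⟨T, T', h, hST, rfl⟩
      refine ⟨gamma v * T, fun y ↦ gamma (A y v) * T' y, fun φ ↦ ?_, fun y hy ↦ ?_, rfl⟩
      · exact contMDiffWithinAt_end_apply (T := fun y ↦ gamma (A y v))
          (fun φ ↦ contMDiffWithinAt_gamma (hA v x hx) φ) (h φ)
      · rw [← mul_assoc, hS y hy, mul_assoc, hST y hy, mul_assoc]
    · exact ⟨1, fun _ ↦ 1, fun φ ↦ contMDiffWithinAt_const, fun y _ ↦ by simp, rfl⟩
  have hall : ∀ B, (Pi.single B 1 : Spinor n) ∈ W := fun B ↦ hW ▸ Submodule.mem_top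
  choose T T' hT hST hTψ using hall
  -- The columns of `R` are `T_B ψ`, those of `R'` are `T'_B ψ' = S T_B ψ`. Since `R` is the
  -- identity at `x`, it is invertible nearby, and `S = R' R⁻¹` there.
  let R : M → Matrix (Finset (Fin (2 * n))) (Finset (Fin (2 * n))) ℝ :=
    fun y ↦ Matrix.of fun C B ↦ T B (ψ y) C
  let R' : M → Matrix (Finset (Fin (2 * n))) (Finset (Fin (2 * n))) ℝ :=
    fun y ↦ Matrix.of fun C B ↦ T' B y (ψ' y) C
  have hR : ∀ C B, ContMDiffWithinAt (𝓡 (4 * n)) 𝓘(ℝ, ℝ) ∞ (fun y ↦ R y C B) D x := fun C B ↦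
    contMDiffWithinAt_pi_space.1 (contMDiffWithinAt_linearMap (T B) (hψ x hx)) C
  have hR' : ∀ C B, ContMDiffWithinAt (𝓡 (4 * n)) 𝓘(ℝ, ℝ) ∞ (fun y ↦ R' y C B) D x :=
    fun C B ↦ contMDiffWithinAt_pi_space.1 (contMDiffWithinAt_end_apply (hT B) (hψ' x hx)) C
  have hRx : R x = 1 := by
    ext C B
    simp only [R, Matrix.of_apply, hTψ, Matrix.one_apply, Pi.single_apply]
  have hdet : (R x).det ≠ 0 := by simp [hRx]
  have hev : ∀ᶠ y in 𝓝[D] x, (R y).det ≠ 0 :=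
    (contMDiffWithinAt_det hR).continuousWithinAt.eventually_ne hdet
  have hformula : ∀ y ∈ D, (R y).det ≠ 0 → S y φ = (R' y * (R y)⁻¹).mulVec φ := by
    intro y hy hdet
    have h1 : (LinearMap.toMatrix' (S y)) * R y = R' y := by
      ext C B
      have h2 : S y (T B (ψ y)) = T' B y (ψ' y) := by
        rw [← Module.End.mul_apply, hST B y hy, Module.End.mul_apply, hSψ y hy]
      rw [← hSψ y hy] at h2
      have h3 := congrFun (LinearMap.toMatrix'_mulVec (S y) (T B (ψ y))) C
      rw [h2, hSψ y hy] at h3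
      exact h3
    rw [← h1, Matrix.mul_nonsing_inv_cancel_right _ _ (isUnit_iff_ne_zero.2 hdet),
      LinearMap.toMatrix'_mulVec]
  have hsm : ContMDiffWithinAt (𝓡 (4 * n)) 𝓘(ℝ, Spinor n) ∞
      (fun y ↦ (R' y * (R y)⁻¹).mulVec φ) D x := by
    rw [contMDiffWithinAt_pi_space]
    intro C
    simp only [Matrix.mulVec, dotProduct, Matrix.mul_apply]
    refine ContMDiffWithinAt.sum fun B _ ↦ ContMDiffWithinAt.mul ?_ contMDiffWithinAt_const
    exact ContMDiffWithinAt.sum fun E _ ↦ (hR' C E).mul (contMDiffWithinAt_inv_apply hR hdet E B)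
  refine hsm.congr_of_eventuallyEq ?_ (hformula x hx hdet)
  filter_upwards [hev, self_mem_nhdsWithin] with y hy hyD
  exact hformula y hyD hy

end Smooth

end NullKahler

namespace NullKahler

lemma finrank_tangentSpace {n : ℕ} {M : Type u} [TopologicalSpace M] [ChartedSpace (Model n) M]
    (x : M) : Module.finrank ℝ (TangentSpace (𝓡 (4 * n)) x) = 4 * n := by
  have : Module.finrank ℝ (Model n) = 4 * n := by simp
  exact this

/-! ### Spin structures from frames with prescribed pure spinors -/

section SpinorFrame

variable {n : ℕ} {M : Type u} [TopologicalSpace M] [ChartedSpace (Model n) M]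
  [IsManifold (𝓡 (4 * n)) ∞ M] {g : SplitMetric n M} {x : M}

variable (g) in
/-- Pseudo-orthonormal frames of the tangent space at a point. -/
def IsOrthoFrame (x : M) (e : Idx n → TangentSpace (𝓡 (4 * n)) x) : Prop :=
  ∀ a c, g.val x (e a) (e c) = if a = c then eta a else 0

variable (g) in
/-- The components of a tangent vector in a pseudo-orthonormal frame. -/
noncomputable def frameComp (x : M) (e : Idx n → TangentSpace (𝓡 (4 * n)) x)
    (v : TangentSpace (𝓡 (4 * n)) x) : Vec n :=
  fun a ↦ eta a * g.val x v (e a)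

variable {e e' e'' : Idx n → TangentSpace (𝓡 (4 * n)) x}

lemma IsOrthoFrame.frameComp_sum (he : IsOrthoFrame g x e) (v : Vec n) :
    frameComp g x e (∑ a, v a • e a) = v := by
  funext a
  simp only [frameComp, map_sum, map_smul, sum_apply,
    smul_apply, he _ _, smul_eq_mul, mul_ite, mul_zero, Finset.sum_ite_eq',
    Finset.mem_univ, if_true]
  linear_combination v a * eta_mul_self a

lemma IsOrthoFrame.linearIndependent (he : IsOrthoFrame g x e) : LinearIndependent ℝ e := by
  rw [Fintype.linearIndependent_iff]
  intro v hv a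
  have := congrFun (he.frameComp_sum v) a
  rw [hv] at this
  simpa [frameComp] using this.symm

lemma IsOrthoFrame.exists_eq_sum (he : IsOrthoFrame g x e) (v : TangentSpace (𝓡 (4 * n)) x) :
    ∃ c : Vec n, v = ∑ a, c a • e a := by
  have hspan := he.linearIndependent.span_eq_top_of_card_eq_finrank' (by
    rw [finrank_tangentSpace]
    simp
    ring)
  have : v ∈ Submodule.span ℝ (Set.range e) := hspan ▸ Submodule.mem_top
  obtain ⟨c, hc⟩ := (Submodule.mem_span_range_iff_exists_fun ℝ).1 this
  exact ⟨c, hc.symm⟩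

lemma IsOrthoFrame.sum_frameComp (he : IsOrthoFrame g x e) (v : TangentSpace (𝓡 (4 * n)) x) :
    ∑ a, frameComp g x e v a • e a = v := by
  obtain ⟨c, rfl⟩ := he.exists_eq_sum v
  rw [he.frameComp_sum]

lemma IsOrthoFrame.val_sum_sum (he : IsOrthoFrame g x e) (v w : Vec n) :
    g.val x (∑ a, v a • e a) (∑ a, w a • e a) = stdBilin n v w := by
  simp only [map_sum, map_smul, sum_apply, smul_apply,
    he _ _, smul_eq_mul, mul_ite, mul_zero, stdBilin_apply, stdInner,
    Finset.sum_ite_eq', Finset.mem_univ, if_true]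
  exact Finset.sum_congr rfl fun a _ ↦ by ring

variable (g x e e') in
/-- The matrix of the change from one frame to another. -/
noncomputable def frameChange : Vec n →ₗ[ℝ] Vec n where
  toFun v := frameComp g x e' (∑ a, v a • e a)
  map_add' v w := by
    funext a
    simp [frameComp, add_smul, Finset.sum_add_distrib, mul_add]
  map_smul' c v := by
    funext a
    simp only [frameComp, Pi.smul_apply, smul_eq_mul, mul_smul, ← Finset.smul_sum, map_smul,
      smul_apply, RingHom.id_apply]
    ring

lemma frameChange_apply (v : Vec n) :
    frameChange g x e e' v = frameComp g x e' (∑ a, v a • e a) := rfl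

lemma isIsometry_frameChange (he : IsOrthoFrame g x e) (he' : IsOrthoFrame g x e') :
    IsIsometry (frameChange g x e e') := by
  intro v w
  rw [frameChange_apply, frameChange_apply, ← he'.val_sum_sum, he'.sum_frameComp,
    he'.sum_frameComp, he.val_sum_sum]

variable (g) in
/-- A pseudo-orthonormal frame together with the components of a positive pure spinor that
corresponds to a given `2n`-form. -/
structure IsSpinorFrame (x : M) (α : (Fin (2 * n) → TangentSpace (𝓡 (4 * n)) x) → ℝ)
    (e : Idx n → TangentSpace (𝓡 (4 * n)) x) (ψ : Spinor n) : Prop where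
  ortho : IsOrthoFrame g x e
  pos : IsPosSemiSpinor ψ
  finrank_eq : Module.finrank ℝ (annihilator ψ) = 2 * n
  form : ∀ z, spinorAlt ψ (fun k ↦ frameComp g x e (z k)) = α z

/-- Elements of the spin group that cover a change of frame and carry a spinor to another. -/
structure IsLift (x : M) (e e' : Idx n → TangentSpace (𝓡 (4 * n)) x) (ψ ψ' : Spinor n)
    (s : (Module.End ℝ (Spinor n))ˣ) : Prop where
  mem : s ∈ spin n
  cover : ∀ v w : Vec n, ∑ a, v a • e a = ∑ a, w a • e' a →
    (s : Module.End ℝ (Spinor n)) * gamma v = gamma w * s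
  map : (s : Module.End ℝ (Spinor n)) ψ = ψ'

variable {α : (Fin (2 * n) → TangentSpace (𝓡 (4 * n)) x) → ℝ} {ψ ψ' ψ'' : Spinor n}

lemma IsSpinorFrame.ne_zero (hn : 0 < n) (h : IsSpinorFrame g x α e ψ) : ψ ≠ 0 := by
  rintro rfl
  obtain ⟨z, hz⟩ := exists_spinorAlt_ne_zero hn h.finrank_eq
  apply hz
  rw [← zero_smul ℝ (0 : Spinor n), spinorAlt_smul]
  simp

lemma IsLift.frameChange {s : (Module.End ℝ (Spinor n))ˣ} (h : IsLift x e e' ψ ψ' s)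
    (he' : IsOrthoFrame g x e') (v : Vec n) :
    (s : Module.End ℝ (Spinor n)) * gamma v = gamma (frameChange g x e e' v) * s :=
  h.cover v _ (he'.sum_frameComp _).symm

theorem IsSpinorFrame.exists_isLift (hn : 0 < n) (h : IsSpinorFrame g x α e ψ)
    (h' : IsSpinorFrame g x α e' ψ') : ∃ s, IsLift x e e' ψ ψ' s := by
  obtain ⟨s, hs, hsψ, hcov⟩ := exists_spin_lift hn (isIsometry_frameChange h.ortho h'.ortho)
    h.pos h'.pos h.finrank_eq h'.finrank_eq fun z ↦ by
      have h1 := h.form fun k ↦ ∑ a, z k a • e a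
      have h2 := h'.form fun k ↦ ∑ a, z k a • e a
      simp only [h.ortho.frameComp_sum] at h1
      rw [h1, ← h2]
      rfl
  refine ⟨s, hs, fun v w hvw ↦ ?_, hsψ⟩
  rw [hcov, frameChange_apply, hvw, h'.ortho.frameComp_sum]

/-- Uniqueness is what turns pointwise choices into a cocycle: two composites of lifts that join the
same frames and spinors must agree. -/
lemma IsLift.unique {s s' : (Module.End ℝ (Spinor n))ˣ} (h : IsLift x e e' ψ ψ' s)
    (h' : IsLift x e e' ψ ψ' s') (he' : IsOrthoFrame g x e') (h0 : ψ ≠ 0) : s = s' :=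
  Units.ext (covering_unique (h.frameChange he') (h'.frameChange he') h0 (h.map.trans h'.map.symm))

lemma IsLift.mul {s s' : (Module.End ℝ (Spinor n))ˣ} (h : IsLift x e e' ψ ψ' s)
    (h' : IsLift x e' e'' ψ' ψ'' s') (he' : IsOrthoFrame g x e') :
    IsLift x e e'' ψ ψ'' (s' * s) where
  mem := mul_mem h'.mem h.mem
  cover v w hvw := by
    have h1 := h.cover v _ (he'.sum_frameComp (∑ a, v a • e a)).symm
    have h2 := h'.cover _ w ((he'.sum_frameComp (∑ a, v a • e a)).trans hvw)
    rw [Units.val_mul, mul_assoc, h1, ← mul_assoc, h2, mul_assoc]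
  map := by rw [Units.val_mul, Module.End.mul_apply, h.map, h'.map]

open Classical in
/-- The lift of a change of frame that carries a spinor to another, if there is one. -/
noncomputable def liftOf (x : M) (e e' : Idx n → TangentSpace (𝓡 (4 * n)) x) (ψ ψ' : Spinor n) :
    (Module.End ℝ (Spinor n))ˣ :=
  if h : ∃ s, IsLift x e e' ψ ψ' s then h.choose else 1

lemma IsSpinorFrame.isLift_liftOf (hn : 0 < n) (h : IsSpinorFrame g x α e ψ)
    (h' : IsSpinorFrame g x α e' ψ') : IsLift x e e' ψ ψ' (liftOf x e e' ψ ψ') := by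
  have hex := h.exists_isLift hn h'
  rw [liftOf, dif_pos hex]
  exact hex.choose_spec

variable {αM : ∀ x : M, (Fin (2 * n) → TangentSpace (𝓡 (4 * n)) x) → ℝ}

/-- `liftOf` is chosen separately at each point. Smoothness still follows, because the lift is
determined by frames and spinors that vary smoothly. -/
lemma contMDiffOn_liftOf (hn : 0 < n) {D : Set M} {E E' : Idx n → VField n M}
    {Ψ Ψ' : M → Spinor n} (hE : ∀ a, SmoothOn (E a) D) (hE' : ∀ a, SmoothOn (E' a) D)
    (hΨ : ContMDiffOn (𝓡 (4 * n)) 𝓘(ℝ, Spinor n) ∞ Ψ D)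
    (hΨ' : ContMDiffOn (𝓡 (4 * n)) 𝓘(ℝ, Spinor n) ∞ Ψ' D)
    (hF : ∀ x ∈ D, IsSpinorFrame g x (αM x) (fun a ↦ E a x) (Ψ x))
    (hF' : ∀ x ∈ D, IsSpinorFrame g x (αM x) (fun a ↦ E' a x) (Ψ' x)) (φ : Spinor n) :
    ContMDiffOn (𝓡 (4 * n)) 𝓘(ℝ, Spinor n) ∞
      (fun x ↦ (liftOf x (fun a ↦ E a x) (fun a ↦ E' a x) (Ψ x) (Ψ' x) :
        Module.End ℝ (Spinor n)) φ) D := by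
  refine contMDiffOn_covering
    (A := fun x v ↦ frameChange g x (fun a ↦ E a x) (fun a ↦ E' a x) v) ?_ hΨ hΨ'
    (fun x hx ↦ (hF x hx).ne_zero hn)
    (fun x hx v ↦ ((hF x hx).isLift_liftOf hn (hF' x hx)).frameChange (hF' x hx).ortho v)
    (fun x hx ↦ ((hF x hx).isLift_liftOf hn (hF' x hx)).map) φ
  intro v x hx
  rw [contMDiffWithinAt_pi_space]
  intro a
  simp only [frameChange_apply, frameComp, map_sum, map_smul, sum_apply,
    smul_apply, smul_eq_mul]
  refine contMDiffWithinAt_const.mul (ContMDiffWithinAt.sum fun c _ ↦ ?_)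
  exact contMDiffWithinAt_const.mul (g.contMDiffWithinAt_val (hE c x hx) (hE' a x hx))

/-- The spin structure defined by a family of local frames with positive pure spinors that
correspond to a given form. -/
noncomputable def spinStructureOfFrames (hn : 0 < n) {ι : Type u} (dom : ι → Set M)
    (isOpen_dom : ∀ i, IsOpen (dom i)) (cover : ∀ x, ∃ i, x ∈ dom i)
    (frame : ι → Idx n → VField n M) (smooth_frame : ∀ i a, SmoothOn (frame i a) (dom i))
    (Ψ : ι → M → Spinor n)
    (hΨ : ∀ i, ContMDiffOn (𝓡 (4 * n)) 𝓘(ℝ, Spinor n) ∞ (Ψ i) (dom i))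
    (hF : ∀ i, ∀ x ∈ dom i, IsSpinorFrame g x (αM x) (fun a ↦ frame i a x) (Ψ i x)) :
    SpinStructure g where
  Index := ι
  dom := dom
  isOpen_dom := isOpen_dom
  cover := cover
  frame := frame
  smooth_frame := smooth_frame
  orthonormal i x hx := (hF i x hx).ortho
  trans i j x := liftOf x (fun a ↦ frame j a x) (fun a ↦ frame i a x) (Ψ j x) (Ψ i x)
  trans_mem i j x hx := ((hF j x hx.2).isLift_liftOf hn (hF i x hx.1)).mem
  smooth_trans i j φ := contMDiffOn_liftOf hn
    (fun a ↦ (smooth_frame j a).mono inter_subset_right)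
    (fun a ↦ (smooth_frame i a).mono inter_subset_left) ((hΨ j).mono inter_subset_right)
    ((hΨ i).mono inter_subset_left) (fun x hx ↦ hF j x hx.2) (fun x hx ↦ hF i x hx.1) φ
  trans_lift i j x hx v w hvw :=
    ((hF j x hx.2).isLift_liftOf hn (hF i x hx.1)).cover v w hvw
  -- Both sides lift the change from frame `k` to frame `i` and carry `Ψ k x` to `Ψ i x`.
  cocycle i j k x hx :=
    (((hF k x hx.2).isLift_liftOf hn (hF j x hx.1.2)).mul
      ((hF j x hx.1.2).isLift_liftOf hn (hF i x hx.1.1)) (hF j x hx.1.2).ortho).unique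
      ((hF k x hx.2).isLift_liftOf hn (hF i x hx.1.1)) (hF i x hx.1.1).ortho
      ((hF k x hx.2).ne_zero hn)

/-- The spinor field with the prescribed components in the frames of the spin structure that it
defines. -/
noncomputable def spinorFieldOfFrames (hn : 0 < n) {ι : Type u} (dom : ι → Set M)
    (isOpen_dom : ∀ i, IsOpen (dom i)) (cover : ∀ x, ∃ i, x ∈ dom i)
    (frame : ι → Idx n → VField n M) (smooth_frame : ∀ i a, SmoothOn (frame i a) (dom i))
    (Ψ : ι → M → Spinor n)
    (hΨ : ∀ i, ContMDiffOn (𝓡 (4 * n)) 𝓘(ℝ, Spinor n) ∞ (Ψ i) (dom i))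
    (hF : ∀ i, ∀ x ∈ dom i, IsSpinorFrame g x (αM x) (fun a ↦ frame i a x) (Ψ i x)) :
    SpinorField (spinStructureOfFrames hn dom isOpen_dom cover frame smooth_frame Ψ hΨ hF) where
  toFun := Ψ
  smooth := hΨ
  compat i j x hx := ((hF j x hx.2).isLift_liftOf hn (hF i x hx.1)).map.symm

lemma SpinorField.isSpinorFrame {P : SpinStructure g} {ψ : SpinorField P} (hp : ψ.IsPosPure)
    (hc : ψ.CorrespondsTo αM) (i : P.Index) {x : M} (hx : x ∈ P.dom i) :
    IsSpinorFrame g x (αM x) (fun a ↦ P.frame i a x) (ψ.toFun i x) where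
  ortho := P.orthonormal i x hx
  pos := (hp i x hx).1
  finrank_eq := (hp i x hx).2.2
  form z := by
    rw [← spinorForm_eq]
    exact hc i x hx z

lemma SpinorField.isLift_trans {P : SpinStructure g} (ψ : SpinorField P) (i j : P.Index) {x : M}
    (hi : x ∈ P.dom i) (hj : x ∈ P.dom j) :
    IsLift x (fun a ↦ P.frame j a x) (fun a ↦ P.frame i a x) (ψ.toFun j x) (ψ.toFun i x)
      (P.trans i j x) where
  mem := P.trans_mem i j x ⟨hi, hj⟩
  cover := P.trans_lift i j x ⟨hi, hj⟩
  map := (ψ.compat i j x ⟨hi, hj⟩).symm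

/-- Two spin structures with positive pure spinor fields that correspond to the same form are
isomorphic, by an isomorphism that carries one spinor field to the other. -/
theorem exists_spinIso_carries (hn : 0 < n) {P P' : SpinStructure g} {ψ : SpinorField P}
    {ψ' : SpinorField P'} (hp : ψ.IsPosPure) (hc : ψ.CorrespondsTo αM) (hp' : ψ'.IsPosPure)
    (hc' : ψ'.CorrespondsTo αM) : ∃ T : SpinIso P P', T.Carries ψ ψ' := by
  have hF := fun i x (hx : x ∈ P.dom i) ↦ SpinorField.isSpinorFrame hp hc i hx
  have hF' := fun i x (hx : x ∈ P'.dom i) ↦ SpinorField.isSpinorFrame hp' hc' i hx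
  have hl := fun k i x (hk : x ∈ P'.dom k) (hi : x ∈ P.dom i) ↦
    (hF i x hi).isLift_liftOf hn (hF' k x hk)
  -- The isomorphism is again the lift matching the spinors. Transition functions are themselves
  -- such lifts, so both compatibilities are instances of uniqueness.
  refine ⟨{
    toFun := fun k i x ↦ liftOf x (fun a ↦ P.frame i a x) (fun a ↦ P'.frame k a x)
      (ψ.toFun i x) (ψ'.toFun k x)
    mem := fun k i x hx ↦ (hl k i x hx.1 hx.2).mem
    smooth := fun k i φ ↦ contMDiffOn_liftOf hn
      (fun a ↦ (P.smooth_frame i a).mono inter_subset_right)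
      (fun a ↦ (P'.smooth_frame k a).mono inter_subset_left)
      ((ψ.smooth i).mono inter_subset_right) ((ψ'.smooth k).mono inter_subset_left)
      (fun x hx ↦ hF i x hx.2) (fun x hx ↦ hF' k x hx.1) φ
    lift := fun k i x hx ↦ (hl k i x hx.1 hx.2).cover
    compat_left := fun l k i x hx ↦
      ((hl k i x hx.1.2 hx.2).mul (ψ'.isLift_trans l k hx.1.1 hx.1.2) (hF' k x hx.1.2).ortho).unique
        (hl l i x hx.1.1 hx.2) (hF' l x hx.1.1).ortho ((hF i x hx.2).ne_zero hn)
    compat_right := fun k i j x hx ↦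
      ((ψ.isLift_trans i j hx.1.2 hx.2).mul (hl k i x hx.1.1 hx.1.2) (hF i x hx.1.2).ortho).unique
        (hl k j x hx.1.1 hx.2) (hF' k x hx.1.1).ortho ((hF j x hx.2).ne_zero hn) }, ?_⟩
  exact fun k i x hx ↦ (hl k i x hx.1 hx.2).map

end SpinorFrame

end NullKahler

namespace NullKahler

/-! ### Frames adapted to the kernel of `N` -/

section NullFrame

variable {n : ℕ} {M : Type u} [TopologicalSpace M] [ChartedSpace (Model n) M]
  [IsManifold (𝓡 (4 * n)) ∞ M] {g : SplitMetric n M} {N : EndField n M} {x : M}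

section Pointwise

variable (g N x) in
/-- The Gram matrix of a family of tangent vectors with respect to the fundamental two-form. -/
noncomputable def fundGram (c : Fin (2 * n) → TangentSpace (𝓡 (4 * n)) x) :
    Matrix (Fin (2 * n)) (Fin (2 * n)) ℝ :=
  Matrix.of fun i j ↦ fundBilin g N x (c i) (c j)

variable (g N x) in
/-- The basis of the kernel of `N` that is dual to a family of tangent vectors. -/
noncomputable def kerVec (c : Fin (2 * n) → TangentSpace (𝓡 (4 * n)) x) (i : Fin (2 * n)) :
    TangentSpace (𝓡 (4 * n)) x :=
  ∑ k, ((1 / 2) * (fundGram g N x c)⁻¹ i k) • N x (c k)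

variable (g N x) in
/-- The isotropic family that is obtained from a family of tangent vectors by adding elements of
the kernel of `N`. -/
noncomputable def coVec (c : Fin (2 * n) → TangentSpace (𝓡 (4 * n)) x) (i : Fin (2 * n)) :
    TangentSpace (𝓡 (4 * n)) x :=
  hypVec (g.bilin x) (kerVec g N x c) c i

variable (g N x) in
/-- The pseudo-orthonormal frame adapted to `N` that is built from a family of tangent vectors. -/
noncomputable def nullFrame (c : Fin (2 * n) → TangentSpace (𝓡 (4 * n)) x) :
    Idx n → TangentSpace (𝓡 (4 * n)) x :=
  Sum.elim (fun i ↦ coVec g N x c i + kerVec g N x c i) fun i ↦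
    coVec g N x c i - kerVec g N x c i

variable {c : Fin (2 * n) → TangentSpace (𝓡 (4 * n)) x}

lemma IsNullKahler.map_kerVec (h : IsNullKahler g N) (i : Fin (2 * n)) :
    N x (kerVec g N x c i) = 0 := by
  simp [kerVec, h.sq_zero]

/-- The vectors `kerVec` lie in the image of `N`, which is orthogonal to `Ker N` because `N` is
skew. -/
lemma IsNullKahler.val_kerVec_of_ker (h : IsNullKahler g N) (i : Fin (2 * n))
    {v : TangentSpace (𝓡 (4 * n)) x} (hv : N x v = 0) : g.val x (kerVec g N x c i) v = 0 := by
  simp [kerVec, sum_apply, h.skew, hv]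

lemma IsNullKahler.val_kerVec_kerVec (h : IsNullKahler g N) (i j : Fin (2 * n)) :
    g.val x (kerVec g N x c i) (kerVec g N x c j) = 0 :=
  h.val_kerVec_of_ker i (h.map_kerVec j)

lemma IsNullKahler.val_kerVec_self (h : IsNullKahler g N)
    (hc : wedgeAlt (fundBilin g N x) n c ≠ 0) (i j : Fin (2 * n)) :
    g.val x (kerVec g N x c i) (c j) = if i = j then 1 / 2 else 0 := by
  have hdet : IsUnit (fundGram g N x c).det :=
    isUnit_iff_ne_zero.2 (det_gram_ne_zero (h.fundBilin_skew x) hc)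
  have h1 := congrFun (congrFun (Matrix.nonsing_inv_mul _ hdet) i) j
  rw [Matrix.mul_apply, Matrix.one_apply] at h1
  have h2 : g.val x (kerVec g N x c i) (c j) =
      (1 / 2) * ∑ k, (fundGram g N x c)⁻¹ i k * fundGram g N x c k j := by
    simp only [kerVec, map_sum, map_smul, sum_apply, smul_apply, smul_eq_mul, Finset.mul_sum]
    refine Finset.sum_congr rfl fun k _ ↦ ?_
    rw [fundGram, Matrix.of_apply, fundBilin_apply, mul_assoc]
  rw [h2, h1]
  split_ifs <;> simp

lemma IsNullKahler.val_kerVec_coVec (h : IsNullKahler g N)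
    (hc : wedgeAlt (fundBilin g N x) n c ≠ 0) (i j : Fin (2 * n)) :
    g.val x (kerVec g N x c i) (coVec g N x c j) = if i = j then 1 / 2 else 0 :=
  bilin_hypVec_right (b := g.bilin x) h.val_kerVec_kerVec (h.val_kerVec_self hc) i j

lemma IsNullKahler.isOrthoFrame_nullFrame (h : IsNullKahler g N)
    (hc : wedgeAlt (fundBilin g N x) n c ≠ 0) : IsOrthoFrame g x (nullFrame g N x c) :=
  bilin_hypFrame (b := g.bilin x) (g.symm x) h.val_kerVec_kerVec (h.val_kerVec_self hc)

lemma map_coVec (h : IsNullKahler g N) (i : Fin (2 * n)) : N x (coVec g N x c i) = N x (c i) := by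
  simp [coVec, hypVec, h.map_kerVec]

/-- Passing from `c` to `coVec` changes vectors only by elements of `Ker N`, which `Ω` does not see.
-/
lemma IsNullKahler.wedgeAlt_coVec (h : IsNullKahler g N) :
    wedgeAlt (fundBilin g N x) n (coVec g N x c) = wedgeAlt (fundBilin g N x) n c := by
  have hB : ∀ i j, fundBilin g N x (coVec g N x c i) (coVec g N x c j) =
      fundBilin g N x (c i) (c j) := fun i j ↦ by
    rw [fundBilin_apply, map_coVec h, ← fundBilin_apply, h.fundBilin_skew, fundBilin_apply,
      map_coVec h, ← fundBilin_apply, ← h.fundBilin_skew]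
  simp only [wedgeAlt_apply, pairProd_apply, Function.comp_apply, hB]

/-- The expansion of a tangent vector in the basis formed by the vectors `coVec` and `kerVec`. -/
lemma IsNullKahler.eq_sum_coVec_add_sum_kerVec (h : IsNullKahler g N)
    (hc : wedgeAlt (fundBilin g N x) n c ≠ 0) (v : TangentSpace (𝓡 (4 * n)) x) :
    v = ∑ i, (2 * g.val x v (kerVec g N x c i)) • coVec g N x c i +
      ∑ i, (2 * g.val x v (coVec g N x c i)) • kerVec g N x c i := by
  conv_lhs => rw [← (h.isOrthoFrame_nullFrame hc).sum_frameComp v]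
  rw [Fintype.sum_sum_type, ← Finset.sum_add_distrib, ← Finset.sum_add_distrib]
  refine Finset.sum_congr rfl fun i _ ↦ ?_
  simp only [frameComp, nullFrame, Sum.elim_inl, Sum.elim_inr, eta, map_add, map_sub]
  module

lemma IsNullKahler.map_eq_zero_iff (h : IsNullKahler g N)
    (hc : wedgeAlt (fundBilin g N x) n c ≠ 0) (v : TangentSpace (𝓡 (4 * n)) x) :
    N x v = 0 ↔ ∀ i, g.val x v (kerVec g N x c i) = 0 := by
  constructor
  · intro hv i
    rw [g.symm, h.val_kerVec_of_ker i hv]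
  · intro hv
    rw [h.eq_sum_coVec_add_sum_kerVec hc v]
    simp [hv, h.map_kerVec]

/-- In this frame the coefficient of `a†_i` in Clifford multiplication by `v` is `2 g(v, kerVec i)`,
and `Ker N` is the orthogonal of the vectors `kerVec`. -/
lemma IsNullKahler.gamma_vac_eq_zero_iff (h : IsNullKahler g N)
    (hc : wedgeAlt (fundBilin g N x) n c ≠ 0) (v : TangentSpace (𝓡 (4 * n)) x) :
    gamma (frameComp g x (nullFrame g N x c) v) (vac n) = 0 ↔ N x v = 0 := by
  rw [NullKahler.gamma_vac_eq_zero_iff, h.map_eq_zero_iff hc]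
  refine forall_congr' fun i ↦ ?_
  have : frameComp g x (nullFrame g N x c) v (Sum.inl i) +
      frameComp g x (nullFrame g N x c) v (Sum.inr i) = 2 * g.val x v (kerVec g N x c i) := by
    simp only [frameComp, nullFrame, Sum.elim_inl, Sum.elim_inr, eta, map_add, map_sub]
    ring
  rw [this]
  simp

lemma sum_creVec_nullFrame (i : Fin (2 * n)) :
    ∑ a, creVec i a • nullFrame g N x c a = coVec g N x c i := by
  simp only [creVec, Pi.add_apply, add_smul, Finset.sum_add_distrib, Pi.single_apply, ite_smul,
    zero_smul, Finset.sum_ite_eq', Finset.mem_univ, if_true, nullFrame, Sum.elim_inl, Sum.elim_inr]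
  module

lemma IsNullKahler.frameComp_coVec (h : IsNullKahler g N)
    (hc : wedgeAlt (fundBilin g N x) n c ≠ 0) (i : Fin (2 * n)) :
    frameComp g x (nullFrame g N x c) (coVec g N x c i) = creVec i := by
  rw [← sum_creVec_nullFrame, (h.isOrthoFrame_nullFrame hc).frameComp_sum]

variable (g N x c) in
/-- The vectors `coVec` and `kerVec` together. -/
noncomputable def nullVec : Idx n → TangentSpace (𝓡 (4 * n)) x :=
  Sum.elim (coVec g N x c) (kerVec g N x c)

lemma IsNullKahler.span_nullVec (h : IsNullKahler g N)
    (hc : wedgeAlt (fundBilin g N x) n c ≠ 0) :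
    Submodule.span ℝ (range (nullVec g N x c)) = ⊤ := by
  refine eq_top_iff.2 fun v _ ↦ ?_
  rw [h.eq_sum_coVec_add_sum_kerVec hc v]
  refine add_mem (Submodule.sum_mem _ fun i _ ↦ Submodule.smul_mem _ _ ?_)
    (Submodule.sum_mem _ fun i _ ↦ Submodule.smul_mem _ _ ?_)
  · exact Submodule.subset_span ⟨Sum.inl i, rfl⟩
  · exact Submodule.subset_span ⟨Sum.inr i, rfl⟩

variable (g x) in
/-- The components of tangent vectors in a frame, as a linear map. -/
noncomputable def frameCompLin (e : Idx n → TangentSpace (𝓡 (4 * n)) x) :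
    TangentSpace (𝓡 (4 * n)) x →ₗ[ℝ] Vec n :=
  LinearMap.pi fun a ↦ eta a • (g.bilin x).flip (e a)

lemma frameCompLin_apply (e : Idx n → TangentSpace (𝓡 (4 * n)) x)
    (v : TangentSpace (𝓡 (4 * n)) x) : frameCompLin g x e v = frameComp g x e v := rfl

/-- In an adapted frame, the form of the vacuum is `Ω^{∧n}`. -/
theorem IsNullKahler.isSpinorFrame_nullFrame (h : IsNullKahler g N)
    (hc : wedgeAlt (fundBilin g N x) n c = spinorAlt (vac n) creVec) :
    IsSpinorFrame g x (fundPower g N x) (nullFrame g N x c) (vac n) where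
  ortho := h.isOrthoFrame_nullFrame (hc ▸ spinorAlt_vac_creVec_ne_zero n)
  pos := isPosSemiSpinor_vac n
  finrank_eq := finrank_annihilator_vac n
  form z := by
    have hc0 : wedgeAlt (fundBilin g N x) n c ≠ 0 := hc ▸ spinorAlt_vac_creVec_ne_zero n
    rw [fundPower_eq]
    have hcard : Fintype.card (Idx n) = Module.finrank ℝ (TangentSpace (𝓡 (4 * n)) x) := by
      rw [finrank_tangentSpace]
      simp
      ring
    let b := basisOfTopLeSpanOfCardEqFinrank (nullVec g N x c) (h.span_nullVec hc0).ge hcard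
    have hb : ⇑b = nullVec g N x c := coe_basisOfTopLeSpanOfCardEqFinrank _ _ _
    suffices (spinorAlt (vac n)).compLinearMap (frameCompLin g x (nullFrame g N x c)) =
        wedgeAlt (fundBilin g N x) n from DFunLike.congr_fun this z
    -- Alternating forms are compared on injective families from a basis. If a vector of `Ker N`
    -- occurs, both forms vanish; otherwise the family is a permutation of `coVec`, where the
    -- normalisation `hc` gives equality.
    refine b.ext_alternating fun ν hν ↦ ?_
    rw [hb]
    by_cases hr : ∃ k i, ν k = Sum.inr i
    · obtain ⟨k, i, hk⟩ := hr
      have h0 : N x (nullVec g N x c (ν k)) = 0 := by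
        rw [hk]
        exact h.map_kerVec i
      rw [wedgeAlt_eq_zero _ k]
      · exact spinorAlt_vac_eq_zero k ((h.gamma_vac_eq_zero_iff hc0 _).2 h0)
      · intro j
        rw [fundBilin_apply, h0, map_zero, zero_apply]
      · intro j
        rw [h.fundBilin_skew, fundBilin_apply, h0, map_zero, zero_apply, neg_zero]
    · have hl : ∀ k, ∃ i, ν k = Sum.inl i := fun k ↦ by
        rcases hk : ν k with i | i
        · exact ⟨i, rfl⟩
        · exact absurd ⟨k, i, hk⟩ hr
      choose σ hσ using hl
      have hbij : Function.Bijective σ := Function.Injective.bijective_of_finite fun k l hkl ↦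
        hν (by rw [hσ, hσ, hkl])
      have hν' : (fun k ↦ nullVec g N x c (ν k)) = coVec g N x c ∘ Equiv.ofBijective σ hbij := by
        funext k
        rw [hσ]
        rfl
      rw [hν', AlternatingMap.map_perm, AlternatingMap.map_perm, h.wedgeAlt_coVec, hc]
      congr 1
      refine congrArg (spinorAlt (vac n)) (funext fun k ↦ ?_)
      exact h.frameComp_coVec hc0 k

/-- Components of `v` in `Ker N` or along another `coVec` drop out. Applied to derivatives of
`coVec`, this turns the derivative of `Ω^{∧n}` into a trace. -/
lemma IsNullKahler.wedgeAlt_update_coVec (h : IsNullKahler g N)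
    (hc : wedgeAlt (fundBilin g N x) n c ≠ 0) (j : Fin (2 * n)) (v : TangentSpace (𝓡 (4 * n)) x) :
    wedgeAlt (fundBilin g N x) n (Function.update (coVec g N x c) j v) =
      2 * g.val x v (kerVec g N x c j) * wedgeAlt (fundBilin g N x) n c := by
  have h0 : ∀ w, N x w = 0 →
      wedgeAlt (fundBilin g N x) n (Function.update (coVec g N x c) j w) = 0 := fun w hw ↦ by
    refine wedgeAlt_eq_zero _ j ?_ ?_
    · intro l
      rw [Function.update_self, fundBilin_apply, hw, map_zero, zero_apply]
    · intro l
      rw [h.fundBilin_skew, Function.update_self, fundBilin_apply, hw, map_zero, zero_apply,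
        neg_zero]
  conv_lhs => rw [h.eq_sum_coVec_add_sum_kerVec hc v]
  rw [AlternatingMap.map_update_add,
    h0 (∑ i, (2 * g.val x v (coVec g N x c i)) • kerVec g N x c i) (by simp [h.map_kerVec]),
    add_zero,
    AlternatingMap.map_update_sum, Finset.sum_eq_single j]
  · rw [AlternatingMap.map_update_smul, Function.update_eq_self, h.wedgeAlt_coVec, smul_eq_mul]
  · intro l _ hl
    rw [AlternatingMap.map_update_smul, AlternatingMap.map_update_self _ _ hl.symm, smul_zero]
  · simp

end Pointwise

end NullFrame

end NullKahler

namespace NullKahler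

/-! ### Local adapted frames and the parallel spinor -/

section ParallelSpinor

variable {n : ℕ} {M : Type u} [TopologicalSpace M] [ChartedSpace (Model n) M]
  [IsManifold (𝓡 (4 * n)) ∞ M] {g : SplitMetric n M} {N : EndField n M}
  {C : Fin (2 * n) → VField n M} {D : Set M}

lemma smoothOn_sum_smul {ι : Type*} [Fintype ι] {f : ι → M → ℝ} {X : ι → VField n M}
    (hf : ∀ i, ContMDiffOn (𝓡 (4 * n)) 𝓘(ℝ, ℝ) ∞ (f i) D) (hX : ∀ i, SmoothOn (X i) D) :
    SmoothOn (fun x ↦ ∑ i, f i x • X i x) D := fun x hx ↦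
  ContMDiffWithinAt.sum_section fun i _ ↦ (hf i x hx).smul_section (hX i x hx)

lemma IsNullKahler.contMDiffOn_fundForm (h : IsNullKahler g N) {X Y : VField n M}
    (hX : SmoothOn X D) (hY : SmoothOn Y D) :
    ContMDiffOn (𝓡 (4 * n)) 𝓘(ℝ, ℝ) ∞ (fun x ↦ g.val x (N x (X x)) (Y x)) D := fun x hx ↦
  g.contMDiffWithinAt_val (contMDiffWithinAt_endField h.contMDiff (hX x hx)) (hY x hx)

lemma IsNullKahler.smoothOn_kerVec (h : IsNullKahler g N) (hC : ∀ j, SmoothOn (C j) D)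
    (hc : ∀ x ∈ D, wedgeAlt (fundBilin g N x) n (fun j ↦ C j x) ≠ 0) (i : Fin (2 * n)) :
    SmoothOn (fun x ↦ kerVec g N x (fun j ↦ C j x) i) D := by
  refine smoothOn_sum_smul (fun k x hx ↦ contMDiffWithinAt_const.mul ?_)
    fun k x hx ↦ contMDiffWithinAt_endField h.contMDiff (hC k x hx)
  exact contMDiffWithinAt_inv_apply (F := fun x ↦ fundGram g N x fun j ↦ C j x)
    (fun i j ↦ h.contMDiffOn_fundForm (hC i) (hC j) x hx)
    (det_gram_ne_zero (h.fundBilin_skew x) (hc x hx)) i k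

lemma IsNullKahler.smoothOn_coVec (h : IsNullKahler g N) (hC : ∀ j, SmoothOn (C j) D)
    (hc : ∀ x ∈ D, wedgeAlt (fundBilin g N x) n (fun j ↦ C j x) ≠ 0) (i : Fin (2 * n)) :
    SmoothOn (fun x ↦ coVec g N x (fun j ↦ C j x) i) D := fun x hx ↦
  (hC i x hx).sub_section <| smoothOn_sum_smul
    (fun k y hy ↦ g.contMDiffWithinAt_val (hC i y hy) (hC k y hy))
    (fun k ↦ h.smoothOn_kerVec hC hc k) x hx

lemma IsNullKahler.smoothOn_nullFrame (h : IsNullKahler g N) (hC : ∀ j, SmoothOn (C j) D)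
    (hc : ∀ x ∈ D, wedgeAlt (fundBilin g N x) n (fun j ↦ C j x) ≠ 0) (a : Idx n) :
    SmoothOn (fun x ↦ nullFrame g N x (fun j ↦ C j x) a) D := fun x hx ↦ by
  rcases a with i | i
  · exact (h.smoothOn_coVec hC hc i x hx).add_section (h.smoothOn_kerVec hC hc i x hx)
  · exact (h.smoothOn_coVec hC hc i x hx).sub_section (h.smoothOn_kerVec hC hc i x hx)

lemma IsNullKahler.contMDiffOn_wedgeAlt (h : IsNullKahler g N) (hC : ∀ j, SmoothOn (C j) D) :
    ContMDiffOn (𝓡 (4 * n)) 𝓘(ℝ, ℝ) ∞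
      (fun x ↦ wedgeAlt (fundBilin g N x) n fun j ↦ C j x) D := fun x hx ↦ by
  simp only [wedgeAlt_apply, pairProd_apply]
  refine contMDiffWithinAt_const.mul (ContMDiffWithinAt.sum fun σ _ ↦
    contMDiffWithinAt_const.mul (contMDiffWithinAt_finsetProd fun k _ ↦ ?_))
  exact h.contMDiffOn_fundForm (hC _) (hC _) x hx

/-- Nondegeneracy of `g` identifies the radical of `Ω` with `Ker N`, so `Ω` has rank `4n - 2n = 2n`.
-/
lemma IsNullKahler.exists_fundPower_ne_zero (h : IsNullKahler g N) (x : M) :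
    ∃ c, wedgeAlt (fundBilin g N x) n c ≠ 0 := by
  refine exists_wedgeAlt_ne_zero (h.fundBilin_skew x) ?_
  have hker : LinearMap.ker (fundBilin g N x) = LinearMap.ker (N x).toLinearMap := by
    ext v
    rw [LinearMap.mem_ker, LinearMap.mem_ker]
    constructor
    · intro hv
      exact g.nondegenerate x _ fun w ↦ congrArg (fun f ↦ f w) hv
    · intro hv
      refine LinearMap.ext fun w ↦ ?_
      have hv' : N x v = 0 := hv
      rw [fundBilin_apply, hv', map_zero]
      rfl
  rw [hker, h.rank_ker, finrank_tangentSpace]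
  omega

/-- Local frames of a complement of the kernel of `N` on which `Ω^{∧n}` takes a given value. -/
lemma IsNullKahler.exists_local_complement (h : IsNullKahler g N) (hn : 0 < n) {r : ℝ}
    (x₀ : M) : ∃ (C : Fin (2 * n) → VField n M) (D : Set M), IsOpen D ∧ x₀ ∈ D ∧
      (∀ j, SmoothOn (C j) D) ∧
      ∀ x ∈ D, wedgeAlt (fundBilin g N x) n (fun j ↦ C j x) = r := by
  obtain ⟨c, hc⟩ := h.exists_fundPower_ne_zero x₀
  have hex : ∀ j, ∃ s ∈ 𝓝 x₀, SmoothOn (FiberBundle.extend (Model n) (c j)) s := fun j ↦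
    FiberBundle.exists_contMDiffOn_extend (k := ∞) (𝓡 (4 * n)) (Model n) (c j)
  choose s hs hsmooth using hex
  obtain ⟨U, hUs, hU, hxU⟩ := mem_nhds_iff.1 (Filter.iInter_mem.2 hs)
  let C : Fin (2 * n) → VField n M := fun j ↦ FiberBundle.extend (Model n) (c j)
  have hC : ∀ j, SmoothOn (C j) U := fun j ↦
    (hsmooth j).mono (hUs.trans (iInter_subset s j))
  let F : M → ℝ := fun x ↦ wedgeAlt (fundBilin g N x) n fun j ↦ C j x
  have hF : ContMDiffOn (𝓡 (4 * n)) 𝓘(ℝ, ℝ) ∞ F U := h.contMDiffOn_wedgeAlt hC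
  let j₀ : Fin (2 * n) := ⟨0, by omega⟩
  -- Rescaling one vector suffices to give the power the value `r`. The factor may be negative, so
  -- the sign of `F` is no obstruction.
  refine ⟨Function.update C j₀ fun x ↦ (r * (F x)⁻¹) • C j₀ x, U ∩ F ⁻¹' {0}ᶜ,
    hF.continuousOn.isOpen_inter_preimage hU isOpen_compl_singleton, ⟨hxU, ?_⟩, ?_, ?_⟩
  · have : (fun j ↦ C j x₀) = c := funext fun j ↦ FiberBundle.extend_apply_self (Model n) (c j)
    simpa only [mem_preimage, mem_compl_iff, mem_singleton_iff, F, this] using hc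
  · intro j x hx
    by_cases hj : j = j₀
    · subst hj
      rw [Function.update_self]
      refine ContMDiffWithinAt.smul_section (contMDiffWithinAt_const.mul ?_)
        ((hC _).mono inter_subset_left x hx)
      exact (hF.mono inter_subset_left x hx).inv₀ hx.2
    · rw [Function.update_of_ne hj]
      exact (hC j).mono inter_subset_left x hx
  · intro x hx
    have hupd : (fun j ↦ Function.update C j₀ (fun x ↦ (r * (F x)⁻¹) • C j₀ x) j x) =
        Function.update (fun j ↦ C j x) j₀ ((r * (F x)⁻¹) • C j₀ x) := by
      funext j
      by_cases hj : j = j₀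
      · subst hj
        simp
      · simp [hj]
    rw [hupd, AlternatingMap.map_update_smul, Function.update_eq_self, smul_eq_mul, mul_assoc]
    exact (congrArg (r * ·) (inv_mul_cancel₀ hx.2)).trans (mul_one r)

/-- A parallel endomorphism has a kernel preserved by the connection. -/
lemma IsNullKahler.map_leviCivita_kerVec (h : IsNullKahler g N) (hD : IsOpen D)
    (hC : ∀ j, SmoothOn (C j) D)
    (hc : ∀ x ∈ D, wedgeAlt (fundBilin g N x) n (fun j ↦ C j x) ≠ 0) {x : M} (hx : x ∈ D)
    (v : TangentSpace (𝓡 (4 * n)) x) (i : Fin (2 * n)) :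
    N x (leviCivita g (fun y ↦ kerVec g N y (fun j ↦ C j y) i) x v) = 0 := by
  rw [← h.parallel x _ ((h.smoothOn_kerVec hC hc i).smoothNear hD hx)]
  simp only [h.map_kerVec]
  exact leviCivita_zero g v

/-- The connection form of an adapted frame on which `Ω^{∧n}` is constant has trace zero on the
kernel of `N`. -/
lemma IsNullKahler.sum_val_leviCivita_kerVec (h : IsNullKahler g N) (hD : IsOpen D)
    (hC : ∀ j, SmoothOn (C j) D) {r : ℝ} (hr : r ≠ 0)
    (hc : ∀ x ∈ D, wedgeAlt (fundBilin g N x) n (fun j ↦ C j x) = r) {x : M} (hx : x ∈ D)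
    (v : TangentSpace (𝓡 (4 * n)) x) :
    ∑ i, g.val x (leviCivita g (fun y ↦ kerVec g N y (fun j ↦ C j y) i) x v)
      (coVec g N x (fun j ↦ C j x) i) = 0 := by
  have hc0 : ∀ x ∈ D, wedgeAlt (fundBilin g N x) n (fun j ↦ C j x) ≠ 0 := fun x hx ↦ by
    rw [hc x hx]
    exact hr
  have hw := fun i ↦ (h.smoothOn_kerVec hC hc0 i).smoothNear hD hx
  have hu := fun i ↦ (h.smoothOn_coVec hC hc0 i).smoothNear hD hx
  have h1 : ∀ i, g.val x (leviCivita g (fun y ↦ kerVec g N y (fun j ↦ C j y) i) x v)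
      -- Differentiating the constant `g(w_i, u_i) = 1 / 2` moves the derivative from `kerVec` to
      -- `coVec`.
      (coVec g N x (fun j ↦ C j x) i) =
      -g.val x (leviCivita g (fun y ↦ coVec g N y (fun j ↦ C j y) i) x v)
        (kerVec g N x (fun j ↦ C j x) i) := fun i ↦ by
    have hm := leviCivita_metric g (hw i).mdifferentiableAt (hu i).mdifferentiableAt v
    have hconst : (fun y ↦ g.val y (kerVec g N y (fun j ↦ C j y) i)
        (coVec g N y (fun j ↦ C j y) i)) =ᶠ[𝓝 x] fun _ ↦ 1 / 2 := by
      filter_upwards [hD.mem_nhds hx] with y hy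
      rw [h.val_kerVec_coVec (hc0 y hy), if_pos rfl]
    rw [dirDeriv_congr hconst, dirDeriv_const, g.symm x (kerVec g N x _ i)] at hm
    linarith
  -- The parallel form is constant on `coVec`, so the sum of its values with one entry
  -- differentiated is zero; that sum is `2 r` times the trace of the derivatives of `coVec`.
  have h2 := h.isParallelForm_fundPower x (fun i y ↦ coVec g N y (fun j ↦ C j y) i) hu v
  have hconst : (fun y ↦ fundPower g N y fun i ↦ coVec g N y (fun j ↦ C j y) i) =ᶠ[𝓝 x]
      fun _ ↦ r := by
    filter_upwards [hD.mem_nhds hx] with y hy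
    rw [fundPower_eq, h.wedgeAlt_coVec, hc y hy]
  rw [dirDeriv_congr hconst, dirDeriv_const] at h2
  simp only [fundPower_eq, h.wedgeAlt_update_coVec (hc0 x hx), hc x hx] at h2
  rw [← Finset.sum_mul, ← Finset.mul_sum] at h2
  simp only [h1, Finset.sum_neg_distrib, neg_eq_zero]
  have := (mul_eq_zero.1 h2.symm).resolve_right hr
  linarith

lemma gamma_single_inr_vac (i : Fin (2 * n)) :
    gamma (Pi.single (Sum.inr i) 1) (vac n) = gamma (Pi.single (Sum.inl i) 1) (vac n) := by
  rw [gamma_single_inl, gamma_single_inr]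
  simp [annih_vac]

/-- The connection form of an adapted frame on which `Ω^{∧n}` is constant annihilates the
vacuum. -/
lemma IsNullKahler.connection_vac (h : IsNullKahler g N) (hD : IsOpen D)
    (hC : ∀ j, SmoothOn (C j) D) {r : ℝ} (hr : r ≠ 0)
    (hc : ∀ x ∈ D, wedgeAlt (fundBilin g N x) n (fun j ↦ C j x) = r) {x : M} (hx : x ∈ D)
    (v : TangentSpace (𝓡 (4 * n)) x) :
    ∑ a, ∑ b, (eta a * eta b * g.val x (nullFrame g N x (fun j ↦ C j x) a)
      (leviCivita g (fun y ↦ nullFrame g N y (fun j ↦ C j y) b) x v)) •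
        gamma (Pi.single a 1) (gamma (Pi.single b 1) (vac n)) = 0 := by
  have hc0 : ∀ x ∈ D, wedgeAlt (fundBilin g N x) n (fun j ↦ C j x) ≠ 0 := fun x hx ↦ by
    rw [hc x hx]
    exact hr
  set e := nullFrame g N x fun j ↦ C j x with he
  have hw := fun i ↦ ((h.smoothOn_kerVec hC hc0 i).smoothNear hD hx).mdifferentiableAt
  have hu := fun i ↦ ((h.smoothOn_coVec hC hc0 i).smoothNear hD hx).mdifferentiableAt
  have hf := fun a ↦ ((h.smoothOn_nullFrame hC hc0 a).smoothNear hD hx).mdifferentiableAt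
  let W : Fin (2 * n) → TangentSpace (𝓡 (4 * n)) x := fun i ↦
    leviCivita g (fun y ↦ kerVec g N y (fun j ↦ C j y) i) x v
  let E : Idx n → TangentSpace (𝓡 (4 * n)) x := fun b ↦
    leviCivita g (fun y ↦ nullFrame g N y (fun j ↦ C j y) b) x v
  -- The frame vectors `u_i + w_i` and `u_i - w_i` act on the vacuum by the same spinor but enter
  -- with opposite signs `eta`. Only the derivative of their difference `2 w_i` survives.
  have hE : ∀ i, E (Sum.inl i) = E (Sum.inr i) + (2 : ℝ) • W i := fun i ↦ by
    have h1 := leviCivita_add g (hu i) (hw i) v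
    have h2 := leviCivita_add g (hf (Sum.inr i)) (hw i) v
    have h3 : ((fun y ↦ nullFrame g N y (fun j ↦ C j y) (Sum.inr i)) +
        fun y ↦ kerVec g N y (fun j ↦ C j y) i : VField n M) =
        fun y ↦ coVec g N y (fun j ↦ C j y) i := by
      funext y
      simp [nullFrame]
    rw [h3] at h2
    rw [h2] at h1
    refine Eq.trans h1 ?_
    simp only [E, W]
    module
  have hstep : ∀ y : TangentSpace (𝓡 (4 * n)) x, ∀ φ : Spinor n,
      ∑ a, (eta a * g.val x (e a) y) • gamma (Pi.single a 1) φ = gamma (frameComp g x e y) φ := by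
    intro y φ
    conv_rhs => rw [pi_eq_sum_univ' (frameComp g x e y)]
    rw [map_sum, LinearMap.sum_apply]
    refine Finset.sum_congr rfl fun a _ ↦ ?_
    rw [map_smul, LinearMap.smul_apply, frameComp, g.symm]
  -- As `∇w_i` stays in `Ker N`, it kills the vacuum, and the Clifford relation leaves the scalar `2
  -- g(∇w_i, u_i + w_i)`, in which the `w_i` term is zero.
  have hW : ∀ i, gamma (frameComp g x e (W i)) (gamma (Pi.single (Sum.inl i) 1) (vac n)) =
      (2 * g.val x (W i) (coVec g N x (fun j ↦ C j x) i)) • vac n := fun i ↦ by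
    have hN := h.map_leviCivita_kerVec hD hC hc0 hx v i
    have h1 := congrArg (fun T ↦ T (vac n))
      (gamma_clifford (frameComp g x e (W i)) (Pi.single (Sum.inl i) 1))
    have h2 := (h.gamma_vac_eq_zero_iff (hc0 x hx) (W i)).2 hN
    simp only [LinearMap.add_apply, Module.End.mul_apply, LinearMap.smul_apply,
      Module.End.one_apply] at h1
    rw [h2, map_zero, add_zero, ← stdBilin_apply, stdBilin_single_right] at h1
    rw [h1]
    have h3 : g.val x (W i) (kerVec g N x (fun j ↦ C j x) i) = 0 := by
      rw [g.symm]
      exact h.val_kerVec_of_ker i hN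
    simp only [frameComp, he, nullFrame, Sum.elim_inl, eta, map_add, h3]
    congr 1
    ring
  rw [Finset.sum_comm]
  have hb : ∀ b, ∑ a, (eta a * eta b * g.val x (e a) (E b)) •
      gamma (Pi.single a 1) (gamma (Pi.single b 1) (vac n)) =
      (eta b : ℝ) • gamma (frameComp g x e (E b)) (gamma (Pi.single b 1) (vac n)) := fun b ↦ by
    rw [← hstep, Finset.smul_sum]
    refine Finset.sum_congr rfl fun a _ ↦ ?_
    rw [smul_smul]
    congr 1
    ring
  refine (Finset.sum_congr rfl fun b _ ↦ hb b).trans ?_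
  rw [Fintype.sum_sum_type, ← Finset.sum_add_distrib]
  have hi : ∀ i, (eta (Sum.inl i : Idx n) : ℝ) • gamma (frameComp g x e (E (Sum.inl i)))
        (gamma (Pi.single (Sum.inl i) 1) (vac n)) +
      (eta (Sum.inr i : Idx n) : ℝ) • gamma (frameComp g x e (E (Sum.inr i)))
        (gamma (Pi.single (Sum.inr i) 1) (vac n)) =
      (4 * g.val x (W i) (coVec g N x (fun j ↦ C j x) i)) • vac n := fun i ↦ by
    rw [gamma_single_inr_vac, hE, ← frameCompLin_apply, ← frameCompLin_apply, map_add, map_smul,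
      map_add, map_smul, frameCompLin_apply, frameCompLin_apply, LinearMap.add_apply,
      LinearMap.smul_apply, hW]
    simp only [eta, Sum.elim_inl, Sum.elim_inr]
    module
  simp only [hi]
  rw [← Finset.sum_smul, ← Finset.mul_sum, h.sum_val_leviCivita_kerVec hD hC hr hc hx v, mul_zero,
    zero_smul]

/-- A null–Kähler manifold has a spin structure with a parallel pure spinor field that corresponds
to `Ω^{∧n}`. -/
theorem IsNullKahler.exists_parallel_pure_spinor (h : IsNullKahler g N) (hn : 0 < n) :
    ∃ (P : SpinStructure g) (ψ : SpinorField P),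
      ψ.IsPosPure ∧ ψ.IsParallel ∧ ψ.AnnihilatorEqKer N ∧ ψ.CorrespondsTo (fundPower g N) := by
  -- The constant value of `Ω^{∧n}` is chosen to be that of the vacuum form on `creVec`, so that the
  -- vacuum represents `Ω^{∧n}` exactly.
  choose C D hD hxD hC hc using
    fun x ↦ h.exists_local_complement hn (r := spinorAlt (vac n) creVec) x
  have hκ := spinorAlt_vac_creVec_ne_zero n
  have hc0 : ∀ i, ∀ x ∈ D i, wedgeAlt (fundBilin g N x) n (fun j ↦ C i j x) ≠ 0 :=
    fun i x hx ↦ by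
      rw [hc i x hx]
      exact hκ
  have hF := fun i x (hx : x ∈ D i) ↦ h.isSpinorFrame_nullFrame (hc i x hx)
  refine ⟨spinStructureOfFrames hn D hD (fun x ↦ ⟨x, hxD x⟩)
    (fun i a x ↦ nullFrame g N x (fun j ↦ C i j x) a)
    (fun i ↦ h.smoothOn_nullFrame (hC i) (hc0 i)) (fun _ _ ↦ vac n)
    (fun _ ↦ contMDiffOn_const) hF,
    spinorFieldOfFrames hn D hD (fun x ↦ ⟨x, hxD x⟩)
    (fun i a x ↦ nullFrame g N x (fun j ↦ C i j x) a)
    (fun i ↦ h.smoothOn_nullFrame (hC i) (hc0 i)) (fun _ _ ↦ vac n)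
    (fun _ ↦ contMDiffOn_const) hF, ?_, ?_, ?_, ?_⟩
  · exact fun _ _ _ ↦ ⟨isPosSemiSpinor_vac n, Or.inl (isPosSemiSpinor_vac n),
      finrank_annihilator_vac n⟩
  · intro i x hx v
    have h1 := h.connection_vac (hD i) (hC i) hκ (hc i) hx v
    -- The components are constant, so only the connection term could contribute, and it annihilates
    -- the vacuum.
    have h2 : mfderiv (𝓡 (4 * n)) 𝓘(ℝ, Spinor n) (fun _ : M ↦ vac n) x v = 0 := by
      rw [mfderiv_const]
      rfl
    unfold SpinorField.covDeriv
    refine (congrArg₂ (fun p q : Spinor n ↦ p + (1 / 4 : ℝ) • q) h2 h1).trans ?_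
    exact (zero_add ((1 / 4 : ℝ) • (0 : Spinor n))).trans (smul_zero _)
  · exact fun i x hx v ↦ h.gamma_vac_eq_zero_iff (hc0 i x hx) v
  · intro i x hx z
    rw [spinorForm_eq]
    exact (hF i x hx).form z

end ParallelSpinor

end NullKahler

theorem mainTheorem8 {n : ℕ} (hn : 0 < n) {M : Type u} [TopologicalSpace M] [T2Space M]
    [SecondCountableTopology M] [ChartedSpace (NullKahler.Model n) M]
    [IsManifold (𝓡 (4 * n)) ∞ M] (g : NullKahler.SplitMetric n M) (N : NullKahler.EndField n M)
    (h : NullKahler.IsNullKahler g N) :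
    NullKahler.IsParallelForm g (NullKahler.fundPower g N) ∧
    (∃ (P : NullKahler.SpinStructure g) (ψ : NullKahler.SpinorField P),
      ψ.IsPosPure ∧ ψ.IsParallel ∧ ψ.AnnihilatorEqKer N ∧
        ψ.CorrespondsTo (NullKahler.fundPower g N)) ∧
    (∀ (P P' : NullKahler.SpinStructure g) (ψ : NullKahler.SpinorField P)
      (ψ' : NullKahler.SpinorField P'),
      ψ.IsPosPure → ψ.CorrespondsTo (NullKahler.fundPower g N) →
      ψ'.IsPosPure → ψ'.CorrespondsTo (NullKahler.fundPower g N) →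
      ∃ T : NullKahler.SpinIso P P', T.Carries ψ ψ') := by
  exact ⟨h.isParallelForm_fundPower, h.exists_parallel_pure_spinor hn,
    fun _ _ _ _ hp hc hp' hc' ↦ NullKahler.exists_spinIso_carries hn hp hc hp' hc'⟩
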